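/- **Theorem (Optimal Linear Arrangement parameterized by vertex cover is fixed-parameter tractable).** For a finite simple undirected graph $G$ on $n$ vertices, a *layout* is a bijection $\sigma : V(G) \to \{1,\dots,n\}$, and its *cost* is $\mathrm{val}(\sigma,G)=\sum_{uv\in E(G)}|\sigma(u)-\sigma(v)|$; a layout is *optimal* if its cost is minimum among all layouts of $G$. A *vertex cover* of $G$ is a set of vertices containing at least one endpoint of every edge. There exist a single algorithm, a function $f:\mathbb{N}\to\mathbb{N}$ and a constant $c\in\mathbb{N}$ such that the following holds for all integers $n,k\ge 0$ and every graph $G$ with vertex set $\{0,\dots,n-1\}$. Given $n$, $k$ and the adjacency matrix of $G$ as input, the algorithm halts after at most $f(k)\cdot(n+1)^{c}$ steps, and if $G$ has a vertex cover of size at most $k$, then its output is an optimal layout $\sigma$ of $G$ (given as the list of the values of $\sigma$ on the vertices $0,\dots,n-1$). Here an algorithm is a program in the WHILE language over finite binary trees of cons cells (copying a reference, the constant nil, cons, head, tail, composition, nil-test, while-loop), each of these operations costing one step; this running time is polynomially related to that of Turing machines. Numbers are given as unary lists, and the matrix as the list of its rows. -/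

import Mathlib

/-- Data of the machine model: finite binary trees ("S-expressions"), as in Lisp. -/
inductive Data : Type
  | nil : Data
  | cons : Data → Data → Data

namespace Data

/-- Head of a cons cell; by convention the head of `nil` is `nil`. -/
def head : Data → Data
  | nil => nil
  | cons a _ => a

/-- Tail of a cons cell; by convention the tail of `nil` is `nil`. -/
def tail : Data → Data
  | nil => nil
  | cons _ b => b

/-- Natural numbers, written in unary: `n` is the list of `n` copies of `nil`. -/
def ofNat : ℕ → Data
  | 0 => nil
  | n + 1 => cons nil (ofNat n)

/-- Lists, as `nil`-terminated chains of cons cells. -/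
def ofList : List Data → Data
  | [] => nil
  | a :: l => cons a (ofList l)

end Data

/-- Programs of the WHILE language over cons cells (in variable-free form: a program maps the
current datum to a new one). A program is a finite piece of syntax; its only primitives are
copying a reference (`id`), the constant `nil`, allocating a cons cell, taking head and tail, and
testing whether a datum is `nil`. -/
inductive Prog : Type
  /-- return the current datum -/
  | id : Prog
  /-- return `nil` -/
  | nil : Prog
  /-- return the head of the current datum -/
  | head : Prog
  /-- return the tail of the current datum -/
  | tail : Prog
  /-- run both programs on the current datum and return the cons cell of the two results -/
  | cons : Prog → Prog → Prog
  /-- run the first program, then run the second one on its result -/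
  | seq : Prog → Prog → Prog
  /-- `ite c p q`: run `p` if the result of `c` is not `nil`, and `q` otherwise -/
  | ite : Prog → Prog → Prog → Prog
  /-- `while c p`: as long as the result of `c` is not `nil`, replace the current datum by the
  result of `p` -/
  | while : Prog → Prog → Prog

/-- `Prog.Eval P d e t`: the program `P`, started on the datum `d`, halts with result `e` after
exactly `t` elementary steps. Every primitive, every composition, every allocation of a cons cell
and every test costs one step. Each step is a constant number of pointer operations on a heap of
cons cells, so that this running time is polynomially related to that of Turing machines. -/
inductive Prog.Eval : Prog → Data → Data → ℕ → Prop
  | id (d : Data) : Prog.Eval .id d d 1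
  | nil (d : Data) : Prog.Eval .nil d .nil 1
  | head (d : Data) : Prog.Eval .head d d.head 1
  | tail (d : Data) : Prog.Eval .tail d d.tail 1
  | cons {p q : Prog} {d a b : Data} {s t : ℕ} :
      Prog.Eval p d a s → Prog.Eval q d b t →
      Prog.Eval (.cons p q) d (.cons a b) (s + t + 1)
  | seq {p q : Prog} {d a b : Data} {s t : ℕ} :
      Prog.Eval p d a s → Prog.Eval q a b t →
      Prog.Eval (.seq p q) d b (s + t + 1)
  | ite_true {c p q : Prog} {d x y e : Data} {s t : ℕ} :
      Prog.Eval c d (.cons x y) s → Prog.Eval p d e t →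
      Prog.Eval (.ite c p q) d e (s + t + 1)
  | ite_false {c p q : Prog} {d e : Data} {s t : ℕ} :
      Prog.Eval c d .nil s → Prog.Eval q d e t →
      Prog.Eval (.ite c p q) d e (s + t + 1)
  | while_stop {c p : Prog} {d : Data} {s : ℕ} :
      Prog.Eval c d .nil s →
      Prog.Eval (.while c p) d d (s + 1)
  | while_step {c p : Prog} {d x y a e : Data} {s t u : ℕ} :
      Prog.Eval c d (.cons x y) s → Prog.Eval p d a t → Prog.Eval (.while c p) a e u →
      Prog.Eval (.while c p) d e (s + t + u + 1)

/-- Programs are deterministic: the result and the running time are unique. -/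
theorem Prog.Eval.unique {P : Prog} {d e e' : Data} {t t' : ℕ}
    (h : Prog.Eval P d e t) (h' : Prog.Eval P d e' t') : e = e' ∧ t = t' := by
  induction h generalizing e' t' with
  | id | nil | head | tail => cases h'; exact ⟨rfl, rfl⟩
  | cons _ _ ih₁ ih₂ =>
    cases h' with
    | cons h₁ h₂ =>
      obtain ⟨rfl, rfl⟩ := ih₁ h₁
      obtain ⟨rfl, rfl⟩ := ih₂ h₂
      exact ⟨rfl, rfl⟩
  | seq _ _ ih₁ ih₂ =>
    cases h' with
    | seq h₁ h₂ =>
      obtain ⟨rfl, rfl⟩ := ih₁ h₁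
      obtain ⟨rfl, rfl⟩ := ih₂ h₂
      exact ⟨rfl, rfl⟩
  | ite_true _ _ ih₁ ih₂ =>
    cases h' with
    | ite_true h₁ h₂ =>
      obtain ⟨_, rfl⟩ := ih₁ h₁
      obtain ⟨rfl, rfl⟩ := ih₂ h₂
      exact ⟨rfl, rfl⟩
    | ite_false h₁ h₂ => exact absurd (ih₁ h₁).1 (by simp)
  | ite_false _ _ ih₁ ih₂ =>
    cases h' with
    | ite_true h₁ h₂ => exact absurd (ih₁ h₁).1 (by simp)
    | ite_false h₁ h₂ =>
      obtain ⟨_, rfl⟩ := ih₁ h₁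
      obtain ⟨rfl, rfl⟩ := ih₂ h₂
      exact ⟨rfl, rfl⟩
  | while_stop _ ih₁ =>
    cases h' with
    | while_stop h₁ =>
      obtain ⟨_, rfl⟩ := ih₁ h₁
      exact ⟨rfl, rfl⟩
    | while_step h₁ h₂ h₃ => exact absurd (ih₁ h₁).1 (by simp)
  | while_step _ _ _ ih₁ ih₂ ih₃ =>
    cases h' with
    | while_stop h₁ => exact absurd (ih₁ h₁).1 (by simp)
    | while_step h₁ h₂ h₃ =>
      obtain ⟨_, rfl⟩ := ih₁ h₁
      obtain ⟨rfl, rfl⟩ := ih₂ h₂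
      obtain ⟨rfl, rfl⟩ := ih₃ h₃
      exact ⟨rfl, rfl⟩

namespace OLA

/-- The adjacency matrix of `G`, as the list of its rows; entries are the numbers `0` and `1`. -/
noncomputable def encodeGraph {n : ℕ} (G : SimpleGraph (Fin n)) : Data :=
  open Classical in
  Data.ofList (List.ofFn fun u : Fin n =>
    Data.ofList (List.ofFn fun v : Fin n => Data.ofNat (if G.Adj u v then 1 else 0)))

/-- An input: the number of vertices, the parameter and the graph. -/
noncomputable def encodeInput {n : ℕ} (G : SimpleGraph (Fin n)) (k : ℕ) : Data :=
  Data.ofList [Data.ofNat n, Data.ofNat k, encodeGraph G]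

/-- The position of the vertex `v`, a number in `{1, …, n}`, in the layout `σ`. -/
def pos {n : ℕ} (σ : Equiv.Perm (Fin n)) (v : Fin n) : ℕ := (σ v : ℕ) + 1

/-- An output: the list of the positions of the vertices `0, …, n - 1`. -/
def encodeLayout {n : ℕ} (σ : Equiv.Perm (Fin n)) : Data :=
  Data.ofList (List.ofFn fun v : Fin n => Data.ofNat (pos σ v))

/-- The cost of a layout: the sum of `|σ(u) - σ(v)|` over all edges `uv`. -/
noncomputable def cost {n : ℕ} (G : SimpleGraph (Fin n)) (σ : Equiv.Perm (Fin n)) : ℤ :=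
  open Classical in
  ∑ e ∈ G.edgeFinset,
    Sym2.lift ⟨fun u v => |(pos σ u : ℤ) - (pos σ v : ℤ)|, fun _ _ => abs_sub_comm _ _⟩ e

/-- An optimal linear arrangement of `G`: a layout of minimum cost. -/
def IsOptimal {n : ℕ} (G : SimpleGraph (Fin n)) (σ : Equiv.Perm (Fin n)) : Prop :=
  ∀ τ : Equiv.Perm (Fin n), cost G σ ≤ cost G τ

end OLA

/-! Call two vertices twins if they have the same neighbours. A graph with a vertex cover of size at
most `k` has at most `k + 2 ^ k` twin classes. If `u` stands immediately before `v` and both are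
outside the cover, swapping them changes the cost by a difference of slopes (`cost_swap`). In a
suitable optimal layout slopes therefore decrease between cover vertices, with ties sorted by class,
and such a layout splits into boundedly many runs of twins (`exists_optimal_few_runs`). A layout is
then described by the sizes `x` of `m` labelled blocks, with `m` bounded in terms of `k`, and twice
its cost is a cubic form in `x` with coefficients 0, 1, 2 (`two_mul_cost_eq_cubic`). It remains to
minimise this form over nonnegative integer vectors with prescribed class sums.

Two completely joined classes cannot both have more than `k` vertices. Hence blocks of size above a
threshold `M` interact only with blocks of size at most `k`. Once the entries up to `M` are guessed,
the form is quadratic in the remaining ones, with a Hessian `H` bounded in terms of `k` and `m`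
alone. Among the minimisers take one with the largest sum of squares. Shifting it by `y` and by `-y`
shows that `H` is positive on the nonzero short vectors with vanishing class sums
(`IsSpreadMin.second_order`). If the radical of `H` on all such vectors were nonzero, Siegel's lemma
would give a short vector in it, a contradiction. So a vector of large entries is determined by its
class sums and its differences of marginal costs (`IsSpreadMin.injective`).

The large part of the minimiser, divided by `2 ^ t` and rounded down, is almost stationary and has
almost the right class sums, with an error bounded in terms of `k` and `m`
(`IsSpreadMin.stationary`). By injectivity only boundedly many vectors pass both tests at a given
scale (`length_le_cap`). The large part is thus found one binary digit at a time: start at a scale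
where it is zero, append all possible digits, keep what passes the tests. The candidate of least
energy over all guesses gives an optimal layout (`solve_spec`).

For the running time, `Comp` is a calculus of functions computable in fixed-parameter time, closed
under folds, branching and substitution. `solve` is written within it, which yields the program
(`comp_solve`). -/

/-- Types whose elements are represented by data. -/
class Enc (α : Type) where
  enc : α → Data

instance : Enc Data := ⟨id⟩

instance : Enc Unit := ⟨fun _ => .nil⟩

instance : Enc ℕ := ⟨Data.ofNat⟩

instance : Enc Bool := ⟨fun b => if b then .cons .nil .nil else .nil⟩

instance {α : Type} [Enc α] : Enc (List α) := ⟨fun l => Data.ofList (l.map Enc.enc)⟩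

instance {α β : Type} [Enc α] [Enc β] : Enc (α × β) :=
  ⟨fun p => .cons (Enc.enc p.1) (Enc.enc p.2)⟩

/-! ### Functions computable in fixed-parameter time, and their closure properties. -/

namespace FPT

open Enc (enc)

/-- A family of instances: size, parameter, and the datum that represents the instance. -/
class Ctx (ι : Type) where
  size : ι → ℕ
  param : ι → ℕ
  inp : ι → Data

/-- Instances together with a further value subject to a condition. -/
structure Ext (ι α : Type) (P : ι → α → Prop) where
  fst : ι
  snd : α
  prop : P fst snd

/-- Size and parameter ignore the local value, so a bound over the extended family is uniform in
that value. The condition `P` is what makes such bounds possible: it carries the invariants that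
limit the value. -/
instance {ι α : Type} [Ctx ι] [Enc α] {P : ι → α → Prop} : Ctx (Ext ι α P) where
  size e := Ctx.size e.fst
  param e := Ctx.param e.fst
  inp e := .cons (Ctx.inp e.fst) (enc e.snd)

/-- Functions bounded by `f(k) * (n + 1) ^ c`. -/
def Bdd {ι : Type} [Ctx ι] (a : ι → ℕ) : Prop :=
  ∃ (f : ℕ → ℕ) (c : ℕ), ∀ i, a i ≤ f (Ctx.param i) * (Ctx.size i + 1) ^ c

/-- Functions bounded in terms of the parameter. -/
def PBdd {ι : Type} [Ctx ι] (a : ι → ℕ) : Prop :=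
  ∃ f : ℕ → ℕ, ∀ i, a i ≤ f (Ctx.param i)

/-- The program `P` turns `d` into `e` in at most `T` steps. -/
def Run (P : Prog) (d e : Data) (T : ℕ) : Prop := ∃ t ≤ T, P.Eval d e t

/-- Functions computed by a program in fixed-parameter tractable time. -/
def Comp {ι α : Type} [Ctx ι] [Enc α] (g : ι → α) : Prop :=
  ∃ (P : Prog) (T : ι → ℕ), Bdd T ∧ ∀ i, Run P (Ctx.inp i) (enc (g i)) (T i)

section Bounds

variable {ι α : Type} [Ctx ι]

theorem Bdd.mono {a b : ι → ℕ} (hb : Bdd b) (h : ∀ i, a i ≤ b i) : Bdd a := by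
  obtain ⟨f, c, hf⟩ := hb
  exact ⟨f, c, fun i => (h i).trans (hf i)⟩

theorem PBdd.mono {a b : ι → ℕ} (hb : PBdd b) (h : ∀ i, a i ≤ b i) : PBdd a := by
  obtain ⟨f, hf⟩ := hb
  exact ⟨f, fun i => (h i).trans (hf i)⟩

theorem PBdd.bdd {a : ι → ℕ} (ha : PBdd a) : Bdd a := by
  obtain ⟨f, hf⟩ := ha
  exact ⟨f, 0, fun i => by simpa using hf i⟩

/-- No monotonicity of `h` is needed: its maximum over a finite box depending on the parameter is a
bound. -/
theorem PBdd.comp₂ {a b : ι → ℕ} (ha : PBdd a) (hb : PBdd b) (h : ℕ → ℕ → ℕ) :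
    PBdd (fun i => h (a i) (b i)) := by
  obtain ⟨f, hf⟩ := ha
  obtain ⟨f', hf'⟩ := hb
  refine ⟨fun k => (Finset.range (f k + 1) ×ˢ Finset.range (f' k + 1)).sup fun p => h p.1 p.2,
    fun i => ?_⟩
  exact Finset.le_sup (f := fun p : ℕ × ℕ => h p.1 p.2) (b := (a i, b i))
    (Finset.mem_product.2 ⟨Finset.mem_range.2 (Nat.lt_succ_of_le (hf i)),
      Finset.mem_range.2 (Nat.lt_succ_of_le (hf' i))⟩)

theorem PBdd.param : PBdd (fun i : ι => Ctx.param i) := ⟨fun k => k, fun _ => le_rfl⟩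

theorem PBdd.const (a : ℕ) : PBdd (fun _ : ι => a) := ⟨fun _ => a, fun _ => le_rfl⟩

theorem PBdd.ext [Enc α] {a : ι → ℕ} (ha : PBdd a) {P : ι → α → Prop} :
    PBdd (fun e : Ext ι α P => a e.fst) := by
  obtain ⟨f, hf⟩ := ha
  exact ⟨f, fun e => hf e.fst⟩

theorem PBdd.add {a b : ι → ℕ} (ha : PBdd a) (hb : PBdd b) : PBdd (fun i => a i + b i) :=
  ha.comp₂ hb (· + ·)

theorem PBdd.mul {a b : ι → ℕ} (ha : PBdd a) (hb : PBdd b) : PBdd (fun i => a i * b i) :=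
  ha.comp₂ hb (· * ·)

theorem PBdd.pow {a b : ι → ℕ} (ha : PBdd a) (hb : PBdd b) : PBdd (fun i => a i ^ b i) :=
  ha.comp₂ hb (· ^ ·)

theorem Bdd.const (a : ℕ) : Bdd (fun _ : ι => a) := (PBdd.const a).bdd

theorem Bdd.size : Bdd (fun i : ι => Ctx.size i) := ⟨fun _ => 1, 1, fun i => by simp⟩

theorem Bdd.ext [Enc α] {a : ι → ℕ} (ha : Bdd a) {P : ι → α → Prop} :
    Bdd (fun e : Ext ι α P => a e.fst) := by
  obtain ⟨f, c, hf⟩ := ha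
  exact ⟨f, c, fun e => hf e.fst⟩

theorem Bdd.add {a b : ι → ℕ} (ha : Bdd a) (hb : Bdd b) : Bdd (fun i => a i + b i) := by
  obtain ⟨f, c, hf⟩ := ha
  obtain ⟨f', c', hf'⟩ := hb
  refine ⟨fun k => f k + f' k, c + c', fun i => ?_⟩
  have h₁ : (Ctx.size i + 1) ^ c ≤ (Ctx.size i + 1) ^ (c + c') :=
    Nat.pow_le_pow_right (Nat.succ_pos _) (by omega)
  have h₂ : (Ctx.size i + 1) ^ c' ≤ (Ctx.size i + 1) ^ (c + c') :=
    Nat.pow_le_pow_right (Nat.succ_pos _) (by omega)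
  rw [add_mul]
  exact add_le_add ((hf i).trans (Nat.mul_le_mul_left _ h₁))
    ((hf' i).trans (Nat.mul_le_mul_left _ h₂))

theorem Bdd.mul {a b : ι → ℕ} (ha : Bdd a) (hb : Bdd b) : Bdd (fun i => a i * b i) := by
  obtain ⟨f, c, hf⟩ := ha
  obtain ⟨f', c', hf'⟩ := hb
  refine ⟨fun k => f k * f' k, c + c', fun i => ?_⟩
  calc a i * b i ≤ _ := Nat.mul_le_mul (hf i) (hf' i)
    _ = _ := by rw [pow_add]; ring

end Bounds

section Programs

variable {ι α β γ : Type} [Ctx ι] [Enc α] [Enc β] [Enc γ]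

theorem Run.mono {P : Prog} {d e : Data} {S T : ℕ} (h : Run P d e S) (hST : S ≤ T) :
    Run P d e T := by
  obtain ⟨t, ht, h⟩ := h
  exact ⟨t, ht.trans hST, h⟩

theorem Run.id (d : Data) : Run .id d d 1 := ⟨1, le_rfl, .id d⟩

theorem Run.nil (d : Data) : Run .nil d .nil 1 := ⟨1, le_rfl, .nil d⟩

theorem Run.head (d : Data) : Run .head d d.head 1 := ⟨1, le_rfl, .head d⟩

theorem Run.tail (d : Data) : Run .tail d d.tail 1 := ⟨1, le_rfl, .tail d⟩

theorem Run.cons {P Q : Prog} {d a b : Data} {S T : ℕ} (h : Run P d a S) (h' : Run Q d b T) :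
    Run (.cons P Q) d (.cons a b) (S + T + 1) := by
  obtain ⟨s, hs, h⟩ := h
  obtain ⟨t, ht, h'⟩ := h'
  exact ⟨s + t + 1, by omega, .cons h h'⟩

theorem Run.seq {P Q : Prog} {d a b : Data} {S T : ℕ} (h : Run P d a S) (h' : Run Q a b T) :
    Run (.seq P Q) d b (S + T + 1) := by
  obtain ⟨s, hs, h⟩ := h
  obtain ⟨t, ht, h'⟩ := h'
  exact ⟨s + t + 1, by omega, .seq h h'⟩

theorem Run.ite_true {C P Q : Prog} {d x y e : Data} {S T : ℕ} (h : Run C d (.cons x y) S)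
    (h' : Run P d e T) : Run (.ite C P Q) d e (S + T + 1) := by
  obtain ⟨s, hs, h⟩ := h
  obtain ⟨t, ht, h'⟩ := h'
  exact ⟨s + t + 1, by omega, .ite_true h h'⟩

theorem Run.ite_false {C P Q : Prog} {d e : Data} {S T : ℕ} (h : Run C d .nil S)
    (h' : Run Q d e T) : Run (.ite C P Q) d e (S + T + 1) := by
  obtain ⟨s, hs, h⟩ := h
  obtain ⟨t, ht, h'⟩ := h'
  exact ⟨s + t + 1, by omega, .ite_false h h'⟩

theorem Comp.congr {g g' : ι → α} (hg : Comp g) (h : ∀ i, g' i = g i) : Comp g' := by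
  rwa [funext h]

/-- Change of the type of the result without change of the representation. -/
theorem Comp.recode {g : ι → α} (hg : Comp g) {g' : ι → β} (h : ∀ i, enc (g' i) = enc (g i)) :
    Comp g' := by
  obtain ⟨P, T, hT, hP⟩ := hg
  exact ⟨P, T, hT, fun i => by rw [h]; exact hP i⟩

theorem Comp.const_of_enc_nil (a : α) (ha : enc a = .nil) : Comp (fun _ : ι => a) :=
  ⟨.nil, fun _ => 1, .const 1, fun i => by rw [ha]; exact Run.nil _⟩

theorem Comp.pair {g : ι → α} {h : ι → β} (hg : Comp g) (hh : Comp h) :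
    Comp (fun i => (g i, h i)) := by
  obtain ⟨P, S, hS, hP⟩ := hg
  obtain ⟨Q, T, hT, hQ⟩ := hh
  exact ⟨.cons P Q, fun i => S i + T i + 1, (hS.add hT).add (.const 1),
    fun i => (hP i).cons (hQ i)⟩

theorem Comp.proj₁ {g : ι → α × β} (hg : Comp g) : Comp (fun i => (g i).1) := by
  obtain ⟨P, S, hS, hP⟩ := hg
  exact ⟨.seq P .head, fun i => S i + 1 + 1, (hS.add (.const 1)).add (.const 1),
    fun i => (hP i).seq (Run.head _)⟩

theorem Comp.proj₂ {g : ι → α × β} (hg : Comp g) : Comp (fun i => (g i).2) := by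
  obtain ⟨P, S, hS, hP⟩ := hg
  exact ⟨.seq P .tail, fun i => S i + 1 + 1, (hS.add (.const 1)).add (.const 1),
    fun i => (hP i).seq (Run.tail _)⟩

theorem Comp.ext {g : ι → β} (hg : Comp g) {P : ι → α → Prop} :
    Comp (fun e : Ext ι α P => g e.fst) := by
  obtain ⟨Q, S, hS, hQ⟩ := hg
  exact ⟨.seq .head Q, fun e => 1 + S e.fst + 1, ((Bdd.const 1).add hS.ext).add (.const 1),
    fun e => (Run.head _).seq (hQ e.fst)⟩

theorem Comp.var {P : ι → α → Prop} : Comp (fun e : Ext ι α P => e.snd) :=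
  ⟨.tail, fun _ => 1, .const 1, fun _ => Run.tail _⟩

theorem Comp.cons {g : ι → α} {h : ι → List α} (hg : Comp g) (hh : Comp h) :
    Comp (fun i => g i :: h i) :=
  (hg.pair hh).recode fun _ => rfl

theorem Comp.empty : Comp (fun _ : ι => ([] : List α)) := .const_of_enc_nil _ rfl

theorem Comp.listTail {h : ι → List α} (hh : Comp h) : Comp (fun i => (h i).tail) := by
  obtain ⟨P, S, hS, hP⟩ := hh
  refine ⟨.seq P .tail, fun i => S i + 1 + 1, (hS.add (.const 1)).add (.const 1),
    fun i => (hP i).seq ?_⟩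
  dsimp only
  cases h i <;> exact Run.tail _

theorem Comp.headD {h : ι → List α} (hh : Comp h) (d : α) (hd : enc d = .nil) :
    Comp (fun i => (h i).headD d) := by
  obtain ⟨P, S, hS, hP⟩ := hh
  refine ⟨.seq P .head, fun i => S i + 1 + 1, (hS.add (.const 1)).add (.const 1),
    fun i => (hP i).seq ?_⟩
  dsimp only
  cases h i with
  | nil => exact (congrArg (Run _ _ · 1) hd).mpr (Run.head _)
  | cons => exact Run.head _

/-- Branching on a Boolean. -/
theorem Comp.cond {b : ι → Bool} {g h : ι → α} (hb : Comp b) (hg : Comp g) (hh : Comp h) :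
    Comp (fun i => if b i then g i else h i) := by
  obtain ⟨B, R, hR, hB⟩ := hb
  obtain ⟨P, S, hS, hP⟩ := hg
  obtain ⟨Q, T, hT, hQ⟩ := hh
  refine ⟨.ite B P Q, fun i => R i + (S i + T i) + 1, (hR.add (hS.add hT)).add (.const 1),
    fun i => ?_⟩
  have hBi := hB i
  dsimp only
  cases hbi : b i <;> rw [hbi] at hBi
  · exact (hBi.ite_false (hQ i)).mono (by omega)
  · exact (hBi.ite_true (hP i)).mono (by omega)

/-- Branching where either branch is only evaluated when it is taken. -/
theorem Comp.dcond {b : ι → Bool} {g : ι → α} (hb : Comp b)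
    (hg : Comp (fun e : Ext ι Bool (fun i _ => b i = true) => g e.fst))
    (hh : Comp (fun e : Ext ι Bool (fun i _ => b i = false) => g e.fst)) :
    Comp g := by
  obtain ⟨B, R, hR, hB⟩ := hb
  obtain ⟨P, S, ⟨f, c, hS⟩, hP⟩ := hg
  obtain ⟨Q, T, ⟨f', c', hT⟩, hQ⟩ := hh
  -- The branch programs expect an instance paired with a local value; the dummy value is `nil`, the
  -- code of `false`.
  refine ⟨.ite B (.seq (.cons .id .nil) P) (.seq (.cons .id .nil) Q),
    fun i => R i + ((f (Ctx.param i) * (Ctx.size i + 1) ^ c + 10) +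
      (f' (Ctx.param i) * (Ctx.size i + 1) ^ c' + 10)) + 1,
    (hR.add ((Bdd.add ⟨f, c, fun _ => le_rfl⟩ (.const 10)).add
      (Bdd.add ⟨f', c', fun _ => le_rfl⟩ (.const 10)))).add (.const 1), fun i => ?_⟩
  have hBi := hB i
  cases hbi : b i <;> rw [hbi] at hBi
  · have := hT ⟨i, false, hbi⟩
    refine (hBi.ite_false (((Run.id _).cons (Run.nil _)).seq (hQ ⟨i, false, hbi⟩))).mono ?_
    simp only [Ctx.param, Ctx.size] at this ⊢
    omega
  · have := hS ⟨i, false, hbi⟩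
    refine (hBi.ite_true (((Run.id _).cons (Run.nil _)).seq (hP ⟨i, false, hbi⟩))).mono ?_
    simp only [Ctx.param, Ctx.size] at this ⊢
    omega

/-- The loop state is (remaining list, (accumulator, environment)), so that `head` is the loop test.
The body receives (environment, (element, accumulator)), which is the code of an instance extended
by a pair. The bound `T` is only available on states satisfying `Inv`. -/
theorem run_while_foldl {Q : Prog} {env : Data} {f : β → α → β} {T : ℕ} (Inv : β → Prop) :
    ∀ (l : List α) (s : β), Inv s → (∀ a ∈ l, ∀ s, Inv s → Inv (f s a)) →
      (∀ a ∈ l, ∀ s, Inv s → Run Q (.cons env (enc (a, s))) (enc (f s a)) T) →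
      Run (.while .head (.cons (.seq .head .tail) (.cons
          (.seq (.cons (.seq .tail .tail) (.cons (.seq .head .head) (.seq .tail .head))) Q)
          (.seq .tail .tail))))
        (.cons (enc l) (.cons (enc s) env)) (.cons .nil (.cons (enc (l.foldl f s)) env))
        (l.length * (T + 30) + 2) := by
  intro l
  induction l with
  | nil => exact fun s _ _ _ => ⟨2, by simp, Prog.Eval.while_stop (.head _)⟩
  | cons a l ih =>
    intro s hs hInv hQ
    obtain ⟨t, ht, h⟩ := hQ a (by simp) s hs
    obtain ⟨u, hu, h'⟩ := ih (f s a) (hInv a (by simp) s hs)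
      (fun b hb => hInv b (by simp [hb])) (fun b hb => hQ b (by simp [hb]))
    refine ⟨_, ?_, .while_step (.head _) (.cons (.seq (.head _) (.tail _)) (.cons
      (.seq (.cons (.seq (.tail _) (.tail _)) (.cons (.seq (.head _) (.head _))
        (.seq (.tail _) (.head _)))) h) (.seq (.tail _) (.tail _)))) h'⟩
    simp only [List.length_cons, add_mul]
    omega

/-- Iteration along a list, with an invariant of the accumulator. -/
theorem Comp.foldl {L : ι → List α} {s : ι → β} {f : ι → β → α → β} (Inv : ι → β → Prop)
    (hL : Comp L) (hlen : Bdd (fun i => (L i).length)) (hs : Comp s) (h0 : ∀ i, Inv i (s i))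
    (hInv : ∀ i, ∀ a ∈ L i, ∀ s, Inv i s → Inv i (f i s a))
    (hf : Comp (fun e : Ext ι (α × β) (fun i p => p.1 ∈ L i ∧ Inv i p.2) =>
      f e.fst e.snd.2 e.snd.1)) :
    Comp (fun i => (L i).foldl (f i) (s i)) := by
  obtain ⟨P, R, hR, hP⟩ := hL
  obtain ⟨P', S, hS, hP'⟩ := hs
  obtain ⟨Q, T, ⟨g, c, hT⟩, hQ⟩ := hf
  refine ⟨.seq (.cons P (.cons P' .id)) (.seq (.while .head (.cons (.seq .head .tail) (.cons
          (.seq (.cons (.seq .tail .tail) (.cons (.seq .head .head) (.seq .tail .head))) Q)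
          (.seq .tail .tail)))) (.seq .tail .head)),
    fun i => R i + S i + (L i).length * (g (Ctx.param i) * (Ctx.size i + 1) ^ c + 30) + 20,
    ((hR.add hS).add (hlen.mul (Bdd.add ⟨g, c, fun _ => le_rfl⟩ (.const 30)))).add (.const 20),
    fun i => ?_⟩
  have hw := run_while_foldl (Q := Q) (env := Ctx.inp i) (f := f i)
    (T := g (Ctx.param i) * (Ctx.size i + 1) ^ c) (Inv i) (L i) (s i) (h0 i) (hInv i)
    (fun a ha s hs => (hQ ⟨i, (a, s), ha, hs⟩).mono (hT ⟨i, (a, s), ha, hs⟩))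
  refine (((hP i).cons ((hP' i).cons (Run.id _))).seq
    (hw.seq ((Run.tail _).seq (Run.head _)))).mono ?_
  dsimp only
  omega

end Programs

end FPT

namespace FPT

open Enc (enc)

/-- The context inside a loop over the elements of a list. -/
abbrev ElemCtx {ι α : Type} (L : ι → List α) : Type := Ext ι α fun i a => a ∈ L i

/-- The context inside a fold over a list. -/
abbrev FoldCtx {ι α β : Type} (L : ι → List α) (Inv : ι → β → Prop) : Type :=
  Ext ι (α × β) fun i p => p.1 ∈ L i ∧ Inv i p.2

/-! ### List operations and Boolean connectives in the calculus. -/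

section Lists

variable {ι κ α β γ : Type} [Ctx ι] [Ctx κ] [Enc α] [Enc β] [Enc γ]

theorem Comp.instance_datum : Comp (fun i : ι => Ctx.inp i) :=
  ⟨.id, fun _ => 1, .const 1, fun _ => Run.id _⟩

/-- Since `π` preserves size and parameter, the time bound for `g` transfers unchanged; only the
recoding of the instance is added. -/
theorem Comp.reindex {g : ι → α} (hg : Comp g) (π : κ → ι)
    (hs : ∀ e, Ctx.size (π e) = Ctx.size e) (hp : ∀ e, Ctx.param (π e) = Ctx.param e)
    (hi : Comp (fun e => Ctx.inp (π e))) : Comp (fun e => g (π e)) := by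
  obtain ⟨P, S, ⟨f, c, hS⟩, hP⟩ := hg
  obtain ⟨Q, T, hT, hQ⟩ := hi
  refine ⟨.seq Q P, fun e => T e + f (Ctx.param e) * (Ctx.size e + 1) ^ c + 1,
    (hT.add ⟨f, c, fun _ => le_rfl⟩).add (.const 1), fun e => (hQ e).seq ((hP (π e)).mono ?_)⟩
  simpa [hs, hp] using hS (π e)

theorem Bdd.reindex {a : ι → ℕ} (ha : Bdd a) (π : κ → ι)
    (hs : ∀ e, Ctx.size (π e) = Ctx.size e) (hp : ∀ e, Ctx.param (π e) = Ctx.param e) :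
    Bdd (fun e => a (π e)) := by
  obtain ⟨f, c, ha⟩ := ha
  exact ⟨f, c, fun e => by simpa [hs, hp] using ha (π e)⟩

/-- Substitution of a computable value for the variable of an extended context. -/
theorem Comp.subst {P : ι → α → Prop} {f : Ext ι α P → β} (hf : Comp f) (π : κ → Ext ι α P)
    (hs : ∀ e, Ctx.size (π e).fst = Ctx.size e) (hp : ∀ e, Ctx.param (π e).fst = Ctx.param e)
    (hi : Comp (fun e => Ctx.inp (π e).fst)) (hv : Comp (fun e => (π e).snd)) :
    Comp (fun e => f (π e)) :=
  hf.reindex π hs hp ((hi.pair hv).recode fun _ => rfl)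

theorem Comp.reverse {L : ι → List α} (hL : Comp L) (hlen : Bdd fun i => (L i).length) :
    Comp (fun i => (L i).reverse) := by
  refine (Comp.foldl (f := fun _ s a => a :: s) (fun _ _ => True) hL hlen .empty
    (fun _ => trivial) (fun _ _ _ _ _ => trivial)
    (Comp.cons (Comp.var.proj₁) (Comp.var.proj₂))).congr fun i => ?_
  simp

theorem Comp.foldr {L : ι → List α} {s : ι → β} {f : ι → α → β → β} (Inv : ι → β → Prop)
    (hL : Comp L) (hlen : Bdd (fun i => (L i).length)) (hs : Comp s) (h0 : ∀ i, Inv i (s i))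
    (hInv : ∀ i, ∀ a ∈ L i, ∀ s, Inv i s → Inv i (f i a s))
    (hf : Comp (fun e : FoldCtx L Inv =>
      f e.fst e.snd.1 e.snd.2)) :
    Comp (fun i => (L i).foldr (f i) (s i)) := by
  have := Comp.foldl (f := fun i s a => f i a s) Inv (hL.reverse hlen) (by simpa using hlen) hs h0
    (fun i a ha => hInv i a (by simpa using ha)) (hf.subst
      (fun e : FoldCtx (fun i => (L i).reverse) Inv =>
        ⟨e.fst, e.snd, by simpa using e.prop⟩) (fun _ => rfl) (fun _ => rfl)
      Comp.instance_datum.ext .var)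
  simpa using this

/-- The element in the context of a fold. -/
theorem Comp.atElem {L : ι → List α} {Inv : ι → β → Prop} {f : ι → α → γ}
    (hf : Comp (fun e : ElemCtx L => f e.fst e.snd)) :
    Comp (fun e : FoldCtx L Inv => f e.fst e.snd.1) :=
  hf.subst (fun e : FoldCtx L Inv => ⟨e.fst, e.snd.1, e.prop.1⟩) (fun _ => rfl) (fun _ => rfl)
    Comp.instance_datum.ext Comp.var.proj₁

theorem Comp.map {L : ι → List α} {f : ι → α → β} (hL : Comp L)
    (hlen : Bdd (fun i => (L i).length))
    (hf : Comp (fun e : ElemCtx L => f e.fst e.snd)) :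
    Comp (fun i => (L i).map (f i)) := by
  refine (Comp.foldr (f := fun i a s => f i a :: s) (fun _ _ => True) hL hlen .empty
    (fun _ => trivial) (fun _ _ _ _ _ => trivial) ?_).congr fun i => List.map_eq_foldr
  exact (hf.atElem (Inv := fun _ _ => True)).cons Comp.var.proj₂

theorem Comp.append {L L' : ι → List α} (hL : Comp L) (hlen : Bdd (fun i => (L i).length))
    (hL' : Comp L') : Comp (fun i => L i ++ L' i) := by
  refine (Comp.foldr (f := fun i a s => a :: s) (fun _ _ => True) hL hlen hL'
    (fun _ => trivial) (fun _ _ _ _ _ => trivial)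
    (Comp.cons (Comp.var.proj₁) (Comp.var.proj₂))).congr fun i => ?_
  simp

theorem Comp.flatMap {L : ι → List α} {f : ι → α → List β} (hL : Comp L)
    (hlen : Bdd (fun i => (L i).length))
    (hf : Comp (fun e : ElemCtx L => f e.fst e.snd))
    (hfl : Bdd (fun e : ElemCtx L => (f e.fst e.snd).length)) :
    Comp (fun i => (L i).flatMap (f i)) := by
  refine (Comp.foldr (f := fun i a s => f i a ++ s) (fun _ _ => True) hL hlen .empty
    (fun _ => trivial) (fun _ _ _ _ _ => trivial) ?_).congr fun i => ?_
  · exact (hf.atElem (Inv := fun _ _ => True)).append (hfl.reindex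
      (fun e : FoldCtx L (fun _ _ => True) => (⟨e.fst, e.snd.1, e.prop.1⟩ : ElemCtx L))
      (fun _ => rfl) fun _ => rfl) Comp.var.proj₂
  · induction L i <;> simp_all

theorem Bdd.flatMap {ι α β : Type} [Ctx ι] {L : ι → List α} {f : ι → α → List β}
    (hlen : Bdd (fun i => (L i).length)) {b : ι → ℕ} (hb : Bdd b) (hfl : ∀ i, ∀ a ∈ L i, (f i a).length ≤ b i) :
    Bdd (fun i => ((L i).flatMap (f i)).length) := by
  refine (hlen.mul hb).mono fun i => ?_
  rw [List.length_flatMap]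
  refine (List.sum_le_card_nsmul _ (b i) ?_).trans_eq (by simp)
  simpa using hfl i

theorem Comp.filter {L : ι → List α} {p : ι → α → Bool} (hL : Comp L)
    (hlen : Bdd (fun i => (L i).length))
    (hp : Comp (fun e : ElemCtx L => p e.fst e.snd)) :
    Comp (fun i => (L i).filter (p i)) := by
  refine (Comp.foldr (f := fun i a s => if p i a then a :: s else s) (fun _ _ => True) hL hlen
    .empty (fun _ => trivial) (fun _ _ _ _ _ => trivial) ?_).congr fun i => ?_
  · exact .cond (hp.atElem (Inv := fun _ _ => True)) (.cons Comp.var.proj₁ Comp.var.proj₂)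
      Comp.var.proj₂
  · induction L i <;> simp_all [List.filter_cons]

theorem Bdd.filter {ι α : Type} [Ctx ι] {L : ι → List α} {p : ι → α → Bool}
    (hlen : Bdd (fun i => (L i).length)) :
    Bdd (fun i => ((L i).filter (p i)).length) :=
  hlen.mono fun _ => List.length_filter_le _ _

theorem Comp.constFalse : Comp (fun _ : ι => false) := .const_of_enc_nil _ rfl

theorem Comp.not {b : ι → Bool} (hb : Comp b) : Comp (fun i => !b i) := by
  obtain ⟨B, R, hR, hB⟩ := hb
  refine ⟨.ite B .nil (.cons .nil .nil), fun i => R i + 3 + 1, (hR.add (.const 3)).add (.const 1),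
    fun i => ?_⟩
  have hBi := hB i
  dsimp only
  cases hbi : b i <;> rw [hbi] at hBi
  · exact (hBi.ite_false ((Run.nil _).cons (Run.nil _)))
  · exact (hBi.ite_true (Run.nil _)).mono (by omega)

theorem Comp.constTrue : Comp (fun _ : ι => true) := Comp.constFalse.not

theorem Comp.and {b c : ι → Bool} (hb : Comp b) (hc : Comp c) : Comp (fun i => b i && c i) :=
  (Comp.cond hb hc .constFalse).congr fun i => by cases b i <;> rfl

theorem Comp.or {b c : ι → Bool} (hb : Comp b) (hc : Comp c) : Comp (fun i => b i || c i) :=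
  (Comp.cond hb .constTrue hc).congr fun i => by cases b i <;> rfl

theorem Comp.all {L : ι → List α} {p : ι → α → Bool} (hL : Comp L)
    (hlen : Bdd (fun i => (L i).length))
    (hp : Comp (fun e : ElemCtx L => p e.fst e.snd)) :
    Comp (fun i => (L i).all (p i)) := by
  refine (Comp.foldr (f := fun i a s => p i a && s) (fun _ _ => True) hL hlen
    .constTrue (fun _ => trivial) (fun _ _ _ _ _ => trivial) ?_).congr fun i => ?_
  · exact (hp.atElem (Inv := fun _ _ => True)).and Comp.var.proj₂
  · induction L i <;> simp_all

end Lists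

/-! ### Arithmetic of unary numbers with bounded values. -/

section Numbers

variable {ι α β : Type} [Ctx ι] [Enc α] [Enc β]

theorem enc_replicate_unit (n : ℕ) : enc (List.replicate n ()) = enc n := by
  induction n with
  | zero => rfl
  | succ n ih => exact congrArg (Data.cons .nil) ih

/-- Computable number-valued functions with bounded values. -/
structure CompN (a : ι → ℕ) : Prop where
  comp : Comp a
  bdd : Bdd a

theorem Comp.zero : Comp (fun _ : ι => 0) := .const_of_enc_nil _ rfl

theorem Comp.succ {a : ι → ℕ} (ha : Comp a) : Comp (fun i => a i + 1) :=
  ((Comp.const_of_enc_nil (() : Unit) rfl).pair ha).recode fun _ => rfl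

theorem Comp.pred {a : ι → ℕ} (ha : Comp a) : Comp (fun i => a i - 1) :=
  ((ha.recode (g' := fun i => List.replicate (a i) ()) fun _ =>
    enc_replicate_unit _).listTail).recode fun i => by rw [List.tail_replicate, enc_replicate_unit]

theorem Comp.iterate {a : ι → ℕ} {s : ι → β} {f : ι → β → β} (Inv : ι → β → Prop)
    (ha : CompN a) (hs : Comp s) (h0 : ∀ i, Inv i (s i)) (hInv : ∀ i s, Inv i s → Inv i (f i s))
    (hf : Comp (fun e : Ext ι β Inv => f e.fst e.snd)) :
    Comp (fun i => (f i)^[a i] (s i)) := by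
  have := Comp.foldl (L := fun i => List.replicate (a i) ()) (f := fun i s _ => f i s) Inv
    (ha.comp.recode fun _ => enc_replicate_unit _) (by simpa using ha.bdd) hs h0
    (fun i _ _ => hInv i) (hf.subst (fun e : FoldCtx (fun i => List.replicate (a i) ()) Inv =>
        ⟨e.fst, e.snd.2, e.prop.2⟩) (fun _ => rfl)
      (fun _ => rfl) Comp.instance_datum.ext Comp.var.proj₂)
  refine this.congr fun i => ?_
  generalize s i = s
  induction a i generalizing s with
  | zero => rfl
  | succ n ih => simp [List.replicate_succ, ← ih]

theorem CompN.ext {a : ι → ℕ} (ha : CompN a) {P : ι → α → Prop} :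
    CompN (fun e : Ext ι α P => a e.fst) := ⟨ha.comp.ext, ha.bdd.ext⟩

theorem CompN.congr {a b : ι → ℕ} (ha : CompN a) (h : ∀ i, b i = a i) : CompN b := by
  rwa [funext h]

theorem CompN.const (n : ℕ) : CompN (fun _ : ι => n) := by
  refine ⟨?_, .const n⟩
  induction n with
  | zero => exact .zero
  | succ n ih => exact ih.succ

theorem Comp.add {a b : ι → ℕ} (ha : CompN a) (hb : Comp b) : Comp (fun i => a i + b i) := by
  refine (Comp.iterate (f := fun _ s => s + 1) (fun _ _ => True) ha hb (fun _ => trivial)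
    (fun _ _ _ => trivial) Comp.var.succ).congr fun i => ?_
  simp [add_comm]

theorem CompN.add {a b : ι → ℕ} (ha : CompN a) (hb : CompN b) : CompN (fun i => a i + b i) :=
  ⟨.add ha hb.comp, ha.bdd.add hb.bdd⟩

theorem CompN.mul {a b : ι → ℕ} (ha : CompN a) (hb : CompN b) : CompN (fun i => a i * b i) := by
  refine ⟨(Comp.iterate (f := fun i s => b i + s) (fun _ _ => True) ha .zero (fun _ => trivial)
    (fun _ _ _ => trivial) (.add hb.ext .var)).congr fun i => ?_, ha.bdd.mul hb.bdd⟩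
  simp

theorem CompN.sub {a b : ι → ℕ} (ha : CompN a) (hb : CompN b) : CompN (fun i => a i - b i) := by
  refine ⟨(Comp.iterate (f := fun _ s => s - 1) (fun _ _ => True) hb ha.comp (fun _ => trivial)
    (fun _ _ _ => trivial) Comp.var.pred).congr fun i => ?_, ha.bdd.mono fun i => Nat.sub_le _ _⟩
  induction b i with
  | zero => rfl
  | succ n ih => rw [Function.iterate_succ_apply', ← ih, Nat.sub_succ, Nat.pred_eq_sub_one]

theorem Comp.isZero {a : ι → ℕ} (ha : Comp a) : Comp (fun i => decide (a i = 0)) := by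
  obtain ⟨B, R, hR, hB⟩ := ha
  refine ⟨.ite B .nil (.cons .nil .nil), fun i => R i + 3 + 1, (hR.add (.const 3)).add (.const 1),
    fun i => ?_⟩
  have hBi := hB i
  dsimp only
  cases hbi : a i <;> rw [hbi] at hBi
  · exact (hBi.ite_false ((Run.nil _).cons (Run.nil _)))
  · exact (hBi.ite_true (Run.nil _)).mono (by omega)

theorem CompN.le {a b : ι → ℕ} (ha : CompN a) (hb : CompN b) :
    Comp (fun i => decide (a i ≤ b i)) :=
  (ha.sub hb).comp.isZero.congr fun _ => decide_eq_decide.2 Nat.sub_eq_zero_iff_le.symm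

theorem CompN.lt {a b : ι → ℕ} (ha : CompN a) (hb : CompN b) :
    Comp (fun i => decide (a i < b i)) :=
  (hb.le ha).not.congr fun i => by rw [← decide_not]; exact decide_eq_decide.2 not_le.symm

theorem CompN.eq {a b : ι → ℕ} (ha : CompN a) (hb : CompN b) :
    Comp (fun i => decide (a i = b i)) :=
  ((ha.le hb).and (hb.le ha)).congr fun i => by simp [le_antisymm_iff]

/-- An invariant sees the accumulator but not the number of iterations, so a counter is stored in
the accumulator to bound the partial powers. The base `a i + 1` is positive, which makes its powers
monotone in the exponent. -/
theorem CompN.pow {a b : ι → ℕ} (ha : CompN a) (hb : CompN b) (h : Bdd fun i => (a i + 1) ^ b i) :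
    CompN (fun i => a i ^ b i) := by
  refine ⟨?_, h.mono fun i => Nat.pow_le_pow_left (Nat.le_succ _) _⟩
  let f : ι → ℕ × ℕ → ℕ × ℕ := fun i p => if decide (p.1 < b i) then (p.1 + 1, a i * p.2) else p
  let Inv : ι → ℕ × ℕ → Prop := fun i p => p.1 ≤ b i ∧ p.2 ≤ (a i + 1) ^ p.1
  have hc : Comp fun i => (f i)^[b i] (0, 1) := by
    refine Comp.iterate Inv hb (Comp.zero.pair Comp.zero.succ) (fun i => by simp [Inv])
      (fun i p hp => ?_) ?_
    · by_cases hlt : p.1 < b i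
      · simp only [f, hlt, decide_true, if_true, Inv]
        refine ⟨hlt, ?_⟩
        rw [pow_succ, mul_comm]
        exact Nat.mul_le_mul hp.2 (Nat.le_succ _)
      · simpa [f, hlt] using hp
    · have h₁ : CompN fun e : Ext ι (ℕ × ℕ) Inv => e.snd.1 :=
        ⟨Comp.var.proj₁, hb.bdd.ext.mono fun e => e.prop.1⟩
      have h₂ : CompN fun e : Ext ι (ℕ × ℕ) Inv => e.snd.2 :=
        ⟨Comp.var.proj₂, h.ext.mono fun e =>
          e.prop.2.trans (Nat.pow_le_pow_right (Nat.succ_pos _) e.prop.1)⟩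
      exact .cond (h₁.lt hb.ext) (h₁.comp.succ.pair (ha.ext.mul h₂).comp) .var
  refine hc.proj₂.congr fun i => ?_
  have key : ∀ n ≤ b i, (f i)^[n] (0, 1) = (n, a i ^ n) := by
    intro n hn
    induction n with
    | zero => rfl
    | succ n ih =>
      rw [Function.iterate_succ_apply', ih (by omega)]
      simp [f, show n < b i by omega, pow_succ, mul_comm]
  rw [key _ le_rfl]

theorem Comp.range {a : ι → ℕ} (ha : CompN a) : Comp (fun i => List.range (a i)) := by
  have h : Comp fun i => (fun p : ℕ × List ℕ => (p.1 + 1, p.1 :: p.2))^[a i] (0, []) :=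
    Comp.iterate (fun _ _ => True) ha (Comp.zero.pair .empty) (fun _ => trivial)
      (fun _ _ _ => trivial) (Comp.var.proj₁.succ.pair (Comp.var.proj₁.cons Comp.var.proj₂))
  have key : ∀ n, (fun p : ℕ × List ℕ => (p.1 + 1, p.1 :: p.2))^[n] (0, []) =
      (n, (List.range n).reverse) := by
    intro n
    induction n with
    | zero => rfl
    | succ n ih => rw [Function.iterate_succ_apply', ih]; simp [List.range_succ]
  refine ((h.proj₂.reverse ?_)).congr fun i => by simp [key]
  simpa [key] using ha.bdd

theorem Comp.replicate {a : ι → ℕ} {g : ι → α} (ha : CompN a) (hg : Comp g) :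
    Comp (fun i => List.replicate (a i) (g i)) := by
  refine (Comp.iterate (f := fun i s => g i :: s) (fun _ _ => True) ha .empty (fun _ => trivial)
    (fun _ _ _ => trivial) (.cons hg.ext .var)).congr fun i => ?_
  induction a i with
  | zero => rfl
  | succ n ih => rw [Function.iterate_succ_apply', ← ih, List.replicate_succ]

theorem Comp.getD {L : ι → List α} {a : ι → ℕ} (hL : Comp L) (ha : CompN a) (d : α)
    (hd : enc d = .nil) : Comp (fun i => (L i).getD (a i) d) := by
  refine ((Comp.iterate (f := fun i s => s.tail) (fun _ _ => True) ha hL (fun _ => trivial)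
    (fun _ _ _ => trivial) Comp.var.listTail).headD d hd).congr fun i => ?_
  generalize L i = l
  induction a i generalizing l with
  | zero => cases l <;> simp
  | succ n ih => rw [Function.iterate_succ_apply, ← ih]; cases l <;> simp

theorem CompN.half {a : ι → ℕ} (ha : CompN a) : CompN (fun i => a i / 2) := by
  have h : Comp fun i => (fun p : Bool × ℕ => (!p.1, if p.1 then p.2 + 1 else p.2))^[a i]
      (false, 0) :=
    Comp.iterate (fun _ _ => True) ha (Comp.constFalse.pair .zero) (fun _ => trivial)
      (fun _ _ _ => trivial) (Comp.var.proj₁.not.pair (.cond Comp.var.proj₁ Comp.var.proj₂.succ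
        Comp.var.proj₂))
  have key : ∀ n, (fun p : Bool × ℕ => (!p.1, if p.1 then p.2 + 1 else p.2))^[n] (false, 0) =
      (decide (n % 2 = 1), n / 2) := by
    intro n
    induction n with
    | zero => rfl
    | succ n ih =>
      rw [Function.iterate_succ_apply', ih]
      rcases Nat.mod_two_eq_zero_or_one n with h | h <;> simp [h] <;> omega
  exact ⟨h.proj₂.congr fun i => by simp [key], ha.bdd.mono fun i => Nat.div_le_self _ _⟩

theorem CompN.length {L : ι → List α} (hL : Comp L) (hlen : Bdd fun i => (L i).length) :
    CompN (fun i => (L i).length) := by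
  refine ⟨(Comp.foldl (f := fun _ s _ => s + 1) (fun _ _ => True) hL hlen .zero
    (fun _ => trivial) (fun _ _ _ _ _ => trivial) Comp.var.proj₂.succ).congr fun i => ?_, hlen⟩
  simp

theorem CompN.sum {L : ι → List α} {f : ι → α → ℕ} (hL : Comp L)
    (hlen : Bdd (fun i => (L i).length))
    (hf : CompN (fun e : ElemCtx L => f e.fst e.snd)) :
    CompN (fun i => ((L i).map (f i)).sum) := by
  constructor
  · refine (Comp.foldr (f := fun i a s => f i a + s) (fun _ _ => True) hL hlen .zero
      (fun _ => trivial) (fun _ _ _ _ _ => trivial) ?_).congr fun i => ?_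
    · exact .add ⟨hf.comp.atElem (Inv := fun _ _ => True), hf.bdd.reindex
        (fun e : FoldCtx L (fun _ _ => True) => (⟨e.fst, e.snd.1, e.prop.1⟩ : ElemCtx L))
        (fun _ => rfl) fun _ => rfl⟩ Comp.var.proj₂
    · induction L i <;> simp_all
  · obtain ⟨g, c, hb⟩ := hf.bdd
    refine (hlen.mul ⟨g, c, fun i => le_rfl⟩).mono fun i => ?_
    refine (List.sum_le_card_nsmul _ (g (Ctx.param i) * (Ctx.size i + 1) ^ c) ?_).trans_eq (by simp)
    simp only [List.mem_map, forall_exists_index, and_imp, forall_apply_eq_imp_iff₂]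
    exact fun a ha => hb ⟨i, a, ha⟩

end Numbers

end FPT

/-! ### Short integer solutions of linear systems and radicals of quadratic forms. -/

namespace OLA

open Finset

/-- Integer solutions of a homogeneous system with small coefficients: if there is a nonzero one,
there is a small one, whatever the number of equations. -/
theorem exists_short_solution {ι : Type} [Fintype ι] {D : ℕ} (hD : 1 ≤ D) (S : Set (ι → ℤ))
    (hS : ∀ c ∈ S, ∀ j, |c j| ≤ D) {y : ι → ℤ} (hy : y ≠ 0) (hSy : ∀ c ∈ S, ∑ j, c j * y j = 0) :
    ∃ t : ι → ℤ, t ≠ 0 ∧ (∀ j, |t j| ≤ ((Fintype.card ι * D) ^ Fintype.card ι : ℕ)) ∧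
      ∀ c ∈ S, ∑ j, c j * t j = 0 := by
  classical
  obtain ⟨i₀, hi₀⟩ := Function.ne_iff.1 hy
  have hcard : 1 ≤ Fintype.card ι := Fintype.card_pos_iff.2 ⟨i₀⟩
  let φ : (ι → ℤ) → (ι → ℚ) →ₗ[ℚ] ℚ := fun t =>
    { toFun := fun v => ∑ j, v j * t j
      map_add' := fun v w => by simp [add_mul, sum_add_distrib]
      map_smul' := fun r v => by simp [mul_sum, mul_assoc] }
  let cast : (ι → ℤ) → ι → ℚ := fun c j => c j
  have hφ : ∀ c t, φ t (cast c) = ((∑ j, c j * t j : ℤ) : ℚ) := fun c t => by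
    simp [φ, cast]
  -- Replacing the equations by a rational basis of their span keeps the solutions and removes the
  -- dependence on the number of equations.
  obtain ⟨b, hbS, hbspan, hbli⟩ := exists_linearIndependent ℚ (cast '' S)
  have hzero : ∀ t : ι → ℤ, (∀ v ∈ b, φ t v = 0) → ∀ c ∈ S, ∑ j, c j * t j = 0 := by
    intro t ht c hc
    have hle : Submodule.span ℚ b ≤ LinearMap.ker (φ t) := Submodule.span_le.2 ht
    have := hle (hbspan ▸ Submodule.subset_span ⟨c, hc, rfl⟩ : cast c ∈ Submodule.span ℚ b)
    rw [LinearMap.mem_ker, hφ] at this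
    exact_mod_cast this
  have hbfin : b.Finite := hbli.setFinite
  have := hbfin.fintype
  -- The span lies in the kernel of pairing with `y`, which is proper because `y` is nonzero.
  have hlt : Fintype.card b < Fintype.card ι := by
    rw [← finrank_span_set_eq_card hbli |>.trans (Set.toFinset_card b),
      ← Module.finrank_fintype_fun_eq_card ℚ (η := ι)]
    apply Submodule.finrank_lt
    intro htop
    have hle : Submodule.span ℚ b ≤ LinearMap.ker (φ y) := by
      rw [Submodule.span_le]
      intro v hv
      obtain ⟨c, hc, rfl⟩ := hbS hv
      rw [SetLike.mem_coe, LinearMap.mem_ker, hφ, hSy c hc]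
      rfl
    rw [htop] at hle
    have := hle (Submodule.mem_top : cast (Pi.single i₀ 1) ∈ ⊤)
    rw [LinearMap.mem_ker, hφ] at this
    simp [Pi.single_apply] at this
    exact hi₀ this
  -- Siegel's lemma requires at least one equation; without equations a unit vector serves.
  rcases isEmpty_or_nonempty b with hempty | hne
  · refine ⟨Pi.single i₀ 1, by simp, fun j => ?_, hzero _ fun v hv => (hempty.false ⟨v, hv⟩).elim⟩
    have h1 : (1 : ℤ) ≤ ((Fintype.card ι * D) ^ Fintype.card ι : ℕ) := by
      exact_mod_cast Nat.one_le_pow _ _ (Nat.mul_pos hcard hD)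
    rcases eq_or_ne j i₀ with rfl | h
    · simpa using h1
    · simp [h]; positivity
  · choose c hc hcv using fun v : b => hbS v.2
    obtain ⟨t, ht0, hAt, htn⟩ := Int.Matrix.exists_ne_zero_int_vec_norm_le
      (Matrix.of c : Matrix b ι ℤ) hlt Fintype.card_pos
    refine ⟨t, ht0, fun j => ?_, hzero t fun v hv => ?_⟩
    · have h1 : (1 : ℝ) ≤ D := by exact_mod_cast hD
      have hc1 : (1 : ℝ) ≤ Fintype.card ι := by exact_mod_cast hcard
      have hbase : (1 : ℝ) ≤ Fintype.card ι * D := by nlinarith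
      have hbn : (Fintype.card b : ℝ) + 1 ≤ Fintype.card ι := by exact_mod_cast hlt
      -- The exponent in Siegel's lemma; its denominator is at least 1.
      have hexp : (Fintype.card b : ℝ) / (Fintype.card ι - Fintype.card b) ≤ Fintype.card ι := by
        rw [div_le_iff₀ (by linarith)]
        nlinarith
      have : ‖t‖ ≤ ((Fintype.card ι : ℝ) * D) ^ (Fintype.card ι : ℝ) :=
        htn.trans ((Real.rpow_le_rpow (mul_nonneg (by positivity) (zero_le_one.trans
          (le_max_left _ _))) (mul_le_mul_of_nonneg_left
          (max_le h1 ((Matrix.norm_le_iff (by positivity)).2 fun v j => by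
            rw [Int.norm_eq_abs]
            exact_mod_cast hS _ (hc v) j)) (by positivity)) (by
          apply div_nonneg <;> linarith)).trans (Real.rpow_le_rpow_of_exponent_le hbase hexp))
      rw [Real.rpow_natCast] at this
      have h2 := (norm_le_pi_norm t j).trans this
      rw [Int.norm_eq_abs] at h2
      exact_mod_cast h2
    · have h3 := congrFun hAt ⟨v, hv⟩
      rw [show v = cast (c ⟨v, hv⟩) from (hcv ⟨v, hv⟩).symm]
      rw [hφ]
      exact_mod_cast (by simpa [Matrix.mulVec, dotProduct] using h3 :
        ∑ j, c ⟨v, hv⟩ j * t j = 0)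

/-- A quadratic form that is positive on the short vectors with vanishing class sums has trivial
radical on all of them. -/
theorem eq_zero_of_radical {ι Λ : Type} [Fintype ι] [DecidableEq ι] [DecidableEq Λ] (lab : ι → Λ)
    (H : ι → ι → ℤ) (J : Finset ι) {C M : ℕ} (hH : ∀ a ∈ J, ∀ b ∈ J, |H a b| ≤ C)
    (hM : (Fintype.card ι * (2 * C + 1)) ^ Fintype.card ι ≤ M)
    (hpos : ∀ y : ι → ℤ, (∀ j ∉ J, y j = 0) → (∀ i, ∑ j with lab j = lab i, y j = 0) →
      (∀ j, |y j| ≤ M) → y ≠ 0 → 0 < ∑ a, ∑ b, H a b * y a * y b)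
    {y : ι → ℤ} (hJ : ∀ j ∉ J, y j = 0) (hsum : ∀ i, ∑ j with lab j = lab i, y j = 0)
    (hrad : ∀ a ∈ J, ∀ b ∈ J, lab a = lab b → ∑ j, H a j * y j = ∑ j, H b j * y j) : y = 0 := by
  by_contra hy
  -- The three kinds of equations express support in `J`, vanishing class sums, and constancy of `H
  -- y` on each class within `J`. Their coefficients are at most `2 * C + 1` in absolute value.
  let S : Set (ι → ℤ) := {c | (∃ j ∉ J, c = Pi.single j 1) ∨
    (∃ i, c = fun j => if lab j = lab i then 1 else 0) ∨
    ∃ a ∈ J, ∃ b ∈ J, lab a = lab b ∧ c = fun j => if j ∈ J then H a j - H b j else 0}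
  have hres : ∀ t : ι → ℤ, (∀ j ∉ J, t j = 0) → ∀ a b, ∑ j, (if j ∈ J then H a j - H b j else 0) * t j
      = ∑ j, H a j * t j - ∑ j, H b j * t j := by
    intro t ht a b
    rw [← sum_sub_distrib]
    refine sum_congr rfl fun j _ => ?_
    by_cases hj : j ∈ J
    · simp [hj, sub_mul]
    · simp [hj, ht j hj]
  obtain ⟨t, ht0, htM, htS⟩ := exists_short_solution (D := 2 * C + 1) (by omega) S (by
    rintro c (⟨i, _, rfl⟩ | ⟨i, rfl⟩ | ⟨a, ha, b, hb, _, rfl⟩) j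
    · rcases eq_or_ne j i with rfl | h
      · simp
      · simp [h]; positivity
    · dsimp only
      split_ifs <;> simp; positivity
    · dsimp only
      split_ifs with hj
      · have h1 := abs_le.1 (hH a ha j hj)
        have h2 := abs_le.1 (hH b hb j hj)
        rw [abs_le]; push_cast; constructor <;> linarith
      · simp; positivity) hy (by
    rintro c (⟨i, hi, rfl⟩ | ⟨i, rfl⟩ | ⟨a, ha, b, hb, hab, rfl⟩)
    · simp [Pi.single_apply, hJ i hi]
    · simpa [sum_filter] using hsum i
    · rw [hres y hJ, hrad a ha b hb hab, sub_self])
  have htJ : ∀ j ∉ J, t j = 0 := fun j hj => by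
    simpa [Pi.single_apply] using htS _ (Or.inl ⟨j, hj, rfl⟩)
  have htsum : ∀ i, ∑ j with lab j = lab i, t j = 0 := fun i => by
    simpa [sum_filter] using htS _ (Or.inr (Or.inl ⟨i, rfl⟩))
  have htrad : ∀ a ∈ J, ∀ b ∈ J, lab a = lab b → ∑ j, H a j * t j = ∑ j, H b j * t j :=
    fun a ha b hb hab => by
      have := htS _ (Or.inr (Or.inr ⟨a, ha, b, hb, hab, rfl⟩))
      rw [hres t htJ] at this
      linarith
  refine (hpos t htJ htsum (fun j => (htM j).trans (by exact_mod_cast hM)) ht0).ne' ?_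
  -- On the support of `t`, the vector `H t` is constant on each class, so a class contributes a
  -- multiple of its vanishing sum. Hence the form is zero at the short vector `t`, against
  -- positivity.
  have h1 : ∀ s ∈ univ.image lab, ∑ a with lab a = s, ∑ b, H a b * t a * t b = 0 := by
    intro s hs
    by_cases h : ∃ a₀ ∈ J, lab a₀ = s
    · obtain ⟨a₀, ha₀, rfl⟩ := h
      calc ∑ a with lab a = lab a₀, ∑ b, H a b * t a * t b
          = ∑ a with lab a = lab a₀, t a * ∑ j, H a₀ j * t j := by
            refine sum_congr rfl fun a ha => ?_
            by_cases haJ : a ∈ J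
            · rw [← htrad a haJ a₀ ha₀ (by simpa using ha), mul_sum]
              exact sum_congr rfl fun b _ => by ring
            · simp [htJ a haJ]
        _ = 0 := by rw [← sum_mul, htsum, zero_mul]
    · refine sum_eq_zero fun a ha => ?_
      have : a ∉ J := fun haJ => h ⟨a, haJ, by simpa using ha⟩
      simp [htJ a this]
  rw [← sum_fiberwise_of_maps_to (s := univ) (t := univ.image lab) (g := lab)
    (fun i _ => mem_image_of_mem _ (mem_univ i))]
  exact sum_eq_zero h1

/-! ### Cubic forms and their expansion at a point. -/

section Trilinear

variable {ι : Type} [Fintype ι]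

/-- The trilinear form with coefficients `κ`. -/
def trilin (κ : ι → ι → ι → ℤ) (u v w : ι → ℤ) : ℤ :=
  ∑ a, ∑ b, ∑ l, κ a b l * u a * v b * w l

/-- The cubic form with coefficients `κ`. -/
def cubic (κ : ι → ι → ι → ℤ) (x : ι → ℤ) : ℤ := trilin κ x x x

/-- The quadratic part of `u ↦ 2 * cubic κ (u + g)` along directions on which it is quadratic. -/
def hess (κ : ι → ι → ι → ℤ) (g : ι → ℤ) (a b : ι) : ℤ :=
  ∑ j, g j * (κ a j b + κ j a b + κ b j a + κ j b a)

/-- The linear part of `u ↦ cubic κ (u + g)`. -/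
def grad (κ : ι → ι → ι → ℤ) (g : ι → ℤ) (a : ι) : ℤ :=
  ∑ j, ∑ l, g j * g l * (κ a j l + κ j a l + κ j l a)

theorem hess_comm (κ : ι → ι → ι → ℤ) (g : ι → ℤ) (a b : ι) : hess κ g a b = hess κ g b a :=
  sum_congr rfl fun _ _ => by ring

theorem trilin_swap₁₂ (κ : ι → ι → ι → ℤ) (u v w : ι → ℤ) :
    trilin κ u v w = trilin (fun a b l => κ b a l) v u w := by
  rw [trilin, sum_comm]
  exact sum_congr rfl fun _ _ => sum_congr rfl fun _ _ => sum_congr rfl fun _ _ => by ring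

theorem trilin_swap₂₃ (κ : ι → ι → ι → ℤ) (u v w : ι → ℤ) :
    trilin κ u v w = trilin (fun a b l => κ a l b) u w v := by
  refine sum_congr rfl fun _ _ => ?_
  rw [sum_comm]
  exact sum_congr rfl fun _ _ => sum_congr rfl fun _ _ => by ring

/-- Every term with `u` in both of the first two slots vanishes, so at most two factors `u` survive.
The factor 2 keeps the symmetrised quadratic part integral. -/
theorem two_mul_cubic_add (κ : ι → ι → ι → ℤ) {J : Finset ι}
    (hJ : ∀ a ∈ J, ∀ b ∈ J, ∀ l, κ a b l = 0) (g : ι → ℤ) {u : ι → ℤ} (hu : ∀ j ∉ J, u j = 0) :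
    2 * cubic κ (u + g) = 2 * cubic κ g + 2 * ∑ a, grad κ g a * u a +
      ∑ a, ∑ b, hess κ g a b * u a * u b := by
  have h0 : ∀ w, trilin κ u u w = 0 := fun w =>
    sum_eq_zero fun a _ => sum_eq_zero fun b _ => sum_eq_zero fun l _ => by
      by_cases ha : a ∈ J
      · by_cases hb : b ∈ J
        · simp [hJ a ha b hb]
        · simp [hu b hb]
      · simp [hu a ha]
  have h1 : cubic κ (u + g) = trilin κ u u u + trilin κ u u g + trilin κ u g u + trilin κ g u u +
      (trilin κ u g g + trilin κ g u g + trilin κ g g u) + cubic κ g := by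
    simp only [cubic, trilin, ← sum_add_distrib, Pi.add_apply]
    exact sum_congr rfl fun _ _ => sum_congr rfl fun _ _ => sum_congr rfl fun _ _ => by ring
  have h2 : ∑ a, grad κ g a * u a = trilin κ u g g + trilin κ g u g + trilin κ g g u := by
    rw [trilin_swap₁₂ κ g u g, trilin_swap₂₃ κ g g u, trilin_swap₁₂ _ g u g]
    simp only [trilin, grad, ← sum_add_distrib, sum_mul]
    exact sum_congr rfl fun _ _ => sum_congr rfl fun _ _ => sum_congr rfl fun _ _ => by ring
  have h3 : ∑ a, ∑ b, hess κ g a b * u a * u b = 2 * (trilin κ u g u + trilin κ g u u) := by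
    have e1 : ∀ κ' : ι → ι → ι → ℤ, ∑ a, ∑ b, ∑ j, κ' a j b * g j * u a * u b = trilin κ' u g u :=
      fun κ' => by
        rw [trilin_swap₂₃]
        exact sum_congr rfl fun _ _ => sum_congr rfl fun _ _ => sum_congr rfl fun _ _ => by ring
    have e2 : ∀ κ' : ι → ι → ι → ℤ, ∑ a, ∑ b, ∑ j, κ' b j a * g j * u a * u b = trilin κ' u g u :=
      fun κ' => by
        rw [← e1, sum_comm]
        exact sum_congr rfl fun _ _ => sum_congr rfl fun _ _ => sum_congr rfl fun _ _ => by ring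
    rw [two_mul, trilin_swap₁₂ κ g u u]
    nth_rw 1 [← e1 κ, ← e1 fun a b l => κ b a l]
    rw [← e2 κ, ← e2 fun a b l => κ b a l]
    simp only [← sum_add_distrib, hess, sum_mul]
    exact sum_congr rfl fun _ _ => sum_congr rfl fun _ _ => sum_congr rfl fun _ _ => by ring
  rw [h1, h2, h3, h0, h0]
  ring

end Trilinear

/-! ### Increments of integral quadratic functions. -/

section Quadratic

variable {ι : Type} [Fintype ι]

/-- Value of `u ↦ 2 L u + u H u`. -/
def quad (H : ι → ι → ℤ) (L : ι → ℤ) (u : ι → ℤ) : ℤ :=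
  2 * ∑ a, L a * u a + ∑ a, ∑ b, H a b * u a * u b

theorem quad_add {H : ι → ι → ℤ} (hH : ∀ a b, H a b = H b a) (L u y : ι → ℤ) :
    quad H L (u + y) = quad H L u + 2 * ∑ a, (L a + ∑ b, H a b * u b) * y a +
      ∑ a, ∑ b, H a b * y a * y b := by
  have h1 : ∑ a, ∑ b, H a b * u a * y b = ∑ a, ∑ b, H a b * u b * y a := by
    rw [sum_comm]
    exact sum_congr rfl fun a _ => sum_congr rfl fun b _ => by rw [hH]
  have h2 : ∑ a, ∑ b, H a b * (u a + y a) * (u b + y b) = ∑ a, ∑ b, H a b * u a * u b +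
      ∑ a, ∑ b, H a b * u a * y b + ∑ a, ∑ b, H a b * u b * y a +
      ∑ a, ∑ b, H a b * y a * y b := by
    simp only [← sum_add_distrib]
    exact sum_congr rfl fun a _ => sum_congr rfl fun b _ => by ring
  have h3 : ∑ a, (L a + ∑ b, H a b * u b) * y a =
      ∑ a, L a * y a + ∑ a, ∑ b, H a b * u b * y a := by
    simp only [add_mul, sum_add_distrib, sum_mul]
  have h4 : ∑ a, L a * (u a + y a) = ∑ a, L a * u a + ∑ a, L a * y a := by
    simp only [mul_add, sum_add_distrib]
  simp only [quad, Pi.add_apply]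
  rw [h2, h1, h3, h4]
  ring

variable [DecidableEq ι]

theorem quad_form_single (H : ι → ι → ℤ) (a : ι) (c : ℤ) :
    ∑ i, ∑ j, H i j * (Pi.single a c : ι → ℤ) i * (Pi.single a c : ι → ℤ) j = H a a * c * c := by
  simp [Pi.single_apply, mul_assoc]

theorem quad_add_single {H : ι → ι → ℤ} (hH : ∀ a b, H a b = H b a) (L u : ι → ℤ) (a : ι) :
    quad H L (u + Pi.single a 1) = quad H L u + 2 * (L a + ∑ b, H a b * u b) + H a a := by
  rw [quad_add hH, quad_form_single]
  simp [Pi.single_apply]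

theorem quad_form_neg {ι : Type} [Fintype ι] (H : ι → ι → ℤ) (y : ι → ℤ) :
    ∑ a, ∑ b, H a b * (-y) a * (-y) b = ∑ a, ∑ b, H a b * y a * y b := by
  simp

theorem quad_form_single_sub_single {H : ι → ι → ℤ} (hH : ∀ a b, H a b = H b a) (a b : ι) :
    ∑ i, ∑ j, H i j * (Pi.single a 1 - Pi.single b 1 : ι → ℤ) i *
      (Pi.single a 1 - Pi.single b 1 : ι → ℤ) j = H a a + H b b - 2 * H a b := by
  simp only [Pi.sub_apply, mul_sub, sub_mul, sum_sub_distrib]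
  simp [Pi.single_apply, hH b a]
  ring

end Quadratic

/-! ### Minimisers of the cubic form: definiteness, stationarity and rigidity of the large part. -/

section Core

variable {ι : Type} [Fintype ι]

/-- The coordinates with large values. -/
def largeSet (M : ℕ) (x : ι → ℤ) : Finset ι := univ.filter fun j => (M : ℤ) < x j

/-- The vector of the large coordinates. -/
def largePart (M : ℕ) (x : ι → ℤ) (j : ι) : ℤ := if (M : ℤ) < x j then x j else 0

/-- The vector of the small coordinates. -/
def smallPart (M : ℕ) (x : ι → ℤ) (j : ι) : ℤ := if (M : ℤ) < x j then 0 else x j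

theorem largePart_add_smallPart {ι : Type} (M : ℕ) (x : ι → ℤ) : largePart M x + smallPart M x = x := by
  ext j
  simp only [Pi.add_apply, largePart, smallPart]
  split_ifs <;> simp

theorem largePart_eq_zero {M : ℕ} {x : ι → ℤ} {j : ι} (hj : j ∉ largeSet M x) :
    largePart M x j = 0 :=
  if_neg (by simpa [largeSet] using hj)

/-- Minimality of `x` among the nonnegative vectors with the same sum over each class; ties are
broken in favour of a large sum of squares. -/
structure IsSpreadMin {Λ : Type} [DecidableEq Λ] (κ : ι → ι → ι → ℤ) (lab : ι → Λ) (x : ι → ℤ) :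
    Prop where
  nonneg : ∀ j, 0 ≤ x j
  le : ∀ x' : ι → ℤ, (∀ j, 0 ≤ x' j) →
    (∀ i, ∑ j with lab j = lab i, x' j = ∑ j with lab j = lab i, x j) → cubic κ x ≤ cubic κ x'
  spread : ∀ x' : ι → ℤ, (∀ j, 0 ≤ x' j) →
    (∀ i, ∑ j with lab j = lab i, x' j = ∑ j with lab j = lab i, x j) → cubic κ x = cubic κ x' →
    ∑ j, x' j ^ 2 ≤ ∑ j, x j ^ 2

/-- Blocks that interact with a large block have size at most `k`. -/
def FewNeighbours (κ : ι → ι → ι → ℤ) (k M : ℕ) (x : ι → ℤ) : Prop :=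
  ∀ a b l, (M : ℤ) < x a → (κ a b l ≠ 0 ∨ κ b a l ≠ 0) → x b ≤ k

variable {Λ : Type} [DecidableEq Λ] {κ : ι → ι → ι → ℤ} {lab : ι → Λ} {x : ι → ℤ}
  {k M : ℕ}

/-- A block interacting with a large one has size at most `k ≤ M`, so two large blocks do not
interact and `two_mul_cubic_add` applies. -/
theorem two_mul_cubic_eq_quad (hadj : FewNeighbours κ k M x) (hkM : k ≤ M)
    {u : ι → ℤ} (hu : ∀ j ∉ largeSet M x, u j = 0) :
    2 * cubic κ (u + smallPart M x) = 2 * cubic κ (smallPart M x) +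
      quad (hess κ (smallPart M x)) (grad κ (smallPart M x)) u := by
  rw [two_mul_cubic_add κ (J := largeSet M x) ?_ _ hu, quad, add_assoc]
  intro a ha b hb l
  by_contra h
  have h1 := hadj a b l (by simpa [largeSet] using ha) (Or.inl h)
  have h2 : (M : ℤ) < x b := by simpa [largeSet] using hb
  omega

/-- Only blocks of size at most `k` contribute to the row of a large block, and each of the four
terms is at most `2 * k`. The bound does not involve `M`, so `M` may later be chosen in terms of it.
-/
theorem abs_hess_le (hκ : ∀ a b l, 0 ≤ κ a b l ∧ κ a b l ≤ 2) (hx : ∀ j, 0 ≤ x j)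
    (hadj : FewNeighbours κ k M x) {a b : ι} (ha : a ∈ largeSet M x) (hb : b ∈ largeSet M x) :
    |hess κ (smallPart M x) a b| ≤ (8 * k * Fintype.card ι : ℕ) := by
  have key : ∀ c ∈ largeSet M x, ∀ j l, |smallPart M x j * κ c j l| ≤ 2 * k ∧
      |smallPart M x j * κ j c l| ≤ 2 * k := by
    intro c hc j l
    have hc' : (M : ℤ) < x c := by simpa [largeSet] using hc
    have hs : ∀ q : ℤ, 0 ≤ q → q ≤ 2 → (q ≠ 0 → x j ≤ k) →
        |smallPart M x j * q| ≤ 2 * k := by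
      intro q h0 h2 h
      rcases eq_or_ne q 0 with rfl | hq
      · simp
      · have h3 := h hq
        have h4 : 0 ≤ smallPart M x j ∧ smallPart M x j ≤ k := by
          unfold smallPart
          split_ifs
          · exact ⟨le_rfl, by positivity⟩
          · exact ⟨hx j, h3⟩
        rw [abs_of_nonneg (mul_nonneg h4.1 h0)]
        nlinarith [h4.1, h4.2]
    exact ⟨hs _ (hκ _ _ _).1 (hκ _ _ _).2 fun h => hadj c j l hc' (Or.inl h),
      hs _ (hκ _ _ _).1 (hκ _ _ _).2 fun h => hadj c j l hc' (Or.inr h)⟩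
  refine (abs_sum_le_sum_abs _ _).trans ((sum_le_card_nsmul _ _ (8 * k : ℤ) fun j _ => ?_).trans
    (by simp [mul_comm]))
  have h1 := abs_le.1 (key a ha j b).1
  have h2 := abs_le.1 (key a ha j b).2
  have h3 := abs_le.1 (key b hb j a).1
  have h4 := abs_le.1 (key b hb j a).2
  rw [abs_le]
  constructor <;> nlinarith

theorem abs_grad_le (hκ : ∀ a b l, 0 ≤ κ a b l ∧ κ a b l ≤ 2) (hx : ∀ j, 0 ≤ x j) (a : ι) :
    |grad κ (smallPart M x) a| ≤ (6 * M ^ 2 * Fintype.card ι ^ 2 : ℕ) := by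
  have hs : ∀ j, 0 ≤ smallPart M x j ∧ smallPart M x j ≤ M := by
    intro j
    unfold smallPart
    split_ifs with h
    · exact ⟨le_rfl, by positivity⟩
    · exact ⟨hx j, by omega⟩
  refine (abs_sum_le_sum_abs _ _).trans ((sum_le_card_nsmul _ _
    (Fintype.card ι * (6 * M ^ 2) : ℤ) fun j _ => ?_).trans_eq (by simp; ring))
  refine (abs_sum_le_sum_abs _ _).trans ((sum_le_card_nsmul _ _ (6 * M ^ 2 : ℤ) fun l _ => ?_).trans
    (by simp))
  have h0 := hκ a j l
  have h1 := hκ j a l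
  have h2 := hκ j l a
  have h3 : 0 ≤ smallPart M x j * smallPart M x l := mul_nonneg (hs j).1 (hs l).1
  have h4 : smallPart M x j * smallPart M x l ≤ M * M :=
    mul_le_mul (hs j).2 (hs l).2 (hs l).1 (by positivity)
  rw [abs_of_nonneg (mul_nonneg h3 (by linarith))]
  calc _ ≤ (M * M : ℤ) * 6 := mul_le_mul h4 (by linarith) (by linarith) (by positivity)
    _ = _ := by ring

/-- As `y` is bounded by `M` and lives where `x` exceeds `M`, both `x + y` and `x - y` are
admissible. Comparing their values with that of `x` bounds the linear term by the quadratic one. If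
the quadratic term were not positive, all three values would agree, while by the parallelogram
identity one of the two shifts has a larger sum of squares. -/
theorem IsSpreadMin.second_order (h : IsSpreadMin κ lab x) (hadj : FewNeighbours κ k M x) (hkM : k ≤ M)
    {y : ι → ℤ} (hJ : ∀ j ∉ largeSet M x, y j = 0) (hsum : ∀ i, ∑ j with lab j = lab i, y j = 0)
    (hy : ∀ j, |y j| ≤ M) :
    |2 * ∑ a, (grad κ (smallPart M x) a +
      ∑ b, hess κ (smallPart M x) a b * largePart M x b) * y a| ≤
      ∑ a, ∑ b, hess κ (smallPart M x) a b * y a * y b ∧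
    (y ≠ 0 → 0 < ∑ a, ∑ b, hess κ (smallPart M x) a b * y a * y b) := by
  have main : ∀ y : ι → ℤ, (∀ j ∉ largeSet M x, y j = 0) →
      (∀ i, ∑ j with lab j = lab i, y j = 0) → (∀ j, |y j| ≤ M) →
      0 ≤ 2 * ∑ a, (grad κ (smallPart M x) a +
        ∑ b, hess κ (smallPart M x) a b * largePart M x b) * y a +
        ∑ a, ∑ b, hess κ (smallPart M x) a b * y a * y b ∧
      (2 * ∑ a, (grad κ (smallPart M x) a +
        ∑ b, hess κ (smallPart M x) a b * largePart M x b) * y a +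
        ∑ a, ∑ b, hess κ (smallPart M x) a b * y a * y b = 0 →
        ∑ j, (x + y) j ^ 2 ≤ ∑ j, x j ^ 2) := by
    intro y hJ hsum hy
    have hz : ∀ j ∉ largeSet M x, largePart M x j = 0 := fun j hj =>
      largePart_eq_zero hj
    have hnn : ∀ j, 0 ≤ (x + y) j := by
      intro j
      by_cases hj : j ∈ largeSet M x
      · have h1 : (M : ℤ) < x j := by simpa [largeSet] using hj
        have h2 := abs_le.1 (hy j)
        simp only [Pi.add_apply]
        linarith
      · simpa [hJ j hj] using h.nonneg j
    have hs : ∀ i, ∑ j with lab j = lab i, (x + y) j = ∑ j with lab j = lab i, x j := fun i => by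
      simp [sum_add_distrib, hsum i]
    have e1 := two_mul_cubic_eq_quad hadj hkM hz
    have e2 := two_mul_cubic_eq_quad hadj hkM (u := largePart M x + y) fun j hj => by
      simp [hz j hj, hJ j hj]
    rw [quad_add (hess_comm _ _)] at e2
    rw [add_right_comm, largePart_add_smallPart] at e2
    rw [largePart_add_smallPart] at e1
    have h1 := h.le _ hnn hs
    exact ⟨by linarith, fun h0 => h.spread _ hnn hs (by linarith)⟩
  have m1 := main y hJ hsum hy
  have m2 := main (-y) (fun j hj => by simp [hJ j hj]) (fun i => by simp [hsum i])
    (fun j => by simpa using hy j)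
  rw [quad_form_neg] at m2
  simp only [Pi.neg_apply, mul_neg, sum_neg_distrib] at m2
  refine ⟨abs_le.2 ⟨by linarith, by linarith⟩, fun hy0 => ?_⟩
  by_contra hle
  have s1 := m1.2 (by linarith)
  have s2 := m2.2 (by linarith)
  have s3 : ∑ j, (x + y) j ^ 2 + ∑ j, (x + -y) j ^ 2 = 2 * ∑ j, x j ^ 2 + 2 * ∑ j, y j ^ 2 := by
    simp only [mul_sum, ← sum_add_distrib]
    exact sum_congr rfl fun j _ => by simp only [Pi.add_apply, Pi.neg_apply]; ring
  have s4 : 0 < ∑ j, y j ^ 2 := by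
    obtain ⟨j, hj⟩ := Function.ne_iff.1 hy0
    exact sum_pos' (fun j _ => sq_nonneg _) ⟨j, mem_univ _, by
      have : y j ≠ 0 := hj
      positivity⟩
  linarith

variable [DecidableEq ι]

/-- Scaled-down versions of the large part of a minimum are almost stationary. -/
theorem IsSpreadMin.stationary (h : IsSpreadMin κ lab x)
    (hκ : ∀ a b l, 0 ≤ κ a b l ∧ κ a b l ≤ 2) (hadj : FewNeighbours κ k M x) (hkM : k ≤ M)
    (hM : 1 ≤ M) (t : ℕ) {a b : ι} (ha : a ∈ largeSet M x) (hb : b ∈ largeSet M x)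
    (hab : lab a = lab b) :
    |cubic κ ((fun j => largePart M x j / 2 ^ t) + Pi.single a 1 + smallPart M x) -
      cubic κ ((fun j => largePart M x j / 2 ^ t) + Pi.single b 1 + smallPart M x)| ≤
      (24 * M ^ 2 * Fintype.card ι ^ 2 + 24 * k * Fintype.card ι +
        16 * k * Fintype.card ι ^ 2 : ℕ) := by
  set H := hess κ (smallPart M x) with hHdef
  set L := grad κ (smallPart M x) with hLdef
  set z := largePart M x with hzdef
  set u : ι → ℤ := fun j => z j / 2 ^ t with hu
  have hHc : ∀ a b, H a b = H b a := hess_comm _ _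
  have hz : ∀ j ∉ largeSet M x, z j = 0 := fun j hj =>
    largePart_eq_zero hj
  have hu0 : ∀ j ∉ largeSet M x, u j = 0 := fun j hj => by simp [hu, hz j hj]
  have hF : ∀ c ∈ largeSet M x, 2 * cubic κ (u + Pi.single c 1 + smallPart M x) =
      2 * cubic κ (smallPart M x) + (quad H L u + 2 * (L c + ∑ j, H c j * u j) + H c c) := by
    intro c hc
    rw [two_mul_cubic_eq_quad hadj hkM, quad_add_single hHc]
    intro j hj
    have : j ≠ c := fun e => hj (e ▸ hc)
    simp [hu0 j hj, this]
  have hHb : ∀ c ∈ largeSet M x, ∀ d ∈ largeSet M x, |H c d| ≤ (8 * k * Fintype.card ι : ℕ) :=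
    fun c hc d hd => abs_hess_le hκ h.nonneg hadj hc hd
  have hLb : ∀ c, |L c| ≤ (6 * M ^ 2 * Fintype.card ι ^ 2 : ℕ) := fun c =>
    abs_grad_le hκ h.nonneg c
  have hstat : |2 * (L a + ∑ j, H a j * z j) - 2 * (L b + ∑ j, H b j * z j)| ≤
      H a a + H b b - 2 * H a b := by
    -- Moving one vertex from block `b` to block `a` of the same class is an admissible short
    -- direction; this is where `1 ≤ M` is used.
    have hst := (h.second_order hadj hkM (y := Pi.single a 1 - Pi.single b 1) (fun j hj => by
      have h1 : j ≠ a := fun e => hj (e ▸ ha)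
      have h2 : j ≠ b := fun e => hj (e ▸ hb)
      simp [h1, h2]) (fun i => by
      simp [Pi.single_apply, sum_sub_distrib, hab]) (fun j => by
      have : (1 : ℤ) ≤ M := by exact_mod_cast hM
      simp only [Pi.sub_apply, Pi.single_apply]
      split_ifs <;> simp <;> linarith)).1
    rw [quad_form_single_sub_single hHc] at hst
    refine le_trans (le_of_eq ?_) hst
    simp only [Pi.sub_apply, mul_sub, sum_sub_distrib]
    simp [Pi.single_apply]
    rfl
  -- Rounding leaves a remainder below `2 ^ t` in each coordinate, weighted by an entry of `H`.
  have hround : ∀ c ∈ largeSet M x, |∑ j, H c j * z j - 2 ^ t * ∑ j, H c j * u j| ≤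
      2 ^ t * (8 * k * Fintype.card ι ^ 2 : ℕ) := by
    intro c hc
    rw [mul_sum, ← sum_sub_distrib]
    refine (abs_sum_le_sum_abs _ _).trans ((sum_le_card_nsmul _ _
      (2 ^ t * (8 * k * Fintype.card ι : ℕ) : ℤ) fun j _ => ?_).trans_eq (by simp; ring))
    by_cases hj : j ∈ largeSet M x
    · have e : H c j * z j - 2 ^ t * (H c j * u j) = H c j * (z j % 2 ^ t) := by
        linear_combination -H c j * Int.mul_ediv_add_emod (z j) (2 ^ t)
      rw [e, abs_mul, mul_comm]
      have h1 : 0 ≤ z j % 2 ^ t := Int.emod_nonneg _ (by positivity)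
      have h2 : z j % 2 ^ t < 2 ^ t := Int.emod_lt_of_pos _ (by positivity)
      rw [abs_of_nonneg h1]
      exact mul_le_mul h2.le (hHb c hc j hj) (abs_nonneg _) (by positivity)
    · simp only [hu0 j hj, hz j hj, mul_zero, sub_zero, abs_zero]
      positivity
  have hp : (1 : ℤ) ≤ 2 ^ t := one_le_pow₀ (by norm_num)
  have B1 := abs_le.1 hstat
  have B2 := abs_le.1 (hround a ha)
  have B3 := abs_le.1 (hround b hb)
  have B4 := abs_le.1 (hHb a ha a ha)
  have B5 := abs_le.1 (hHb b hb b hb)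
  have B6 := abs_le.1 (hHb a ha b hb)
  have B7 := abs_le.1 (hLb a)
  have B8 := abs_le.1 (hLb b)
  have Fa := hF a ha
  have Fb := hF b hb
  generalize ∑ j, H a j * z j = p at *
  generalize ∑ j, H b j * z j = q at *
  generalize ∑ j, H a j * u j = r at *
  generalize ∑ j, H b j * u j = s at *
  push_cast at *
  set D : ℤ := 8 * k * Fintype.card ι with hD
  set E : ℤ := 6 * M ^ 2 * Fintype.card ι ^ 2 with hE
  set W : ℤ := 8 * k * Fintype.card ι ^ 2 with hW
  have hD0 : 0 ≤ D := by positivity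
  have hE0 : 0 ≤ E := by positivity
  -- Stationarity of the unscaled vector bounds `p - q`; after division by `2 ^ t` the rounding
  -- error is still bounded independently of `t`.
  have hrs : |r - s| ≤ 2 * D + 2 * E + 2 * W := by
    have h1 : 2 ^ t * (r - s) ≤ 2 ^ t * (2 * D + 2 * E + 2 * W) := by nlinarith
    have h2 : 2 ^ t * (-(2 * D + 2 * E + 2 * W)) ≤ 2 ^ t * (r - s) := by nlinarith
    exact abs_le.2 ⟨le_of_mul_le_mul_left h2 (by linarith), le_of_mul_le_mul_left h1 (by linarith)⟩
  have B9 := abs_le.1 hrs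
  rw [abs_le]
  constructor <;> linarith

/-- Vectors supported on the large coordinates are determined by the class sums and the marginal
values. -/
theorem IsSpreadMin.injective (h : IsSpreadMin κ lab x)
    (hκ : ∀ a b l, 0 ≤ κ a b l ∧ κ a b l ≤ 2) (hadj : FewNeighbours κ k M x) (hkM : k ≤ M)
    (hM : (Fintype.card ι * (2 * (8 * k * Fintype.card ι) + 1)) ^ Fintype.card ι ≤ M)
    {u v : ι → ℤ} (hu : ∀ j ∉ largeSet M x, u j = 0) (hv : ∀ j ∉ largeSet M x, v j = 0)
    (hsum : ∀ i, ∑ j with lab j = lab i, u j = ∑ j with lab j = lab i, v j)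
    (hdiff : ∀ a ∈ largeSet M x, ∀ b ∈ largeSet M x, lab a = lab b →
      cubic κ (u + Pi.single a 1 + smallPart M x) - cubic κ (u + Pi.single b 1 + smallPart M x) =
      cubic κ (v + Pi.single a 1 + smallPart M x) - cubic κ (v + Pi.single b 1 + smallPart M x)) :
    u = v := by
  have hF : ∀ w : ι → ℤ, (∀ j ∉ largeSet M x, w j = 0) → ∀ c ∈ largeSet M x,
      2 * cubic κ (w + Pi.single c 1 + smallPart M x) =
      2 * cubic κ (smallPart M x) + (quad (hess κ (smallPart M x)) (grad κ (smallPart M x)) w +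
        2 * (grad κ (smallPart M x) c + ∑ j, hess κ (smallPart M x) c j * w j) +
        hess κ (smallPart M x) c c) := by
    intro w hw c hc
    rw [two_mul_cubic_eq_quad hadj hkM, quad_add_single (hess_comm _ _)]
    intro j hj
    have : j ≠ c := fun e => hj (e ▸ hc)
    simp [hw j hj, this]
  -- Differences of energies under unit bumps recover the differences of rows of `H u`; the gradient
  -- and diagonal terms are the same for `u` and `v` and cancel. Thus `u - v` lies in the radical.
  refine sub_eq_zero.1 (eq_zero_of_radical lab (hess κ (smallPart M x)) (largeSet M x)
    (fun a ha b hb => abs_hess_le hκ h.nonneg hadj ha hb) hM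
    (fun y h1 h2 h3 => (h.second_order hadj hkM h1 h2 h3).2) (fun j hj => by simp [hu j hj, hv j hj])
    (fun i => by simp [sum_sub_distrib, hsum i]) fun a ha b hb hab => ?_)
  have h1 := hF u hu a ha
  have h2 := hF u hu b hb
  have h3 := hF v hv a ha
  have h4 := hF v hv b hb
  have h5 := hdiff a ha b hb hab
  simp only [Pi.sub_apply, mul_sub, sum_sub_distrib]
  linarith

end Core

/-! ### The cost of a layout: effect of a swap, and the cubic formula for blocks. -/

section Cost

variable {n : ℕ} (G : SimpleGraph (Fin n))

open Classical in
/-- The adjacency matrix with integer entries. -/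
noncomputable def adj (u v : Fin n) : ℤ := if G.Adj u v then 1 else 0

theorem adj_comm (u v : Fin n) : adj G u v = adj G v u := by
  by_cases h : G.Adj u v
  · simp [adj, h, h.symm]
  · have h' : ¬ G.Adj v u := fun h' => h h'.symm
    simp [adj, h, h']

theorem cost_eq_sum_lt (σ : Equiv.Perm (Fin n)) :
    cost G σ = ∑ u, ∑ v, adj G u v * if σ u < σ v then ((σ v : ℕ) - (σ u : ℕ) : ℤ) else 0 := by
  classical
  rw [← sum_product', cost]
  have h1 : ∀ p ∈ (univ ×ˢ univ : Finset (Fin n × Fin n)),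
      adj G p.1 p.2 * (if σ p.1 < σ p.2 then ((σ p.2 : ℕ) - (σ p.1 : ℕ) : ℤ) else 0) =
      if G.Adj p.1 p.2 ∧ σ p.1 < σ p.2 then ((σ p.2 : ℕ) - (σ p.1 : ℕ) : ℤ) else 0 := by
    intro p _
    unfold adj
    split_ifs <;> simp_all
  rw [sum_congr rfl h1, ← sum_filter]
  symm
  refine sum_bij (fun p _ => s(p.1, p.2)) (fun p hp => ?_) (fun p hp q hq h => ?_)
    (fun e he => ?_) (fun p hp => ?_)
  · simp only [mem_filter] at hp
    simpa using hp.2.1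
  · simp only [mem_filter] at hp hq
    rcases Sym2.eq_iff.1 h with ⟨h1, h2⟩ | ⟨h1, h2⟩
    · exact Prod.ext h1 h2
    · rw [h1, h2] at hp
      exact absurd hp.2.2 hq.2.2.not_gt
  · induction e with
    | _ u v =>
      have huv : G.Adj u v := by simpa using he
      rcases lt_or_gt_of_ne (fun h => huv.ne (σ.injective h) : σ u ≠ σ v) with h | h
      · exact ⟨(u, v), by simp [huv, h], rfl⟩
      · exact ⟨(v, u), by simp [huv.symm, h], Sym2.eq_swap⟩
  · simp only [mem_filter] at hp
    have : (σ p.1 : ℕ) < σ p.2 := hp.2.2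
    rw [Sym2.lift_mk]
    simp only [pos]
    rw [abs_sub_comm, abs_of_nonneg] <;> push_cast <;> linarith

theorem two_mul_cost (σ : Equiv.Perm (Fin n)) :
    2 * cost G σ = ∑ u, ∑ v, adj G u v * |((σ u : ℕ) : ℤ) - (σ v : ℕ)| := by
  have h : cost G σ = ∑ u, ∑ v, adj G u v *
      if σ v < σ u then ((σ u : ℕ) - (σ v : ℕ) : ℤ) else 0 := by
    rw [cost_eq_sum_lt, sum_comm]
    exact sum_congr rfl fun u _ => sum_congr rfl fun v _ => by rw [adj_comm]
  rw [two_mul]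
  nth_rw 1 [cost_eq_sum_lt]
  rw [h]
  simp only [← sum_add_distrib, ← mul_add]
  refine sum_congr rfl fun u _ => sum_congr rfl fun v _ => ?_
  congr 1
  rcases lt_trichotomy (σ u) (σ v) with h | h | h
  · have h' : (σ u : ℕ) < σ v := h
    rw [if_pos h, if_neg h.not_gt, abs_sub_comm, abs_of_nonneg] <;> linarith
  · simp [h]
  · have h' : (σ v : ℕ) < σ u := h
    rw [if_pos h, if_neg h.not_gt, abs_of_nonneg] <;> linarith

/-- Number of left neighbours minus number of right neighbours. -/
noncomputable def slope (σ : Equiv.Perm (Fin n)) (u : Fin n) : ℤ :=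
  ∑ y, adj G u y * if σ y < σ u then 1 else -1

/-- One step to the right lengthens the edges of `u` to the left and shortens those to the right,
each by one; for `v` it is the reverse. As `u` and `v` are not adjacent, no edge is affected twice.
-/
theorem cost_swap (σ : Equiv.Perm (Fin n)) {u v : Fin n} (hpos : (σ v : ℕ) = σ u + 1)
    (huv : ¬ G.Adj u v) :
    cost G ((Equiv.swap u v).trans σ) = cost G σ + slope G σ u - slope G σ v := by
  classical
  set s : Fin n → Fin n → ℤ := fun w y => if σ y < σ w then 1 else -1 with hs
  set τ := (Equiv.swap u v).trans σ with hτ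
  have hne : u ≠ v := by rintro rfl; omega
  have hτu : τ u = σ v := by simp [hτ]
  have hτv : τ v = σ u := by simp [hτ]
  have hτw : ∀ w, w ≠ u → w ≠ v → τ w = σ w := fun w h1 h2 => by
    simp [hτ, Equiv.swap_apply_of_ne_of_ne h1 h2]
  have hval : ∀ w w', w ≠ w' → (σ w : ℕ) ≠ σ w' := fun w w' h e => h (σ.injective (Fin.ext e))
  have hu : ∀ y, y ≠ u → y ≠ v → |((σ v : ℕ) : ℤ) - (σ y : ℕ)| =
      |((σ u : ℕ) : ℤ) - (σ y : ℕ)| + s u y := by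
    intro y h1 h2
    have e1 := hval y u h1
    have e2 := hval y v h2
    simp only [hs, Fin.lt_def]
    split_ifs with h
    · rw [abs_of_nonneg (by omega), abs_of_nonneg (by omega)]; omega
    · rw [abs_of_nonpos (by omega), abs_of_nonpos (by omega)]; omega
  have hv : ∀ y, y ≠ u → y ≠ v → |((σ u : ℕ) : ℤ) - (σ y : ℕ)| =
      |((σ v : ℕ) : ℤ) - (σ y : ℕ)| - s v y := by
    intro y h1 h2
    have e1 := hval y u h1
    have e2 := hval y v h2
    simp only [hs, Fin.lt_def]
    split_ifs with h
    · rw [abs_of_nonneg (by omega), abs_of_nonneg (by omega)]; omega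
    · rw [abs_of_nonpos (by omega), abs_of_nonpos (by omega)]; omega
  have key : ∀ x y, adj G x y * |((τ x : ℕ) : ℤ) - (τ y : ℕ)| =
      adj G x y * |((σ x : ℕ) : ℤ) - (σ y : ℕ)| +
      ((if x = u then adj G x y * s x y else 0) - (if x = v then adj G x y * s x y else 0) +
      (if y = u then adj G y x * s y x else 0) - (if y = v then adj G y x * s y x else 0)) := by
    intro x y
    by_cases hA : G.Adj x y
    · have hxy : x ≠ y := hA.ne
      by_cases hxu : x = u
      · subst hxu
        have hyv : y ≠ v := fun e => huv (e ▸ hA)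
        rw [hτu, hτw y hxy.symm hyv, hu y hxy.symm hyv]
        simp [hne, hxy.symm, hyv, mul_add]
      by_cases hxv : x = v
      · subst hxv
        have hyu : y ≠ u := fun e => huv (e ▸ hA.symm)
        rw [hτv, hτw y hyu hxy.symm, hv y hyu hxy.symm]
        simp [hxu, hyu, hxy.symm, mul_sub]
        ring
      rw [hτw x hxu hxv, adj_comm G y x]
      by_cases hyu : y = u
      · subst hyu
        rw [hτu, abs_sub_comm, hu x hxu hxv, abs_sub_comm]
        simp [hxu, hxv, hne, mul_add]
      by_cases hyv : y = v
      · subst hyv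
        rw [hτv, abs_sub_comm, hv x hxu hxv, abs_sub_comm]
        simp [hxu, hxv, hyu, mul_sub]
        ring
      rw [hτw y hyu hyv]
      simp [hxu, hxv, hyu, hyv]
    · have h1 : adj G x y = 0 := by simp [adj, hA]
      have h2 : adj G y x = 0 := by rw [adj_comm, h1]
      simp [h1, h2]
  have h2 : 2 * cost G τ = 2 * cost G σ + 2 * (slope G σ u - slope G σ v) := by
    rw [two_mul_cost, two_mul_cost, sum_congr rfl fun x _ => sum_congr rfl fun y _ => key x y]
    simp only [sum_add_distrib, sum_sub_distrib]
    rw [sum_comm (f := fun x y => if y = u then adj G y x * s y x else 0),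
      sum_comm (f := fun x y => if y = v then adj G y x * s y x else 0)]
    simp only [sum_ite_irrel, sum_const_zero, sum_ite_eq', mem_univ, if_true, slope]
    ring
  linarith

/-- The cost of a layout whose vertices are grouped into consecutive blocks, in terms of the sizes
of the blocks. -/
theorem two_mul_cost_eq_cubic {m : ℕ} {σ : Equiv.Perm (Fin n)} {β : Fin n → Fin m}
    (hβ : ∀ u v, β u < β v → σ u < σ v) {e : Fin m → Fin m → ℤ}
    (he : ∀ u v, adj G u v = e (β u) (β v)) (hind : ∀ u v, β u = β v → ¬ G.Adj u v) :
    2 * cost G σ = cubic (fun i j l => e i j *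
      if i < j then (if i < l ∧ l < j then 2 else if l = i ∨ l = j then 1 else 0) else 0)
      (fun j => #{v | β v = j}) := by
  classical
  have hfib : ∀ f : Fin m → ℤ, ∑ j, f j * (#{v | β v = j} : ℕ) = ∑ v, f (β v) := by
    intro f
    rw [← sum_fiberwise univ β]
    refine sum_congr rfl fun j _ => ?_
    rw [sum_congr rfl (g := fun _ => f j) (fun v hv => by rw [(mem_filter.1 hv).2])]
    simp [mul_comm]
  set c : Fin m → Fin m → Fin m → ℤ := fun i j l =>
    if i < j then (if i < l ∧ l < j then 2 else if l = i ∨ l = j then 1 else 0) else 0 with hc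
  have hR : cubic (fun i j l => e i j * c i j l) (fun j => #{v | β v = j}) =
      ∑ u, ∑ v, ∑ w, adj G u v * c (β u) (β v) (β w) := by
    simp only [cubic, trilin, he]
    rw [← hfib fun i => ∑ v, ∑ w, e i (β v) * c i (β v) (β w)]
    refine sum_congr rfl fun i _ => ?_
    rw [← hfib fun j => ∑ w, e i j * c i j (β w), sum_mul]
    refine sum_congr rfl fun j _ => ?_
    rw [← hfib fun l => e i j * c i j l, sum_mul, sum_mul]
    exact sum_congr rfl fun l _ => by ring
  -- A vertex `w` in the block of `u` is counted 0, 1 or 2 times in twice the length of an edge at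
  -- `u`; `p` is the antisymmetric deviation from the average 1.
  set p : Fin n → Fin n → ℤ := fun u w =>
    (if σ u < σ w then 1 else 0) + (if σ u ≤ σ w then 1 else 0) - 1 with hp
  have hpanti : ∀ u w, p u w = -p w u := by
    intro u w
    rcases lt_trichotomy (σ u) (σ w) with h | h | h
    · simp [hp, h, h.le, h.not_gt, h.not_ge]
    · simp [hp, h]
    · simp [hp, h, h.le, h.not_gt, h.not_ge]
  have hanti : ∀ f : Fin n → Fin n → ℤ, (∀ u w, f u w = -f w u) → ∑ u, ∑ w, f u w = 0 := by
    intro f hf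
    have h1 : ∑ u, ∑ w, f u w = -∑ u, ∑ w, f u w := by
      conv_rhs => rw [sum_comm]
      simp only [← sum_neg_distrib]
      exact sum_congr rfl fun u _ => sum_congr rfl fun w _ => by rw [hf]
    omega
  -- Counting with both half-open intervals treats the two ends symmetrically: vertices strictly
  -- between count twice, end vertices once.
  have hdist : ∀ u v, σ u < σ v → 2 * (((σ v : ℕ) : ℤ) - (σ u : ℕ)) =
      ∑ w, ((if σ u < σ w ∧ σ w ≤ σ v then 1 else 0) +
        (if σ u ≤ σ w ∧ σ w < σ v then 1 else 0)) := by
    intro u v h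
    have h' : (σ u : ℕ) < σ v := h
    rw [sum_add_distrib, Equiv.sum_comp σ fun q => if σ u < q ∧ q ≤ σ v then (1 : ℤ) else 0,
      Equiv.sum_comp σ fun q => if σ u ≤ q ∧ q < σ v then (1 : ℤ) else 0, ← sum_filter,
      ← sum_filter, sum_const, sum_const,
      show (univ.filter fun q => σ u < q ∧ q ≤ σ v) = Ioc (σ u) (σ v) by ext; simp,
      show (univ.filter fun q => σ u ≤ q ∧ q < σ v) = Ico (σ u) (σ v) by ext; simp,
      Fin.card_Ioc, Fin.card_Ico, nsmul_one, Nat.cast_sub h'.le]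
    ring
  have hterm : ∀ u v, 2 * (adj G u v * if σ u < σ v then ((σ v : ℕ) - (σ u : ℕ) : ℤ) else 0) =
      ∑ w, (adj G u v * c (β u) (β v) (β w) +
        (if β u < β v then adj G u v * (if β w = β u then p u w else 0) else 0) +
        (if β u < β v then adj G u v * (if β w = β v then p w v else 0) else 0)) := by
    intro u v
    by_cases hA : G.Adj u v
    · rcases lt_trichotomy (β u) (β v) with h | h | h
      · have hσ := hβ u v h
        rw [if_pos hσ, mul_left_comm, hdist u v hσ, mul_sum]
        refine sum_congr rfl fun w _ => ?_
        rw [if_pos h, if_pos h, ← mul_add, ← mul_add]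
        congr 1
        simp only [hc, if_pos h]
        rcases lt_trichotomy (β w) (β u) with h1 | h1 | h1
        · have e1 := hβ w u h1
          have h2 : β w ≠ β v := (h1.trans h).ne
          simp [h1.not_gt, h1.ne, h2, e1.not_gt, e1.not_ge]
        · have e1 := hβ w v (h1 ▸ h)
          simp [h1, h.ne, e1, e1.le, hp]
        · rcases lt_trichotomy (β w) (β v) with h2 | h2 | h2
          · have e1 := hβ u w h1
            have e2 := hβ w v h2
            simp [h1, h2, h1.ne', h2.ne, e1, e1.le, e2, e2.le]
          · have e1 := hβ u w h1
            simp [h2, h.ne', e1, e1.le, hp]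
            ring
          · have e1 := hβ v w h2
            simp [h2.not_gt, h1.ne', h2.ne', e1.not_gt, e1.not_ge]
      · exact absurd hA (hind u v h)
      · have hσ := hβ v u h
        simp [hσ.not_gt, h.not_gt, hc]
    · simp [adj, hA]
  rw [cost_eq_sum_lt, hR, mul_sum]
  simp only [mul_sum]
  rw [sum_congr rfl fun u _ => sum_congr rfl fun v _ => hterm u v]
  simp only [sum_add_distrib]
  -- Adjacency depends only on the blocks, so exchanging `u` and `w` within a block changes only the
  -- sign of `p`, and the deviations cancel.
  have z1 : ∑ u, ∑ v, ∑ w, (if β u < β v then adj G u v * (if β w = β u then p u w else 0)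
      else 0) = 0 := by
    rw [sum_comm]
    refine sum_eq_zero fun v _ => hanti _ fun u w => ?_
    by_cases h : β w = β u
    · rw [he, he, h, hpanti u w]
      split_ifs <;> simp
    · simp [h, Ne.symm h]
  have z2 : ∑ u, ∑ v, ∑ w, (if β u < β v then adj G u v * (if β w = β v then p w v else 0)
      else 0) = 0 := by
    refine sum_eq_zero fun u _ => hanti _ fun v w => ?_
    by_cases h : β w = β v
    · rw [he, he, h, hpanti w v]
      split_ifs <;> simp
    · simp [h, Ne.symm h]
  rw [z1, z2]
  ring

end Cost

/-! ### Exchange arguments: an optimal layout with few runs of twins. -/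

section Runs

variable {n : ℕ} {G : SimpleGraph (Fin n)} {C : Finset (Fin n)} {lab : Fin n → ℕ}

/-- An optimal layout in which consecutive vertices outside of the vertex cover are sorted by slope,
and by label for equal slopes. -/
theorem exists_sorted_optimal (G : SimpleGraph (Fin n)) (hC : G.IsVertexCover (C : Set (Fin n)))
    (lab : Fin n → ℕ) :
    ∃ σ : Equiv.Perm (Fin n), IsOptimal G σ ∧ ∀ u v, u ∉ C → v ∉ C → (σ v : ℕ) = σ u + 1 →
      slope G σ v ≤ slope G σ u ∧ (slope G σ v = slope G σ u → lab u ≤ lab v) := by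
  -- Among the layouts of least cost, the second component prefers large labels far to the right. A
  -- cost-neutral swap of neighbours can then not improve the order of labels.
  obtain ⟨σ, -, hσ⟩ := exists_min_image (univ : Finset (Equiv.Perm (Fin n)))
    (fun σ => toLex (cost G σ, -∑ v, (lab v : ℤ) * (σ v : ℕ))) univ_nonempty
  simp only [mem_univ, true_implies, Prod.Lex.le_iff, ofLex_toLex] at hσ
  refine ⟨σ, fun τ => ?_, fun u v hu hv huv => ?_⟩
  · rcases hσ τ with h | h
    · exact h.le
    · exact h.1.le
  · have hne : u ≠ v := by rintro rfl; omega
    have hadj : ¬ G.Adj u v := fun h => by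
      rcases hC h with h' | h'
      · exact hu h'
      · exact hv h'
    have hswap := cost_swap G σ huv hadj
    have hmin := hσ ((Equiv.swap u v).trans σ)
    refine ⟨by rcases hmin with h | h <;> omega, fun hs => ?_⟩
    have h1 := (hmin.resolve_left (by omega)).2
    have h2 : ∑ w, (lab w : ℤ) * (((Equiv.swap u v).trans σ) w : ℕ) =
        ∑ w, (lab w : ℤ) * (σ w : ℕ) + (lab u - lab v) := by
      have h3 : ∀ w, (lab w : ℤ) * (((Equiv.swap u v).trans σ) w : ℕ) =
          (lab w : ℤ) * (σ w : ℕ) + ((if w = u then (lab u : ℤ) else 0) -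
            if w = v then (lab v : ℤ) else 0) := by
        intro w
        by_cases hwu : w = u
        · subst hwu
          simp [hne, huv, mul_add]
        by_cases hwv : w = v
        · subst hwv
          simp [hwu, huv, mul_add]
        simp [hwu, hwv, Equiv.swap_apply_of_ne_of_ne hwu hwv]
      rw [sum_congr rfl fun w _ => h3 w]
      simp [sum_add_distrib]
    omega

theorem eq_of_antitone_of_eq {f : ℕ → ℤ} {p q : ℕ} (hf : ∀ i, p ≤ i → i < q → f (i + 1) ≤ f i)
    (h : f p = f q) : ∀ i, p ≤ i → i ≤ q → f i = f p := by
  have h1 : ∀ i, p ≤ i → ∀ j, i ≤ j → j ≤ q → f j ≤ f i := by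
    intro i hi j hij
    induction j, hij using Nat.le_induction with
    | base => exact fun _ => le_rfl
    | succ j hij ih => exact fun hj => (hf j (by omega) (by omega)).trans (ih (by omega))
  intro i hp hq
  have h2 := h1 p le_rfl i hp hq
  have h3 := h1 i hp q hq le_rfl
  omega

/-- Twins in the same gap have only twins between them. -/
theorem next_label_eq (hC : G.IsVertexCover (C : Set (Fin n)))
    (hlab : ∀ u v, lab u = lab v → ∀ w, G.Adj u w ↔ G.Adj v w) {σ : Equiv.Perm (Fin n)}
    (hσ : ∀ u v, u ∉ C → v ∉ C → (σ v : ℕ) = σ u + 1 →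
      slope G σ v ≤ slope G σ u ∧ (slope G σ v = slope G σ u → lab u ≤ lab v))
    {u u' : Fin n} (huu' : σ u < σ u') (hgap : ∀ w, σ u ≤ σ w → σ w ≤ σ u' → w ∉ C)
    (heq : lab u = lab u') {w : Fin n} (hw : (σ w : ℕ) = σ u + 1) : lab w = lab u := by
  have huu'' : (σ u : ℕ) < σ u' := huu'
  let vtx : ℕ → Fin n := fun i => if h : i < n then σ.symm ⟨i, h⟩ else u
  have hvtx : ∀ i, i < n → (σ (vtx i) : ℕ) = i := fun i hi => by simp [vtx, hi]
  have hvtx' : ∀ v, vtx (σ v) = v := fun v => by simp [vtx]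
  have hC' : ∀ i, (σ u : ℕ) ≤ i → i ≤ σ u' → vtx i ∉ C := fun i h1 h2 => by
    have h3 := hvtx i (by omega)
    exact hgap _ (Fin.le_def.2 (by omega)) (Fin.le_def.2 (by omega))
  have hstep : ∀ i, (σ u : ℕ) ≤ i → i < σ u' →
      slope G σ (vtx (i + 1)) ≤ slope G σ (vtx i) ∧
      (slope G σ (vtx (i + 1)) = slope G σ (vtx i) → lab (vtx i) ≤ lab (vtx (i + 1))) :=
    fun i h1 h2 => hσ _ _ (hC' _ h1 (by omega)) (hC' _ (by omega) (by omega))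
      (by rw [hvtx _ (by omega), hvtx _ (by omega)])
  -- The neighbours of `u` lie in the cover, and none of them stands between `u` and `u'`; hence the
  -- twins have the same neighbours on the left and on the right.
  have hslope : slope G σ u = slope G σ u' := by
    refine sum_congr rfl fun y _ => ?_
    by_cases hy : G.Adj u y
    · have hy' := (hlab _ _ heq y).1 hy
      have hyC : y ∈ C := by
        rcases hC hy with h | h
        · exact absurd h (hgap u le_rfl huu'.le)
        · exact h
      have : σ y < σ u ↔ σ y < σ u' := by
        constructor
        · exact fun h => h.trans huu'
        · intro h
          by_contra h'
          exact hgap y (not_lt.1 h') h.le hyC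
      simp [adj, hy, hy', this]
    · have hy' : ¬ G.Adj u' y := fun h => hy ((hlab _ _ heq y).2 h)
      simp [adj, hy, hy']
  -- Slopes decrease along the gap and agree at its ends, so they are constant; then labels increase
  -- along the gap and agree at its ends, so they are constant too.
  have hs := eq_of_antitone_of_eq (f := fun i => slope G σ (vtx i)) (fun i h1 h2 =>
    (hstep i h1 h2).1) (by simpa [hvtx'] using hslope)
  have hl := eq_of_antitone_of_eq (f := fun i => -(lab (vtx i) : ℤ)) (p := σ u) (q := σ u')
    (fun i h1 h2 => by
      have := (hstep i h1 h2).2 ((hs (i + 1) (by omega) (by omega)).trans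
        (hs i h1 (by omega)).symm)
      simpa using this) (by simpa [hvtx'] using heq)
  have := hl (σ w) (by omega) (by omega)
  simpa [hvtx'] using this

/-- Some optimal layout consists of few runs of twins. -/
theorem exists_optimal_few_runs {k τ : ℕ} (hC : G.IsVertexCover (C : Set (Fin n)))
    (hk : #C ≤ k) (hlab : ∀ u v, lab u = lab v → ∀ w, G.Adj u w ↔ G.Adj v w)
    (hτ : #(univ.image lab) ≤ τ) :
    ∃ (σ : Equiv.Perm (Fin n)) (run : Fin n → ℕ), IsOptimal G σ ∧
      (∀ v, run v < 2 * (k + 1) * τ + 1) ∧ (∀ u v, σ u ≤ σ v → run u ≤ run v) ∧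
      ∀ u v, run u = run v → lab u = lab v := by
  classical
  obtain ⟨σ, hopt, hσ⟩ := exists_sorted_optimal G hC lab
  -- The last vertices of all runs but the final one.
  set B : Finset (Fin n) := univ.filter fun w => ∃ w', (σ w' : ℕ) = σ w + 1 ∧ lab w ≠ lab w'
    with hB
  have hcard : #B ≤ 2 * (k + 1) * τ := by
    -- Two run ends with equal data would be twins in the same gap, and by `next_label_eq` the first
    -- would not end its run. Counting the possible data gives `2 * (k + 1) * τ`.
    have hinj : Set.InjOn (fun w => (decide (w ∈ C), #{c ∈ C | σ c ≤ σ w}, lab w))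
        (B : Set (Fin n)) := by
      have key : ∀ w₁ ∈ B, ∀ w₂ ∈ B, (decide (w₁ ∈ C), #{c ∈ C | σ c ≤ σ w₁}, lab w₁) =
          (decide (w₂ ∈ C), #{c ∈ C | σ c ≤ σ w₂}, lab w₂) → ¬ σ w₁ < σ w₂ := by
        intro w₁ h₁ w₂ h₂ h hlt
        simp only [Prod.mk.injEq, decide_eq_decide] at h
        have hsub : {c ∈ C | σ c ≤ σ w₁} = {c ∈ C | σ c ≤ σ w₂} :=
          eq_of_subset_of_card_le (fun c hc => by
            simp only [mem_filter] at hc ⊢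
            exact ⟨hc.1, hc.2.trans hlt.le⟩) h.2.1.ge
        have hgap : ∀ w, σ w₁ < σ w → σ w ≤ σ w₂ → w ∉ C := by
          intro w hw hw' hwC
          have : w ∈ {c ∈ C | σ c ≤ σ w₁} := by
            rw [hsub]
            exact mem_filter.2 ⟨hwC, hw'⟩
          exact absurd (mem_filter.1 this).2 (not_le.2 hw)
        have hw₂ := hgap w₂ hlt le_rfl
        have hw₁ : w₁ ∉ C := fun h' => hw₂ (h.1.1 h')
        obtain ⟨w', hw', hne⟩ := (mem_filter.1 h₁).2
        refine hne (next_label_eq hC hlab hσ hlt (fun w hw hw' => ?_) h.2.2 hw').symm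
        rcases hw.eq_or_lt with e | hlt'
        · rwa [← σ.injective e]
        · exact hgap w hlt' hw'
      intro w₁ h₁ w₂ h₂ h
      by_contra hne
      rcases lt_or_gt_of_ne (fun e => hne (σ.injective e) : σ w₁ ≠ σ w₂) with hlt | hlt
      · exact key _ h₁ _ h₂ h hlt
      · exact key _ h₂ _ h₁ h.symm hlt
    have hmaps : ∀ w ∈ B, (decide (w ∈ C), #{c ∈ C | σ c ≤ σ w}, lab w) ∈
        (univ : Finset Bool) ×ˢ (range (k + 1) ×ˢ univ.image lab) := by
      intro w _
      have := (card_filter_le C fun c => σ c ≤ σ w).trans hk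
      simp only [mem_product, mem_univ, mem_range, mem_image, true_and]
      exact ⟨by omega, w, rfl⟩
    refine (card_le_card_of_injOn _ hmaps hinj).trans ?_
    rw [card_product, card_product, card_range, mul_assoc]
    exact Nat.mul_le_mul (by simp) (Nat.mul_le_mul_left _ hτ)
  -- The run of `v` is numbered by the breaks strictly before it.
  refine ⟨σ, fun v => #{w ∈ B | σ w < σ v}, hopt, fun v => ?_, fun u v h => ?_, ?_⟩
  · exact Nat.lt_succ_of_le ((card_filter_le _ _).trans hcard)
  · exact card_le_card fun w hw => by
      simp only [mem_filter] at hw ⊢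
      exact ⟨hw.1, hw.2.trans_le h⟩
  · have key : ∀ u v, σ u ≤ σ v → #{w ∈ B | σ w < σ u} = #{w ∈ B | σ w < σ v} →
        lab u = lab v := by
      intro u v huv h
      have hsub : {w ∈ B | σ w < σ u} = {w ∈ B | σ w < σ v} :=
        eq_of_subset_of_card_le (fun w hw => by
          simp only [mem_filter] at hw ⊢
          exact ⟨hw.1, hw.2.trans_le huv⟩) h.ge
      have hind : ∀ i, (σ u : ℕ) ≤ i → ∀ w, (σ w : ℕ) = i → i ≤ σ v → lab u = lab w := by
        intro i hi
        induction i, hi using Nat.le_induction with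
        | base => exact fun w hw _ => by rw [σ.injective (Fin.ext hw)]
        | succ i hi ih =>
          intro w hw hiv
          have hin : i < n := by have := (σ w).2; omega
          have h1 : (σ (σ.symm ⟨i, hin⟩) : ℕ) = i := by simp
          rw [ih _ h1 (by omega)]
          by_contra hne
          have h2 : σ.symm ⟨i, hin⟩ ∈ {w ∈ B | σ w < σ v} := by
            refine mem_filter.2 ⟨mem_filter.2 ⟨mem_univ _, w, by omega, hne⟩, ?_⟩
            rw [Fin.lt_def]
            omega
          rw [← hsub, mem_filter, Fin.lt_def] at h2
          omega
      exact hind _ huv v rfl le_rfl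
    intro u v h
    rcases le_total (σ u) (σ v) with h' | h'
    · exact key u v h' h
    · exact (key v u h' h.symm).symm

/-- A graph with a small vertex cover has few types of vertices. -/
theorem card_le_of_pairwise_not_twins {k : ℕ} (hC : G.IsVertexCover (C : Set (Fin n)))
    (hk : #C ≤ k) (S : Finset (Fin n))
    (hS : ∀ u ∈ S, ∀ v ∈ S, (∀ w, G.Adj u w ↔ G.Adj v w) → u = v) : #S ≤ k + 2 ^ k := by
  classical
  -- Outside of the cover a vertex has all its neighbours in `C`, so this subset of `C` determines
  -- its type.
  have hinj : Set.InjOn (fun v => if v ∈ C then Sum.inl v else Sum.inr (C.filter (G.Adj v)))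
      (S : Set (Fin n)) := by
    intro u hu v hv h
    dsimp only at h
    split_ifs at h with h1 h2 h2
    · exact Sum.inl_injective h
    · refine hS u hu v hv fun w => ?_
      have h3 := Sum.inr_injective h
      have key : ∀ u, u ∉ C → (G.Adj u w ↔ w ∈ C.filter (G.Adj u)) := by
        intro u hu
        rw [mem_filter]
        refine ⟨fun h => ⟨?_, h⟩, fun h => h.2⟩
        rcases hC h with h' | h'
        · exact absurd h' hu
        · exact h'
      rw [key u h1, key v h2, h3]
  refine (card_le_card_of_injOn (t := C.disjSum C.powerset) _ (fun v hv => ?_) hinj).trans ?_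
  · split_ifs with h
    · exact inl_mem_disjSum.2 h
    · exact inr_mem_disjSum.2 (mem_powerset.2 (filter_subset _ _))
  · rw [card_disjSum, card_powerset]
    exact add_le_add hk (Nat.pow_le_pow_right two_pos hk)

/-- Of two completely joined sets of vertices, one is small. -/
theorem card_le_of_complete {k : ℕ} (hC : G.IsVertexCover (C : Set (Fin n))) (hk : #C ≤ k)
    {S T : Finset (Fin n)} (h : ∀ u ∈ S, ∀ v ∈ T, G.Adj u v) (hS : k < #S) : #T ≤ k := by
  -- A vertex of `S` outside of the cover forces all of `T` into the cover.
  obtain ⟨u, hu, huC⟩ := exists_mem_notMem_of_card_lt_card (hk.trans_lt hS)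
  refine (card_le_card fun v hv => ?_).trans hk
  rcases hC (h u hu v hv) with h' | h'
  · exact absurd h' huC
  · exact h'

end Runs

/-! ### Realising prescribed block sizes by an explicit layout. -/

section Blocks

theorem mem_iff_lt_card_of_lower {m : ℕ} {S : Finset (Fin m)} (hS : ∀ i ∈ S, ∀ j ≤ i, j ∈ S)
    (j : Fin m) : j ∈ S ↔ (j : ℕ) < #S := by
  constructor
  · intro hj
    have := card_le_card (fun i hi => hS j hj i (mem_Iic.1 hi) : Iic j ⊆ S)
    rw [Fin.card_Iic] at this
    omega
  · intro hj
    by_contra h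
    have := card_le_card (fun i hi => mem_Iio.2 (by
      by_contra h'
      exact h (hS i hi j (not_lt.1 h'))) : S ⊆ Iio j)
    rw [Fin.card_Iio] at this
    omega

variable {n m : ℕ} (lab : Fin m → ℕ) (cl : Fin n → ℕ) (x : Fin m → ℕ)

/-- Number of earlier vertices of the same class. -/
def classRank (v : Fin n) : ℕ := #{w | w < v ∧ cl w = cl v}

/-- The block in which `v` is placed, if the blocks of its class are filled in order. -/
def blockOf (v : Fin n) : ℕ :=
  #{j : Fin m | ∑ i with i ≤ j ∧ lab i = cl v, x i ≤ classRank cl v}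

/-- Number of vertices that are placed before `v`. -/
def placeOf (v : Fin n) : ℕ :=
  #{w | blockOf lab cl x w < blockOf lab cl x v ∨
    blockOf lab cl x w = blockOf lab cl x v ∧ w < v}

/-- The blocks of each class have the right total size. -/
def Fits : Prop :=
  (∀ v, ∑ j with lab j = cl v, x j = #{w | cl w = cl v}) ∧
    ∀ i, ∑ j with lab j = lab i, x j = #{w | cl w = lab i}

theorem image_classRank (s : ℕ) :
    (univ.filter fun w => cl w = s).image (classRank cl) = range #{w | cl w = s} := by
  refine eq_of_subset_of_card_le (fun r hr => ?_) ?_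
  · obtain ⟨v, hv, rfl⟩ := mem_image.1 hr
    have hv' : cl v = s := by simpa using hv
    refine mem_range.2 (card_lt_card (Finset.ssubset_iff_subset_ne.2 ⟨fun w hw => ?_, fun h => ?_⟩))
    · simp only [mem_filter, mem_univ, true_and] at hw ⊢
      exact hw.2.trans hv'
    · rw [← h] at hv
      simp at hv
  · rw [card_range, card_image_of_injOn]
    have key : ∀ u v, cl u = s → cl v = s → u < v → classRank cl u < classRank cl v := by
      intro u v hu hv huv
      refine card_lt_card (Finset.ssubset_iff_subset_ne.2 ⟨fun w hw => ?_, fun h => ?_⟩)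
      · simp only [mem_filter, mem_univ, true_and] at hw ⊢
        exact ⟨hw.1.trans huv, by rw [hw.2, hu, hv]⟩
      · have : u ∈ univ.filter fun w => w < v ∧ cl w = cl v := by simp [huv, hu, hv]
        rw [← h] at this
        simp at this
    intro u hu v hv h
    simp only [coe_filter, mem_univ, true_and, Set.mem_ofPred_eq] at hu hv
    rcases lt_trichotomy u v with h' | h' | h'
    · exact absurd h (key u v hu hv h').ne
    · exact h'
    · exact absurd h (key v u hv hu h').ne'

theorem classRank_lt (v : Fin n) : classRank cl v < #{w | cl w = cl v} := by
  rw [← mem_range, ← image_classRank]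
  exact mem_image_of_mem _ (by simp)

variable {lab cl x}

theorem lt_blockOf_iff (v : Fin n) (j : Fin m) :
    (j : ℕ) < blockOf lab cl x v ↔
      ∑ i with i ≤ j ∧ lab i = cl v, x i ≤ classRank cl v := by
  rw [blockOf, ← mem_iff_lt_card_of_lower, mem_filter]
  · simp
  · intro i hi j hij
    simp only [mem_filter, mem_univ, true_and] at hi ⊢
    refine (sum_le_sum_of_subset fun l hl => ?_).trans hi
    simp only [mem_filter, mem_univ, true_and] at hl ⊢
    exact ⟨hl.1.trans hij, hl.2⟩

theorem blockOf_lt (h : Fits lab cl x) (v : Fin n) : blockOf lab cl x v < m := by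
  by_contra hge
  have h1 := classRank_lt cl v
  rw [← h.1 v] at h1
  rcases Nat.eq_zero_or_pos m with rfl | hm
  · simp at h1
  · have h2 := (lt_blockOf_iff (lab := lab) (cl := cl) (x := x) v ⟨m - 1, by omega⟩).1
      (by dsimp only; omega)
    rw [show (univ.filter fun i : Fin m => i ≤ ⟨m - 1, by omega⟩ ∧ lab i = cl v) =
      univ.filter fun i => lab i = cl v from filter_congr fun i _ => by
        simp only [Fin.le_def, and_iff_right_iff_imp]
        intro _
        omega] at h2
    omega

theorem blockOf_eq_iff (h : Fits lab cl x) (v : Fin n) (j : Fin m) :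
    blockOf lab cl x v = j ↔ ∑ i with i < j ∧ lab i = cl v, x i ≤ classRank cl v ∧
      classRank cl v < ∑ i with i ≤ j ∧ lab i = cl v, x i := by
  constructor
  · intro hj
    refine ⟨?_, ?_⟩
    · rcases Nat.eq_zero_or_pos (j : ℕ) with h0 | h0
      · rw [sum_eq_zero]
        · exact Nat.zero_le _
        · intro i hi
          have := (mem_filter.1 hi).2.1
          rw [Fin.lt_def] at this
          omega
      · have h2 := (lt_blockOf_iff (lab := lab) (cl := cl) (x := x) v ⟨j - 1, by omega⟩).1
          (by dsimp only; omega)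
        refine (sum_le_sum_of_subset fun i hi => ?_).trans h2
        simp only [mem_filter, mem_univ, true_and, Fin.lt_def, Fin.le_def] at hi ⊢
        exact ⟨by omega, hi.2⟩
    · exact not_le.1 fun h' => by
        have := (lt_blockOf_iff v j).2 h'
        omega
  · rintro ⟨h1, h2⟩
    refine le_antisymm (not_lt.1 fun h' => ?_) (not_lt.1 fun h' => ?_)
    · exact h2.not_ge ((lt_blockOf_iff v j).1 h')
    · have := (lt_blockOf_iff (lab := lab) (cl := cl) (x := x) v
        ⟨blockOf lab cl x v, blockOf_lt h v⟩).2 ((sum_le_sum_of_subset fun i hi => by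
          simp only [mem_filter, mem_univ, true_and, Fin.lt_def, Fin.le_def] at hi ⊢
          exact ⟨by omega, hi.2⟩).trans h1)
      exact lt_irrefl _ this

theorem sum_le_eq_add (s : ℕ) (j : Fin m) :
    ∑ i with i ≤ j ∧ lab i = s, x i =
      ∑ i with i < j ∧ lab i = s, x i + if lab j = s then x j else 0 := by
  have h : ∀ i : Fin m, (if i ≤ j ∧ lab i = s then x i else 0) =
      (if i < j ∧ lab i = s then x i else 0) + if i = j then (if lab j = s then x j else 0)
        else 0 := by
    intro i
    rcases lt_trichotomy i j with h | h | h
    · simp [h, h.le, h.ne]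
    · simp [h]
    · simp [h.not_gt, h.not_ge, h.ne']
  rw [sum_filter, sum_congr rfl fun i _ => h i, sum_add_distrib, ← sum_filter]
  simp

/-- The partial sum over the blocks of the class of `v` passes the rank of `v` exactly at this
block, so the block itself contributes to that sum. -/
theorem label_blockOf (h : Fits lab cl x) (v : Fin n) :
    lab ⟨blockOf lab cl x v, blockOf_lt h v⟩ = cl v := by
  have h1 := (blockOf_eq_iff h v ⟨blockOf lab cl x v, blockOf_lt h v⟩).1 rfl
  rw [sum_le_eq_add] at h1
  by_contra hne
  rw [if_neg hne] at h1
  omega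

/-- Ranks enumerate a class without repetition, and block `j` receives an interval of ranks of
length `x j`. -/
theorem card_blockOf_eq (h : Fits lab cl x) (j : Fin m) :
    #{v | blockOf lab cl x v = j} = x j := by
  have h1 : (univ.filter fun v => blockOf lab cl x v = j).image (classRank cl) =
      Ico (∑ i with i < j ∧ lab i = lab j, x i) (∑ i with i ≤ j ∧ lab i = lab j, x i) := by
    ext r
    simp only [mem_image, mem_filter, mem_univ, true_and, mem_Ico]
    constructor
    · rintro ⟨v, hv, rfl⟩
      have h2 : cl v = lab j := by
        rw [← label_blockOf h v]
        exact congrArg lab (Fin.ext hv)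
      rw [blockOf_eq_iff h, h2] at hv
      exact hv
    · rintro ⟨hr1, hr2⟩
      have h3 : r ∈ range #{w | cl w = lab j} := by
        rw [mem_range, ← h.2 j]
        refine hr2.trans_le (sum_le_sum_of_subset fun i hi => ?_)
        simp only [mem_filter, mem_univ, true_and] at hi ⊢
        exact hi.2
      rw [← image_classRank] at h3
      obtain ⟨v, hv, rfl⟩ := mem_image.1 h3
      have hv' : cl v = lab j := by simpa using hv
      exact ⟨v, (blockOf_eq_iff h v j).2 (by rw [hv']; exact ⟨hr1, hr2⟩), rfl⟩
  have hinj : Set.InjOn (classRank cl)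
      ((univ.filter fun v => blockOf lab cl x v = j : Finset (Fin n)) : Set (Fin n)) := by
    have hcl : ((univ.filter fun v => blockOf lab cl x v = j : Finset (Fin n)) : Set (Fin n)) ⊆
        (univ.filter fun v => cl v = lab j : Finset (Fin n)) := by
      intro v hv
      simp only [coe_filter, mem_univ, true_and, Set.mem_ofPred_eq] at hv ⊢
      rw [← label_blockOf h v]
      exact congrArg lab (Fin.ext hv)
    refine Set.InjOn.mono hcl (card_image_iff.1 ?_)
    rw [image_classRank, card_range]
  rw [← card_image_of_injOn hinj, h1, Nat.card_Ico, sum_le_eq_add]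
  simp

theorem placeOf_lt (v : Fin n) : placeOf lab cl x v < n := by
  conv_rhs => rw [← Fintype.card_fin n]
  refine card_lt_univ_of_notMem (x := v) ?_
  simp

theorem placeOf_lt_placeOf {u v : Fin n} (h : blockOf lab cl x u < blockOf lab cl x v ∨
    blockOf lab cl x u = blockOf lab cl x v ∧ u < v) :
    placeOf lab cl x u < placeOf lab cl x v := by
  refine card_lt_card (Finset.ssubset_iff_subset_ne.2 ⟨fun w hw => ?_, fun he => ?_⟩)
  · simp only [mem_filter, mem_univ, true_and] at hw ⊢
    omega
  · have : u ∈ univ.filter fun w => blockOf lab cl x w < blockOf lab cl x v ∨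
        blockOf lab cl x w = blockOf lab cl x v ∧ w < v := by simpa using h
    rw [← he] at this
    simp at this

/-- Block sizes that fit are realised by the layout `placeOf`. -/
theorem exists_layout_of_fits (h : Fits lab cl x) :
    ∃ (σ : Equiv.Perm (Fin n)) (β : Fin n → Fin m), (∀ v, (σ v : ℕ) = placeOf lab cl x v) ∧
      (∀ u v, β u < β v → σ u < σ v) ∧ (∀ v, lab (β v) = cl v) ∧ ∀ j, #{v | β v = j} = x j := by
  have hinj : Function.Injective
      (fun v => (⟨placeOf lab cl x v, placeOf_lt v⟩ : Fin n)) := by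
    intro u v huv
    have h1 : placeOf lab cl x u = placeOf lab cl x v := congrArg Fin.val huv
    by_contra hne
    have h2 : (blockOf lab cl x u < blockOf lab cl x v ∨
        blockOf lab cl x u = blockOf lab cl x v ∧ u < v) ∨
        (blockOf lab cl x v < blockOf lab cl x u ∨
        blockOf lab cl x v = blockOf lab cl x u ∧ v < u) := by omega
    rcases h2 with h2 | h2
    · exact (placeOf_lt_placeOf h2).ne h1
    · exact (placeOf_lt_placeOf h2).ne' h1
  refine ⟨Equiv.ofBijective _ (Finite.injective_iff_bijective.1 hinj),
    fun v => ⟨blockOf lab cl x v, blockOf_lt h v⟩, fun v => rfl, fun u v huv => ?_,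
    label_blockOf h, fun j => ?_⟩
  · exact Fin.lt_def.2 (placeOf_lt_placeOf (Or.inl huv))
  · rw [← card_blockOf_eq h j]
    exact congrArg card (filter_congr fun v _ => Fin.ext_iff)

end Blocks

end OLA

namespace OLA

/-! ### The algorithm on lists of natural numbers. -/

section Algorithm

/-- Entry of a matrix given by its rows. -/
def entry (A : List (List ℕ)) (u v : ℕ) : ℕ := (A.getD u []).getD v 0

/-- Equality of the first `n` entries of two rows. -/
def twin (A : List (List ℕ)) (n u v : ℕ) : Bool :=
  (List.range n).all fun w => decide (entry A u w = entry A v w)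

/-- The first vertices of the classes of twins. -/
def reps (A : List (List ℕ)) (n : ℕ) : List ℕ :=
  (List.range n).filter fun v => (List.range v).all fun u => !twin A n u v

/-- Number of twins of a vertex. -/
def classSize (A : List (List ℕ)) (n s : ℕ) : ℕ :=
  ((List.range n).filter fun v => twin A n s v).length

/-- The classes of the blocks of which a layout is composed. -/
def labels (A : List (List ℕ)) (n k : ℕ) : List ℕ :=
  -- One copy of all classes for each possible run; blocks that are not used have size zero.
  (List.replicate (2 * (k + 1) * (reps A n).length + 1) (reps A n)).flatten

/-- Contribution of a triple of blocks to twice the cost. -/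
def coeff (i j l : ℕ) : ℕ :=
  if i < j then (if i < l ∧ l < j then 2 else if l = i ∨ l = j then 1 else 0) else 0

/-- Twice the cost of a layout with blocks of labels `lab` and sizes `x`. -/
def energy (A : List (List ℕ)) (lab x : List ℕ) : ℕ :=
  ((List.range lab.length).map fun i => ((List.range lab.length).map fun j =>
    ((List.range lab.length).map fun l => entry A (lab.getD i 0) (lab.getD j 0) * coeff i j l *
      x.getD i 0 * x.getD j 0 * x.getD l 0).sum).sum).sum

/-- All lists of length `m` with entries less than `B`. -/
def vecs (B : ℕ) (m : ℕ) : List (List ℕ) :=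
  (fun L => L.flatMap fun l => (List.range B).map fun a => a :: l)^[m] [[]]

/-- Bound for the sizes of blocks that are guessed. -/
def smallBound (k m : ℕ) : ℕ := (m * (2 * (8 * k * m) + 1)) ^ m + (k + 1)

/-- Bound for the errors of approximate solutions. -/
def slack (k m : ℕ) : ℕ :=
  -- The first three summands come from `IsSpreadMin.stationary`, the last from rounding the class
  -- sums and omitting the small blocks.
  24 * smallBound k m ^ 2 * m ^ 2 + 24 * k * m + 16 * k * m ^ 2 + (m + m * smallBound k m)

/-- Bound for the number of approximate solutions. -/
def cap (k m : ℕ) : ℕ := (2 * slack k m + 1) ^ m * (2 * slack k m + 1) ^ (m * m)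

/-- The coordinates that are not guessed. -/
def isFree (k m : ℕ) (g : List ℕ) (j : ℕ) : Bool := decide (g.getD j 0 = smallBound k m + 1)

/-- Replacement of the free coordinates of `g` by those of `z`. -/
def merge (k m : ℕ) (g z : List ℕ) : List ℕ :=
  (List.range m).map fun j => if isFree k m g j then z.getD j 0 else g.getD j 0

/-- Addition of a unit vector. -/
def bump (m : ℕ) (z : List ℕ) (a : ℕ) : List ℕ :=
  (List.range m).map fun j => z.getD j 0 + if decide (j = a) then 1 else 0

/-- Binary extension of the entries of `z`. -/
def double (m : ℕ) (z b : List ℕ) : List ℕ :=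
  (List.range m).map fun j => 2 * z.getD j 0 + b.getD j 0

/-- Sum of the free coordinates with the same label as `i`. -/
def freeSum (k : ℕ) (lab g z : List ℕ) (i : ℕ) : ℕ :=
  ((List.range lab.length).map fun j =>
    if isFree k lab.length g j && decide (lab.getD j 0 = lab.getD i 0) then z.getD j 0 else 0).sum

/-- Test of the class sums of an approximate solution at scale `2 ^ t`. -/
def testSums (A : List (List ℕ)) (n k : ℕ) (lab g : List ℕ) (t : ℕ) (z : List ℕ) : Bool :=
  (List.range lab.length).all fun i => if isFree k lab.length g i then
    decide (freeSum k lab g z i ≤ (· / 2)^[t] (classSize A n (lab.getD i 0)) + slack k lab.length) &&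
    decide ((· / 2)^[t] (classSize A n (lab.getD i 0)) ≤ freeSum k lab g z i + slack k lab.length)
    else decide (z.getD i 0 = 0)

/-- Test of the stationarity of an approximate solution. -/
def testEnergy (A : List (List ℕ)) (k : ℕ) (lab g z : List ℕ) : Bool :=
  (List.range lab.length).all fun a => (List.range lab.length).all fun b =>
    !(isFree k lab.length g a && (isFree k lab.length g b &&
      decide (lab.getD a 0 = lab.getD b 0))) ||
    decide (energy A lab (merge k lab.length g (bump lab.length z a)) ≤
      energy A lab (merge k lab.length g (bump lab.length z b)) + slack k lab.length)

/-- The next digit of all approximate solutions. -/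
def expand (m : ℕ) (L : List (List ℕ)) : List (List ℕ) :=
  L.flatMap fun z => (vecs 2 m).map fun b => double m z b

/-- The approximate solutions at the next scale. -/
def refineStep (A : List (List ℕ)) (n k : ℕ) (lab g : List ℕ) (t : ℕ) (L : List (List ℕ)) :
    List (List ℕ) :=
  let L' := (expand lab.length L).filter fun z =>
    testSums A n k lab g t z && testEnergy A k lab g z
  -- The guess belonging to a spread minimum never exceeds the cap, so an overflowing guess may be
  -- dropped; this keeps the running time bounded for all guesses.
  if decide (L'.length ≤ cap k lab.length) then L' else []

/-- The possible values of the free coordinates. -/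
def search (A : List (List ℕ)) (n k : ℕ) (lab g : List ℕ) : List (List ℕ) :=
  -- The right fold visits the scales from `n - 1` down to 0.
  (List.range n).foldr (fun t L => refineStep A n k lab g t L) [List.replicate lab.length 0]

/-- The test whether all classes of twins have the right total size. -/
def fits (A : List (List ℕ)) (n : ℕ) (lab x : List ℕ) : Bool :=
  (List.range lab.length).all fun i => decide (((List.range lab.length).map fun j =>
    if decide (lab.getD j 0 = lab.getD i 0) then x.getD j 0 else 0).sum =
      classSize A n (lab.getD i 0))

/-- The candidates for the block sizes of an optimal layout. -/
def candidates (A : List (List ℕ)) (n k : ℕ) (lab : List ℕ) : List (List ℕ) :=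
  (vecs (smallBound k lab.length + 2) lab.length).flatMap fun g =>
    ((search A n k lab g).map fun z => merge k lab.length g z).filter fun x => fits A n lab x

/-- A candidate of least energy. -/
def best (A : List (List ℕ)) (lab : List ℕ) (L : List (List ℕ)) : List ℕ :=
  L.foldl (fun b x => if decide (energy A lab x ≤ energy A lab b) then x else b) (L.headD [])

/-- The index of the block of a vertex. -/
def blockIndex (A : List (List ℕ)) (n : ℕ) (lab x : List ℕ) (v : ℕ) : ℕ :=
  ((List.range lab.length).filter fun j => decide (((List.range (j + 1)).map fun i =>
    if twin A n (lab.getD i 0) v then x.getD i 0 else 0).sum ≤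
      ((List.range v).filter fun w => twin A n w v).length)).length

/-- The positions of the vertices in the layout with block sizes `x`. -/
def positions (A : List (List ℕ)) (n : ℕ) (lab x : List ℕ) : List ℕ :=
  (List.range n).map fun v => ((List.range n).filter fun w =>
    decide (blockIndex A n lab x w < blockIndex A n lab x v) ||
    (decide (blockIndex A n lab x w = blockIndex A n lab x v) && decide (w < v))).length + 1

/-- The positions of the vertices in an optimal layout. -/
def solve (A : List (List ℕ)) (n k : ℕ) : List ℕ :=
  -- This holds whenever there is a vertex cover of size at most `k`; otherwise the number of blocks
  -- would not be bounded by the parameter.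
  if decide ((reps A n).length ≤ k + 2 ^ k) then
    positions A n (labels A n k)
      (best A (labels A n k) (candidates A n k (labels A n k)))
  else []

end Algorithm

open Finset

/-! ### From lists to vectors: sums, counts and the energy as a cubic form. -/

section Lists

theorem sum_map_range {M : Type} [AddCommMonoid M] (f : ℕ → M) (m : ℕ) :
    ((List.range m).map f).sum = ∑ j : Fin m, f j := by
  rw [← Finset.sum_range]
  rfl

theorem length_filter_range (p : ℕ → Bool) (m : ℕ) :
    ((List.range m).filter p).length = #{j : Fin m | p j = true} := by
  rw [card_filter, ← sum_map_range fun j => if p j = true then 1 else 0]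
  induction List.range m with
  | nil => rfl
  | cons a l ih => cases h : p a <;> simp [h, ih, add_comm]

theorem getD_map_range (f : ℕ → ℕ) {m j : ℕ} (hj : j < m) :
    ((List.range m).map f).getD j 0 = f j := by
  simp [hj]

theorem list_ext_getD {m : ℕ} {x y : List ℕ} (hx : x.length = m) (hy : y.length = m)
    (h : ∀ j < m, x.getD j 0 = y.getD j 0) : x = y := by
  refine List.ext_getElem (hx.trans hy.symm) fun j h1 h2 => ?_
  have := h j (hx ▸ h1)
  rwa [List.getD_eq_getElem _ _ h1, List.getD_eq_getElem _ _ h2] at this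

theorem mem_vecs {B m : ℕ} {l : List ℕ} :
    l ∈ vecs B m ↔ l.length = m ∧ ∀ j < m, l.getD j 0 < B := by
  unfold vecs
  induction m generalizing l with
  | zero => simp
  | succ m ih =>
    rw [Function.iterate_succ_apply']
    simp only [List.mem_flatMap, List.mem_map, List.mem_range, ih]
    constructor
    · rintro ⟨l', ⟨h1, h2⟩, a, ha, rfl⟩
      refine ⟨by simp [h1], fun j hj => ?_⟩
      cases j with
      | zero => simpa using ha
      | succ j => simpa using h2 j (by omega)
    · rintro ⟨h1, h2⟩
      cases l with
      | nil => simp at h1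
      | cons a l =>
        refine ⟨l, ⟨by simpa using h1, fun j hj => ?_⟩, a, by simpa using h2 0 (by omega), rfl⟩
        simpa using h2 (j + 1) (by omega)

theorem nodup_vecs (B m : ℕ) : (vecs B m).Nodup := by
  unfold vecs
  induction m with
  | zero => simp
  | succ m ih =>
    rw [Function.iterate_succ_apply', List.nodup_flatMap]
    refine ⟨fun l _ => List.nodup_range.map fun a b h => (List.cons.inj h).1, ih.imp ?_⟩
    intro l l' hne
    simp only [Function.onFun, List.disjoint_left, List.mem_map]
    rintro _ ⟨a, _, rfl⟩ ⟨b, _, h⟩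
    exact hne (List.cons.inj h).2.symm

theorem length_vecs (B m : ℕ) : (vecs B m).length = B ^ m := by
  unfold vecs
  induction m with
  | zero => rfl
  | succ m ih =>
    rw [Function.iterate_succ_apply', List.length_flatMap]
    simp [ih, pow_succ]

theorem iterate_half (t c : ℕ) : (· / 2)^[t] c = c / 2 ^ t := by
  induction t with
  | zero => simp
  | succ t ih => rw [Function.iterate_succ_apply', ih, Nat.div_div_eq_div_mul, pow_succ]

theorem coeff_le (i j l : ℕ) : coeff i j l ≤ 2 := by
  unfold coeff
  split_ifs <;> omega

variable (A : List (List ℕ)) (lab : List ℕ)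

/-- The vector with the entries of a list. -/
def vec (m : ℕ) (x : List ℕ) (j : Fin m) : ℤ := (x.getD j 0 : ℕ)

/-- The coefficients of `energy`. -/
def blockCoeff (i j l : Fin lab.length) : ℤ :=
  (entry A (lab.getD i 0) (lab.getD j 0) * coeff i j l : ℕ)

theorem energy_eq_cubic (x : List ℕ) :
    (energy A lab x : ℤ) = cubic (blockCoeff A lab) (vec lab.length x) := by
  simp only [energy, sum_map_range, cubic, trilin, blockCoeff, vec]
  push_cast
  rfl

theorem blockCoeff_bounds (hA : ∀ u v, entry A u v ≤ 1) (i j l : Fin lab.length) :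
    0 ≤ blockCoeff A lab i j l ∧ blockCoeff A lab i j l ≤ 2 := by
  refine ⟨by unfold blockCoeff; positivity, ?_⟩
  unfold blockCoeff
  have := Nat.mul_le_mul (hA (lab.getD i 0) (lab.getD j 0)) (coeff_le i j l)
  exact_mod_cast this

end Lists

/-! ### The digit search finds the large part of a spread minimum. -/

section Search

variable {A : List (List ℕ)} {lab : List ℕ} {n k : ℕ} {x : Fin lab.length → ℕ}

/-- The label of a block. -/
def labelOf (lab : List ℕ) (j : Fin lab.length) : ℕ := lab.getD j 0

/-- The guess that belongs to a vector of block sizes. -/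
def guess (k : ℕ) {m : ℕ} (x : Fin m → ℕ) : List ℕ :=
  List.ofFn fun j => if smallBound k m < x j then smallBound k m + 1 else x j

/-- The large entries of a vector of block sizes, divided by `2 ^ t`. -/
def scaled (k : ℕ) {m : ℕ} (x : Fin m → ℕ) (t : ℕ) : List ℕ :=
  List.ofFn fun j => if smallBound k m < x j then x j / 2 ^ t else 0

theorem getD_ofFn {m : ℕ} (f : Fin m → ℕ) (j : Fin m) : (List.ofFn f).getD j 0 = f j := by
  simp

theorem isFree_guess {m : ℕ} (x : Fin m → ℕ) (j : Fin m) :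
    isFree k m (guess k x) j = true ↔ smallBound k m < x j := by
  simp only [isFree, guess, getD_ofFn, decide_eq_true_eq]
  split_ifs <;> omega

theorem isFree_guess' {m : ℕ} (x : Fin m → ℕ) (j : Fin m) :
    isFree k m (guess k x) j = true ↔
      j ∈ largeSet (smallBound k m) (fun j => (x j : ℤ)) := by
  rw [isFree_guess]
  simp [largeSet]

theorem vec_merge_bump {m : ℕ} (x : Fin m → ℕ) {z : List ℕ}
    (hz : ∀ j : Fin m, ¬ smallBound k m < x j → z.getD j 0 = 0) {a : Fin m}
    (ha : smallBound k m < x a) :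
    vec m (merge k m (guess k x) (bump m z a)) =
      vec m z + Pi.single a 1 + smallPart (smallBound k m) (fun j => (x j : ℤ)) := by
  ext j
  have h1 := isFree_guess (k := k) x j
  simp only [vec, merge, bump, getD_map_range _ j.2, Pi.add_apply, smallPart, Nat.cast_lt]
  by_cases h : smallBound k m < x j
  · simp [h1.2 h, h, Pi.single_apply, Fin.ext_iff]
  · have h2 : ¬ isFree k m (guess k x) j = true := fun h' => h (h1.1 h')
    have h3 : j ≠ a := fun e => h (e ▸ ha)
    rw [if_neg h2, hz j h, guess, getD_ofFn, if_neg h, if_neg h]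
    simp [h3]

theorem merge_scaled_zero {m : ℕ} (x : Fin m → ℕ) :
    merge k m (guess k x) (scaled k x 0) = List.ofFn x := by
  refine list_ext_getD (m := m) (by simp [merge]) (by simp) fun j hj => ?_
  have h1 := isFree_guess (k := k) x ⟨j, hj⟩
  have h2 := getD_ofFn x ⟨j, hj⟩
  dsimp only at h1 h2
  rw [merge, getD_map_range _ hj, h2]
  by_cases h : smallBound k m < x ⟨j, hj⟩
  · rw [if_pos (h1.2 h)]
    have := getD_ofFn (fun j => if smallBound k m < x j then x j / 2 ^ 0 else 0) ⟨j, hj⟩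
    simpa [scaled, h] using this
  · rw [if_neg fun h' => h (h1.1 h')]
    have := getD_ofFn (fun j => if smallBound k m < x j then smallBound k m + 1 else x j) ⟨j, hj⟩
    simpa [guess, h] using this

theorem freeSum_guess (z : List ℕ) (i : Fin lab.length) :
    freeSum k lab (guess k x) z i =
      ∑ j with smallBound k lab.length < x j ∧ labelOf lab j = labelOf lab i, z.getD j 0 := by
  rw [freeSum, sum_map_range, sum_filter]
  refine sum_congr rfl fun j _ => if_congr ?_ rfl rfl
  rw [Bool.and_eq_true, isFree_guess, decide_eq_true_eq]
  rfl

/-- Each of at most `m` entries loses less than 1 by rounding, and each omitted small block at most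
`M`; this accounts for the summand `m + m * M` of `slack`. -/
theorem testSums_scaled (hcs : ∀ i, ∑ j with labelOf lab j = labelOf lab i, x j =
    classSize A n (labelOf lab i)) (t : ℕ) :
    testSums A n k lab (guess k x) t (scaled k x t) = true := by
  suffices key : ∀ i : Fin lab.length, (if isFree k lab.length (guess k x) i then
      decide (freeSum k lab (guess k x) (scaled k x t) i ≤
        (· / 2)^[t] (classSize A n (labelOf lab i)) + slack k lab.length) &&
      decide ((· / 2)^[t] (classSize A n (labelOf lab i)) ≤
        freeSum k lab (guess k x) (scaled k x t) i + slack k lab.length)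
      else decide ((scaled k x t).getD i 0 = 0)) = true by
    simp only [testSums, List.all_eq_true, List.mem_range]
    exact fun i hi => key ⟨i, hi⟩
  intro i
  have h0 := isFree_guess (k := k) x i
  split_ifs with h
  · rw [freeSum_guess, iterate_half, Bool.and_eq_true, decide_eq_true_eq, decide_eq_true_eq, ← hcs]
    simp only [scaled, getD_ofFn]
    set M := smallBound k lab.length with hM
    set S := ∑ j with M < x j ∧ labelOf lab j = labelOf lab i, if M < x j then x j / 2 ^ t else 0
      with hS
    have hp : 0 < 2 ^ t := by positivity
    have hS' : S = ∑ j with labelOf lab j = labelOf lab i, if M < x j then x j / 2 ^ t else 0 := by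
      rw [hS, sum_filter, sum_filter]
      refine sum_congr rfl fun j _ => ?_
      by_cases hj : M < x j <;> simp [hj]
    constructor
    · refine le_trans ?_ (Nat.le_add_right _ _)
      rw [hS', Nat.le_div_iff_mul_le hp, sum_mul]
      refine sum_le_sum fun j _ => ?_
      split_ifs
      · exact Nat.div_mul_le_self _ _
      · simp
    · have h1 : ∑ j with labelOf lab j = labelOf lab i, x j ≤
          2 ^ t * (S + (lab.length + lab.length * M)) := by
        calc ∑ j with labelOf lab j = labelOf lab i, x j
            ≤ ∑ j with labelOf lab j = labelOf lab i,
              2 ^ t * ((if M < x j then x j / 2 ^ t else 0) + (1 + M)) := by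
              refine sum_le_sum fun j _ => ?_
              split_ifs with hj
              · have := (Nat.lt_mul_div_succ (x j) hp).le
                nlinarith [Nat.zero_le (2 ^ t * M)]
              · nlinarith [Nat.zero_le M]
          _ = 2 ^ t * (S + #{j : Fin lab.length | labelOf lab j = labelOf lab i} * (1 + M)) := by
              rw [← mul_sum, sum_add_distrib, ← hS', sum_const, smul_eq_mul]
          _ ≤ _ := by
              have := card_le_univ {j : Fin lab.length | labelOf lab j = labelOf lab i}
              rw [Fintype.card_fin] at this
              refine Nat.mul_le_mul_left _ (Nat.add_le_add_left ?_ _)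
              calc _ ≤ lab.length * (1 + M) := Nat.mul_le_mul_right _ this
                _ = _ := by ring
      have h2 : (∑ j with labelOf lab j = labelOf lab i, x j) / 2 ^ t ≤
          S + (lab.length + lab.length * M) := by
        refine Nat.div_le_of_le_mul h1
      refine h2.trans (Nat.add_le_add_left ?_ _)
      rw [slack, ← hM]
      omega
  · rw [decide_eq_true_eq, scaled, getD_ofFn, if_neg fun h' => h (h0.2 h')]

theorem testEnergy_scaled (hA : ∀ u v, entry A u v ≤ 1)
    (h : IsSpreadMin (blockCoeff A lab) (labelOf lab) (fun j => (x j : ℤ)))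
    (hadj : FewNeighbours (blockCoeff A lab) k (smallBound k lab.length) (fun j => (x j : ℤ)))
    (t : ℕ) : testEnergy A k lab (guess k x) (scaled k x t) = true := by
  simp only [testEnergy, List.all_eq_true, List.mem_range]
  intro a ha b hb
  rw [Bool.or_eq_true, Bool.not_eq_true', ← Bool.not_eq_true, or_iff_not_imp_left, not_not]
  simp only [Bool.and_eq_true, decide_eq_true_eq]
  rintro ⟨h1, h2, h3⟩
  have h1' := (isFree_guess (k := k) x ⟨a, ha⟩).1 h1
  have h2' := (isFree_guess (k := k) x ⟨b, hb⟩).1 h2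
  have hst := h.stationary (blockCoeff_bounds A lab hA) hadj
    (by unfold smallBound; omega) (by unfold smallBound; omega) t (a := ⟨a, ha⟩) (b := ⟨b, hb⟩)
    ((isFree_guess' x _).1 h1) ((isFree_guess' x _).1 h2) h3
  have hz : ∀ j : Fin lab.length, ¬ smallBound k lab.length < x j →
      (scaled k x t).getD j 0 = 0 := fun j hj => by
    rw [scaled, getD_ofFn, if_neg hj]
  have hv : vec lab.length (scaled k x t) = fun j =>
      largePart (smallBound k lab.length) (fun j => (x j : ℤ)) j / 2 ^ t := by
    ext j
    simp only [vec, scaled, getD_ofFn, largePart, Nat.cast_lt]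
    split_ifs <;> simp
  rw [← hv, ← vec_merge_bump x hz h1', ← vec_merge_bump x hz h2', ← energy_eq_cubic,
    ← energy_eq_cubic, Fintype.card_fin] at hst
  have h4 := (abs_le.1 hst).2
  have h5 : 24 * smallBound k lab.length ^ 2 * lab.length ^ 2 + 24 * k * lab.length +
      16 * k * lab.length ^ 2 ≤ slack k lab.length := by
    unfold slack
    omega
  generalize slack k lab.length = W at *
  dsimp only at h4
  omega

/-- There are few approximate solutions. -/
theorem length_le_cap (hA : ∀ u v, entry A u v ≤ 1)
    (h : IsSpreadMin (blockCoeff A lab) (labelOf lab) (fun j => (x j : ℤ)))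
    (hadj : FewNeighbours (blockCoeff A lab) k (smallBound k lab.length) (fun j => (x j : ℤ)))
    {t : ℕ} {L : List (List ℕ)} (hnd : L.Nodup) (hlen : ∀ z ∈ L, z.length = lab.length)
    (htest : ∀ z ∈ L, testSums A n k lab (guess k x) t z = true ∧
      testEnergy A k lab (guess k x) z = true) : L.length ≤ cap k lab.length := by
  set W := slack k lab.length with hW
  set J : Fin lab.length → Prop := fun j => smallBound k lab.length < x j with hJ
  set c : Fin lab.length → ℕ := fun i => (· / 2)^[t] (classSize A n (labelOf lab i)) with hc
  set E : List ℕ → Fin lab.length → ℕ := fun z a =>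
    energy A lab (merge k lab.length (guess k x) (bump lab.length z a)) with hE
  have hsums : ∀ z ∈ L, ∀ i : Fin lab.length, (J i → freeSum k lab (guess k x) z i ≤ c i + W ∧
      c i ≤ freeSum k lab (guess k x) z i + W) ∧ (¬ J i → z.getD i 0 = 0) := by
    intro z hz i
    have h1 := (htest z hz).1
    simp only [testSums, List.all_eq_true, List.mem_range] at h1
    have h2 := h1 i i.2
    refine ⟨fun hi => ?_, fun hi => ?_⟩
    · rw [if_pos ((isFree_guess x i).2 hi), Bool.and_eq_true, decide_eq_true_eq,
        decide_eq_true_eq] at h2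
      exact h2
    · rw [if_neg fun h' => hi ((isFree_guess x i).1 h')] at h2
      simpa using h2
  have hener : ∀ z ∈ L, ∀ a b, J a → J b → labelOf lab a = labelOf lab b →
      E z a ≤ E z b + W := by
    intro z hz a b ha hb hab
    have h1 := (htest z hz).2
    simp only [testEnergy, List.all_eq_true, List.mem_range] at h1
    have h2 := h1 a a.2 b b.2
    rw [(isFree_guess x a).2 ha, (isFree_guess x b).2 hb] at h2
    rw [decide_eq_true (show lab.getD a 0 = lab.getD b 0 from hab), Bool.and_self, Bool.and_self,
      Bool.not_true, Bool.false_or,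
      decide_eq_true_eq] at h2
    exact h2
  -- Errors of class sums and differences of marginal energies, shifted by `W` so that truncated
  -- subtraction loses nothing and the values lie in `[0, 2 * W]`.
  let sig : List ℕ → (Fin lab.length → ℕ) × (Fin lab.length × Fin lab.length → ℕ) := fun z =>
    (fun i => if J i then freeSum k lab (guess k x) z i + W - c i else 0,
      fun p => if J p.1 ∧ J p.2 ∧ labelOf lab p.1 = labelOf lab p.2 then E z p.1 + W - E z p.2
        else 0)
  have hmaps : ∀ z ∈ L.toFinset, sig z ∈
      (Fintype.piFinset fun _ : Fin lab.length => range (2 * W + 1)) ×ˢ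
        (Fintype.piFinset fun _ : Fin lab.length × Fin lab.length => range (2 * W + 1)) := by
    intro z hz
    rw [List.mem_toFinset] at hz
    simp only [mem_product, Fintype.mem_piFinset, mem_range, sig]
    refine ⟨fun i => ?_, fun p => ?_⟩
    · split_ifs with hi
      · have := (hsums z hz i).1 hi
        omega
      · omega
    · split_ifs with hp
      · have := hener z hz _ _ hp.1 hp.2.1 hp.2.2
        omega
      · omega
  have hinj : Set.InjOn sig (L.toFinset : Set (List ℕ)) := by
    intro z hz z' hz' he
    rw [mem_coe, List.mem_toFinset] at hz hz'
    have e1 : ∀ i, J i → freeSum k lab (guess k x) z i = freeSum k lab (guess k x) z' i := by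
      intro i hi
      have h1 := congrFun (congrArg Prod.fst he) i
      simp only [sig, if_pos hi] at h1
      have h2 := (hsums z hz i).1 hi
      have h3 := (hsums z' hz' i).1 hi
      omega
    have e2 : ∀ a b, J a → J b → labelOf lab a = labelOf lab b →
        (E z a : ℤ) - E z b = E z' a - E z' b := by
      intro a b ha hb hab
      have h1 := congrFun (congrArg Prod.snd he) (a, b)
      simp only [sig, if_pos (And.intro ha (And.intro hb hab))] at h1
      have h2 := hener z hz b a hb ha hab.symm
      have h3 := hener z' hz' b a hb ha hab.symm
      omega
    have hJl : ∀ j, j ∈ largeSet (smallBound k lab.length) (fun j => (x j : ℤ)) ↔ J j := fun j => by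
      simp [largeSet, hJ]
    have hzero : ∀ z ∈ L, ∀ j ∉ largeSet (smallBound k lab.length) (fun j => (x j : ℤ)),
        vec lab.length z j = 0 := fun z hz j hj => by
      rw [hJl] at hj
      simp only [vec, (hsums z hz j).2 hj, Nat.cast_zero]
    have hsum : ∀ z ∈ L, ∀ i, J i → ∑ j with labelOf lab j = labelOf lab i, vec lab.length z j =
        freeSum k lab (guess k x) z i := by
      intro z hz i hi
      rw [freeSum_guess, sum_filter, sum_filter]
      push_cast
      refine sum_congr rfl fun j _ => ?_
      by_cases hj : J j
      · have hj' : smallBound k lab.length < x j := hj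
        simp [vec, hj']
      · have h0 : vec lab.length z j = 0 := by simp only [vec, (hsums z hz j).2 hj, Nat.cast_zero]
        have hj' : ¬ smallBound k lab.length < x j := hj
        simp only [h0, hj', ite_self, false_and, if_false]
    have key := h.injective (blockCoeff_bounds A lab hA) hadj (by unfold smallBound; omega)
      (by rw [Fintype.card_fin]; unfold smallBound; omega) (hzero z hz) (hzero z' hz')
      (fun i => by
        by_cases hi : ∃ i' : Fin lab.length, J i' ∧ labelOf lab i' = labelOf lab i
        · obtain ⟨i', hi', hl⟩ := hi
          rw [← hl, hsum z hz i' hi', hsum z' hz' i' hi', e1 i' hi']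
        · rw [sum_eq_zero, sum_eq_zero]
          · exact fun j hj => hzero z' hz' j fun h' =>
              hi ⟨j, (hJl j).1 h', by simpa using hj⟩
          · exact fun j hj => hzero z hz j fun h' =>
              hi ⟨j, (hJl j).1 h', by simpa using hj⟩)
      (fun a ha b hb hab => by
        rw [hJl] at ha hb
        rw [← vec_merge_bump x (fun j => (hsums z hz j).2) ha,
          ← vec_merge_bump x (fun j => (hsums z hz j).2) hb,
          ← vec_merge_bump x (fun j => (hsums z' hz' j).2) ha,
          ← vec_merge_bump x (fun j => (hsums z' hz' j).2) hb]
        simp only [← energy_eq_cubic]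
        exact e2 a b ha hb hab)
    refine list_ext_getD (hlen z hz) (hlen z' hz') fun j hj => ?_
    have := congrFun key ⟨j, hj⟩
    simpa only [vec, Nat.cast_inj] using this
  have hcard := card_le_card_of_injOn sig hmaps hinj
  rw [List.toFinset_card_of_nodup hnd, card_product, Fintype.card_piFinset,
    Fintype.card_piFinset] at hcard
  simpa [cap, hW] using hcard

/-- Uniqueness of the last binary digit. Absence of duplicates matters because the cap is compared
with the length of a list, while the counting argument bounds the number of distinct solutions. -/
theorem expand_good {m : ℕ} {L : List (List ℕ)} (hnd : L.Nodup)
    (hlen : ∀ z ∈ L, z.length = m) :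
    (expand m L).Nodup ∧ ∀ z ∈ expand m L, z.length = m := by
  have hinj : ∀ z b z' b' : List ℕ, z.length = m → z'.length = m → b ∈ vecs 2 m → b' ∈ vecs 2 m →
      double m z b = double m z' b' → z = z' ∧ b = b' := by
    intro z b z' b' hz hz' hb hb' h
    rw [mem_vecs] at hb hb'
    have key : ∀ j < m, z.getD j 0 = z'.getD j 0 ∧ b.getD j 0 = b'.getD j 0 := by
      intro j hj
      have h1 := congrArg (fun l => l.getD j 0) h
      simp only [double, getD_map_range _ hj] at h1
      have h2 := hb.2 j hj
      have h3 := hb'.2 j hj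
      omega
    exact ⟨list_ext_getD hz hz' fun j hj => (key j hj).1,
      list_ext_getD hb.1 hb'.1 fun j hj => (key j hj).2⟩
  refine ⟨?_, ?_⟩
  · rw [expand, List.nodup_flatMap]
    refine ⟨fun z hz => (nodup_vecs 2 m).map_on fun b hb b' hb' h =>
      (hinj z b z b' (hlen z hz) (hlen z hz) hb hb' h).2, ?_⟩
    refine List.Pairwise.imp_of_mem ?_ hnd
    intro z z' hz hz' hne
    simp only [Function.onFun, List.disjoint_left, List.mem_map]
    rintro _ ⟨b, hb, rfl⟩ ⟨b', hb', h⟩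
    exact hne (hinj z' b' z b (hlen z' hz') (hlen z hz) hb' hb h).1.symm
  · intro z hz
    simp only [expand, List.mem_flatMap, List.mem_map] at hz
    obtain ⟨_, _, _, _, rfl⟩ := hz
    simp [double]

/-- Induction on the scale: the scaled large part is among the digit extensions of its predecessor,
it passes both tests, and the cap does not cut it off. -/
theorem scaled_mem_search (hA : ∀ u v, entry A u v ≤ 1)
    (h : IsSpreadMin (blockCoeff A lab) (labelOf lab) (fun j => (x j : ℤ)))
    (hadj : FewNeighbours (blockCoeff A lab) k (smallBound k lab.length) (fun j => (x j : ℤ)))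
    (hcs : ∀ i, ∑ j with labelOf lab j = labelOf lab i, x j = classSize A n (labelOf lab i))
    (hn : ∀ j, x j ≤ n) : scaled k x 0 ∈ search A n k lab (guess k x) := by
  have key : ∀ s, ∀ L : List (List ℕ), L.Nodup → (∀ z ∈ L, z.length = lab.length) →
      scaled k x s ∈ L → scaled k x 0 ∈
        (List.range s).foldr (fun t L => refineStep A n k lab (guess k x) t L) L := by
    intro s
    induction s with
    | zero => exact fun L _ _ h => h
    | succ s ih =>
      intro L hnd hlen hmem
      rw [List.range_succ, List.foldr_append, List.foldr_cons, List.foldr_nil]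
      have hg := expand_good hnd hlen
      have hcap := length_le_cap (t := s) (n := n) hA h hadj (hg.1.filter fun z =>
        testSums A n k lab (guess k x) s z && testEnergy A k lab (guess k x) z)
        (fun z hz => hg.2 z (List.mem_of_mem_filter hz))
        (fun z hz => by simpa using (List.mem_filter.1 hz).2)
      have hstep : refineStep A n k lab (guess k x) s L = (expand lab.length L).filter fun z =>
          testSums A n k lab (guess k x) s z && testEnergy A k lab (guess k x) z := by
        rw [refineStep]
        simp only [decide_eq_true_eq]
        rw [if_pos hcap]
      rw [hstep]
      refine ih _ (hg.1.filter _) (fun z hz => hg.2 z (List.mem_of_mem_filter hz))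
        (List.mem_filter.2 ⟨?_, ?_⟩)
      -- The digit to append is the `s`-th binary digit of each large entry.
      · refine List.mem_flatMap.2 ⟨_, hmem, List.mem_map.2 ⟨List.ofFn fun j : Fin lab.length =>
          if smallBound k lab.length < x j then x j / 2 ^ s % 2 else 0, ?_, ?_⟩⟩
        · refine mem_vecs.2 ⟨by simp, fun j hj => ?_⟩
          have := getD_ofFn (fun j : Fin lab.length =>
            if smallBound k lab.length < x j then x j / 2 ^ s % 2 else 0) ⟨j, hj⟩
          dsimp only at this
          rw [this]
          split_ifs <;> omega
        · refine list_ext_getD (m := lab.length) (by simp [double]) (by simp [scaled])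
            fun j hj => ?_
          rw [double, getD_map_range _ hj]
          have e1 := getD_ofFn (fun j : Fin lab.length =>
            if smallBound k lab.length < x j then x j / 2 ^ s % 2 else 0) ⟨j, hj⟩
          have e2 := getD_ofFn (fun j : Fin lab.length =>
            if smallBound k lab.length < x j then x j / 2 ^ (s + 1) else 0) ⟨j, hj⟩
          have e3 := getD_ofFn (fun j : Fin lab.length =>
            if smallBound k lab.length < x j then x j / 2 ^ s else 0) ⟨j, hj⟩
          dsimp only at e1 e2 e3
          rw [scaled, scaled, e1, e2, e3]
          split_ifs
          · rw [pow_succ, ← Nat.div_div_eq_div_mul]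
            omega
          · rfl
      · rw [Bool.and_eq_true]
        exact ⟨testSums_scaled hcs s, testEnergy_scaled hA h hadj s⟩
  -- Since `x j ≤ n < 2 ^ n`, the vector at scale `n` is zero, which is where the search starts.
  refine key n _ (by simp) (by simp) (List.mem_singleton.2 ?_)
  refine list_ext_getD (m := lab.length) (by simp [scaled]) (by simp) fun j hj => ?_
  have e2 := getD_ofFn (fun j : Fin lab.length =>
    if smallBound k lab.length < x j then x j / 2 ^ n else 0) ⟨j, hj⟩
  dsimp only at e2
  rw [scaled, e2, Nat.div_eq_of_lt ((hn _).trans_lt Nat.lt_two_pow_self)]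
  simp [hj]

theorem fits_iff {y : List ℕ} : fits A n lab y = true ↔
    ∀ i, ∑ j with labelOf lab j = labelOf lab i, y.getD j 0 = classSize A n (labelOf lab i) := by
  simp only [fits, List.all_eq_true, List.mem_range, decide_eq_true_eq]
  simp only [sum_map_range, sum_filter]
  exact ⟨fun h i => h i i.2, fun h i hi => h ⟨i, hi⟩⟩

theorem mem_candidates (hA : ∀ u v, entry A u v ≤ 1)
    (h : IsSpreadMin (blockCoeff A lab) (labelOf lab) (fun j => (x j : ℤ)))
    (hadj : FewNeighbours (blockCoeff A lab) k (smallBound k lab.length) (fun j => (x j : ℤ)))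
    (hcs : ∀ i, ∑ j with labelOf lab j = labelOf lab i, x j = classSize A n (labelOf lab i))
    (hn : ∀ j, x j ≤ n) : List.ofFn x ∈ candidates A n k lab := by
  refine List.mem_flatMap.2 ⟨guess k x, mem_vecs.2 ⟨by simp [guess], fun j hj => ?_⟩,
    List.mem_filter.2 ⟨List.mem_map.2 ⟨_, scaled_mem_search hA h hadj hcs hn,
      merge_scaled_zero x⟩, ?_⟩⟩
  · have := getD_ofFn (fun j : Fin lab.length => if smallBound k lab.length < x j then
      smallBound k lab.length + 1 else x j) ⟨j, hj⟩
    dsimp only at this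
    rw [guess, this]
    split_ifs <;> omega
  · rw [fits_iff]
    intro i
    rw [← hcs i]
    exact sum_congr rfl fun j _ => getD_ofFn x j

end Search

/-! ### Correctness of the algorithm on adjacency matrices. -/

section Correctness

/-- Nonnegativity and the class sums leave finitely many vectors; take the lexicographic minimum of
the cubic form and the negated sum of squares. -/
theorem exists_isSpreadMin {ι Λ : Type} [Fintype ι] [DecidableEq Λ] (κ : ι → ι → ι → ℤ)
    (lab : ι → Λ) (y : ι → ℤ) (hy : ∀ j, 0 ≤ y j) :
    ∃ x : ι → ℤ, IsSpreadMin κ lab x ∧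
      ∀ i, ∑ j with lab j = lab i, x j = ∑ j with lab j = lab i, y j := by
  classical
  let F : Set (ι → ℤ) := {x | (∀ j, 0 ≤ x j) ∧
    ∀ i, ∑ j with lab j = lab i, x j = ∑ j with lab j = lab i, y j}
  have hF : F.Finite := by
    refine (Set.finite_Icc (0 : ι → ℤ) fun i => ∑ j with lab j = lab i, y j).subset ?_
    rintro x ⟨h0, h1⟩
    refine ⟨h0, fun i => ?_⟩
    change x i ≤ ∑ j with lab j = lab i, y j
    rw [← h1 i]
    exact single_le_sum (f := x) (fun j _ => h0 j) (by simp)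
  obtain ⟨x, hx, hmin⟩ := Set.exists_min_image F
    (fun x => toLex (cubic κ x, -∑ j, x j ^ 2)) hF ⟨y, hy, fun _ => rfl⟩
  simp only [Prod.Lex.le_iff, ofLex_toLex] at hmin
  refine ⟨x, ⟨hx.1, fun x' h0 h1 => ?_, fun x' h0 h1 h2 => ?_⟩, hx.2⟩
  · rcases hmin x' ⟨h0, fun i => (h1 i).trans (hx.2 i)⟩ with h | h
    · exact h.le
    · exact h.1.le
  · have := (hmin x' ⟨h0, fun i => (h1 i).trans (hx.2 i)⟩).resolve_left (by omega)
    omega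

theorem best_spec (A : List (List ℕ)) (lab : List ℕ) {L : List (List ℕ)} (hL : L ≠ []) :
    best A lab L ∈ L ∧ ∀ x ∈ L, energy A lab (best A lab L) ≤ energy A lab x := by
  have key : ∀ (L : List (List ℕ)) (b : List ℕ),
      (L.foldl (fun b x => if decide (energy A lab x ≤ energy A lab b) then x else b) b = b ∨
        L.foldl (fun b x => if decide (energy A lab x ≤ energy A lab b) then x else b) b ∈ L) ∧
      ∀ x ∈ b :: L, energy A lab
        (L.foldl (fun b x => if decide (energy A lab x ≤ energy A lab b) then x else b) b) ≤
          energy A lab x := by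
    intro L
    induction L with
    | nil => simp
    | cons a L ih =>
      intro b
      rw [List.foldl_cons]
      obtain ⟨h1, h2⟩ := ih (if decide (energy A lab a ≤ energy A lab b) then a else b)
      set r := L.foldl (fun b x => if decide (energy A lab x ≤ energy A lab b) then x else b)
        (if decide (energy A lab a ≤ energy A lab b) then a else b) with hr
      have h3 := h2 _ List.mem_cons_self
      by_cases hab : energy A lab a ≤ energy A lab b
      · simp only [hab, decide_true, if_true] at h1 h3
        refine ⟨Or.inr ?_, fun x hx => ?_⟩
        · rcases h1 with h1 | h1
          · rw [h1]; exact List.mem_cons_self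
          · exact List.mem_cons_of_mem _ h1
        · rcases List.mem_cons.1 hx with rfl | hx
          · exact h3.trans hab
          rcases List.mem_cons.1 hx with rfl | hx
          · exact h3
          · exact h2 x (List.mem_cons_of_mem _ hx)
      · simp only [hab, decide_false, Bool.false_eq_true, if_false] at h1 h3
        refine ⟨h1.imp id fun h => List.mem_cons_of_mem _ h, fun x hx => ?_⟩
        rcases List.mem_cons.1 hx with rfl | hx
        · exact h3
        rcases List.mem_cons.1 hx with rfl | hx
        · omega
        · exact h2 x (List.mem_cons_of_mem _ hx)
  cases L with
  | nil => exact absurd rfl hL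
  | cons a L =>
    obtain ⟨h1, h2⟩ := key (a :: L) a
    refine ⟨?_, fun x hx => h2 x (List.mem_cons_of_mem _ hx)⟩
    have e : best A lab (a :: L) = List.foldl
      (fun b x => if decide (energy A lab x ≤ energy A lab b) then x else b) a (a :: L) := rfl
    rcases h1 with h1 | h1
    · rw [e, h1]; exact List.mem_cons_self
    · exact h1

theorem getD_flatten_replicate (l : List ℕ) {R i s : ℕ} (hi : i < R) (hs : s < l.length) :
    (List.replicate R l).flatten.getD (i * l.length + s) 0 = l.getD s 0 := by
  induction R generalizing i with
  | zero => omega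
  | succ R ih =>
    rw [List.replicate_succ, List.flatten_cons]
    cases i with
    | zero => rw [zero_mul, zero_add, List.getD_append _ _ _ _ hs]
    | succ i =>
      have e : (i + 1) * l.length + s = l.length + (i * l.length + s) := by ring
      rw [e, List.getD_append_right _ _ _ _ (by omega), Nat.add_sub_cancel_left]
      exact ih (by omega)

theorem sum_map_range_of_le {f : ℕ → ℕ} {j m : ℕ} (hj : j ≤ m) :
    ((List.range j).map f).sum = ∑ i : Fin m, if (i : ℕ) < j then f i else 0 := by
  rw [sum_map_range, ← Finset.sum_range f,
    ← Finset.sum_range fun i => if i < j then f i else 0, ← sum_filter]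
  congr 1
  ext i
  simp only [mem_range, mem_filter]
  omega

theorem length_filter_range_of_le {p : ℕ → Bool} {j m : ℕ} (hj : j ≤ m) :
    ((List.range j).filter p).length = #{i : Fin m | (i : ℕ) < j ∧ p i = true} := by
  have h := sum_map_range_of_le (f := fun i => if p i then 1 else 0) hj
  have h1 : ((List.range j).map fun i => if p i then 1 else 0).sum =
      ((List.range j).filter p).length := by
    induction List.range j with
    | nil => rfl
    | cons a l ih => cases h : p a <;> simp [h, ih, add_comm]
  rw [← h1, h, card_filter]
  exact sum_congr rfl fun i _ => by simp only [ite_and]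

variable {n : ℕ} (G : SimpleGraph (Fin n))

open Classical in
/-- The rows of the adjacency matrix. -/
noncomputable def rows : List (List ℕ) :=
  List.ofFn fun u : Fin n => List.ofFn fun v : Fin n => if G.Adj u v then 1 else 0

open Classical in
theorem entry_rows (u v : Fin n) : entry (rows G) u v = if G.Adj u v then 1 else 0 := by
  simp [entry, rows]

theorem entry_rows_le (u v : ℕ) : entry (rows G) u v ≤ 1 := by
  classical
  by_cases hu : u < n
  · by_cases hv : v < n
    · have := entry_rows G ⟨u, hu⟩ ⟨v, hv⟩
      dsimp only at this
      rw [this]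
      split_ifs <;> simp
    · simp [entry, rows, hu, hv]
  · simp [entry, rows, hu]

theorem entry_rows_eq_adj (u v : Fin n) : (entry (rows G) u v : ℤ) = adj G u v := by
  rw [entry_rows, adj]
  push_cast
  rfl

theorem twin_rows (u v : Fin n) :
    twin (rows G) n u v = true ↔ ∀ w, G.Adj u w ↔ G.Adj v w := by
  simp only [twin, List.all_eq_true, List.mem_range, decide_eq_true_eq]
  have key : ∀ w : Fin n, entry (rows G) u w = entry (rows G) v w ↔ (G.Adj u w ↔ G.Adj v w) := by
    intro w
    rw [entry_rows, entry_rows]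
    by_cases h1 : G.Adj u w <;> by_cases h2 : G.Adj v w <;> simp [h1, h2]
  exact ⟨fun h w => (key w).1 (h w w.2), fun h w hw => (key ⟨w, hw⟩).2 (h _)⟩

theorem mem_reps {r : ℕ} : r ∈ reps (rows G) n ↔
    r < n ∧ ∀ u < r, ¬ twin (rows G) n u r = true := by
  simp [reps]

theorem exists_rep (v : Fin n) : ∃ r : Fin n, (r : ℕ) ∈ reps (rows G) n ∧
    twin (rows G) n r v = true := by
  classical
  have hex : ∃ r : Fin n, twin (rows G) n r v = true := ⟨v, (twin_rows G v v).2 fun _ => Iff.rfl⟩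
  obtain ⟨r, hr, hmin⟩ := exists_min_image (univ.filter fun r : Fin n => twin (rows G) n r v = true)
    id (by simpa [Finset.Nonempty] using hex)
  rw [mem_filter] at hr
  refine ⟨r, (mem_reps G).2 ⟨r.2, fun u hu htw => ?_⟩, hr.2⟩
  have h1 := (twin_rows G ⟨u, hu.trans r.2⟩ r).1 htw
  have h2 := (twin_rows G r v).1 hr.2
  have h3 := hmin ⟨u, hu.trans r.2⟩ (by
    rw [mem_filter, twin_rows]
    exact ⟨mem_univ _, fun w => (h1 w).trans (h2 w)⟩)
  exact absurd h3 (not_le.2 (Fin.lt_def.2 hu))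

theorem rep_unique {r r' : Fin n} (hr : (r : ℕ) ∈ reps (rows G) n)
    (hr' : (r' : ℕ) ∈ reps (rows G) n) (h : ∀ w, G.Adj r w ↔ G.Adj r' w) : r = r' := by
  rcases lt_trichotomy r r' with h' | h' | h'
  · exact absurd ((twin_rows G r r').2 h) (((mem_reps G).1 hr').2 r h')
  · exact h'
  · exact absurd ((twin_rows G r' r).2 fun w => (h w).symm) (((mem_reps G).1 hr).2 r' h')

/-- The first twin of a vertex. -/
noncomputable def repOf (v : Fin n) : Fin n := (exists_rep G v).choose

/-- The label of the class of a vertex. -/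
noncomputable def classOf (v : Fin n) : ℕ := repOf G v

theorem classOf_mem (v : Fin n) : classOf G v ∈ reps (rows G) n := (exists_rep G v).choose_spec.1

theorem adj_repOf (v w : Fin n) : G.Adj (repOf G v) w ↔ G.Adj v w :=
  (twin_rows G _ _).1 (exists_rep G v).choose_spec.2 w

theorem classOf_eq_iff (u v : Fin n) : classOf G u = classOf G v ↔ ∀ w, G.Adj u w ↔ G.Adj v w := by
  constructor
  · intro h w
    have h' : repOf G u = repOf G v := Fin.ext h
    rw [← adj_repOf G u, ← adj_repOf G v, h']
  · intro h
    exact congrArg Fin.val (rep_unique G (classOf_mem G u) (classOf_mem G v) fun w => by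
      rw [adj_repOf, adj_repOf, h])

theorem twin_iff_eq_classOf {s : ℕ} (hs : s ∈ reps (rows G) n) (v : Fin n) :
    twin (rows G) n s v = true ↔ s = classOf G v := by
  obtain ⟨hsn, -⟩ := (mem_reps G).1 hs
  have h1 := twin_rows G ⟨s, hsn⟩ v
  dsimp only at h1
  rw [h1]
  constructor
  · intro h
    exact congrArg Fin.val (rep_unique G (r := ⟨s, hsn⟩) hs (classOf_mem G v) fun w => by
      rw [h, adj_repOf])
  · intro h w
    rw [show (⟨s, hsn⟩ : Fin n) = repOf G v from Fin.ext h, adj_repOf]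

theorem twin_iff_classOf_eq (u v : Fin n) :
    twin (rows G) n u v = true ↔ classOf G u = classOf G v := by
  rw [twin_rows, classOf_eq_iff]

theorem classSize_eq {s : ℕ} (hs : s ∈ reps (rows G) n) :
    classSize (rows G) n s = #{v | classOf G v = s} := by
  rw [classSize, length_filter_range]
  exact congrArg card (filter_congr fun v _ => by rw [twin_iff_eq_classOf G hs, eq_comm])

theorem adj_eq_entry_classOf (u v : Fin n) :
    adj G u v = (entry (rows G) (classOf G u) (classOf G v) : ℕ) := by
  rw [classOf, classOf, entry_rows_eq_adj]
  have : G.Adj (repOf G u) (repOf G v) ↔ G.Adj u v := by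
    rw [adj_repOf, G.adj_comm, adj_repOf, G.adj_comm]
  by_cases h : G.Adj u v
  · simp [adj, h, this.2 h]
  · simp [adj, h, mt this.1 h]

theorem length_reps_le {k : ℕ} {C : Finset (Fin n)} (hC : G.IsVertexCover (C : Set (Fin n)))
    (hk : #C ≤ k) : (reps (rows G) n).length ≤ k + 2 ^ k := by
  classical
  have h : (reps (rows G) n).length = #{v : Fin n | (v : ℕ) ∈ reps (rows G) n} := by
    rw [reps, length_filter_range]
    refine congrArg card (filter_congr fun v _ => ?_)
    rw [List.mem_filter]
    simp
  rw [h]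
  refine card_le_of_pairwise_not_twins hC hk _ fun u hu v hv huv => ?_
  exact rep_unique G (by simpa using hu) (by simpa using hv) huv

theorem labelOf_mem {k : ℕ} (j : Fin (labels (rows G) n k).length) :
    labelOf (labels (rows G) n k) j ∈ reps (rows G) n := by
  rw [labelOf, List.getD_eq_getElem _ _ j.2]
  obtain ⟨l, hl, h⟩ := List.mem_flatten.1 (List.getElem_mem (l := labels (rows G) n k) j.2)
  rwa [List.eq_of_mem_replicate hl] at h

theorem positions_eq {k : ℕ} {x : List ℕ} (v : Fin n) :
    (positions (rows G) n (labels (rows G) n k) x).getD v 0 =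
      placeOf (labelOf (labels (rows G) n k)) (classOf G) (fun j => x.getD j 0) v + 1 := by
  have hblock : ∀ v : Fin n, blockIndex (rows G) n (labels (rows G) n k) x v =
      blockOf (labelOf (labels (rows G) n k)) (classOf G) (fun j => x.getD j 0) v := by
    intro v
    rw [blockIndex, length_filter_range, blockOf]
    refine congrArg card (filter_congr fun j _ => ?_)
    rw [decide_eq_true_eq, sum_map_range_of_le (m := (labels (rows G) n k).length)
      (by omega), length_filter_range_of_le v.2.le, classRank, sum_filter]
    have e1 : ∀ i : Fin (labels (rows G) n k).length,
        (if (i : ℕ) < j + 1 then if twin (rows G) n ((labels (rows G) n k).getD i 0) v = true then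
          x.getD i 0 else 0 else 0) =
        if i ≤ j ∧ labelOf (labels (rows G) n k) i = classOf G v then x.getD i 0 else 0 := by
      intro i
      rw [← ite_and]
      refine if_congr (and_congr ?_ (twin_iff_eq_classOf G (labelOf_mem G i) v)) rfl rfl
      rw [Fin.le_def]
      omega
    have e2 : (univ.filter fun w : Fin n => (w : ℕ) < v ∧ twin (rows G) n w v = true) =
        univ.filter fun w => w < v ∧ classOf G w = classOf G v :=
      filter_congr fun w _ => and_congr Fin.lt_def.symm (twin_iff_classOf_eq G w v)
    rw [sum_congr rfl fun i _ => e1 i, e2]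
  rw [positions, getD_map_range _ v.2, length_filter_range, placeOf]
  congr 2
  refine filter_congr fun w _ => ?_
  rw [Bool.or_eq_true, Bool.and_eq_true, decide_eq_true_eq, decide_eq_true_eq, decide_eq_true_eq,
    hblock, hblock, ← Fin.lt_def]

/-- The energy of the block sizes of a layout is twice its cost. -/
theorem energy_eq_two_mul_cost {lab : List ℕ} {σ : Equiv.Perm (Fin n)}
    {β : Fin n → Fin lab.length} (hβ : ∀ u v, β u < β v → σ u < σ v)
    (hlab : ∀ v, labelOf lab (β v) = classOf G v) {x : List ℕ}
    (hx : ∀ j : Fin lab.length, #{v | β v = j} = x.getD j 0) :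
    (energy (rows G) lab x : ℤ) = 2 * cost G σ := by
  rw [two_mul_cost_eq_cubic G hβ (e := fun i j => (entry (rows G) (lab.getD i 0) (lab.getD j 0) : ℕ))
    (fun u v => by rw [adj_eq_entry_classOf, ← hlab u, ← hlab v]; rfl)
    (fun u v huv hadj => by
      have h1 : classOf G u = classOf G v := by rw [← hlab, ← hlab, huv]
      exact G.irrefl (((classOf_eq_iff G u v).1 h1 v).1 hadj)), energy_eq_cubic]
  simp only [hx]
  congr 1
  ext i j l
  simp only [blockCoeff, coeff, Fin.lt_def, Fin.ext_iff]
  push_cast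
  rfl

theorem fits_of_blocks {lab : List ℕ} {β : Fin n → Fin lab.length}
    (hlab : ∀ v, labelOf lab (β v) = classOf G v) (s : ℕ) :
    ∑ j with labelOf lab j = s, #{v | β v = j} = #{v | classOf G v = s} := by
  rw [card_eq_sum_card_fiberwise (f := β) (t := univ.filter fun j => labelOf lab j = s)]
  · refine sum_congr rfl fun j hj => congrArg card ?_
    ext v
    simp only [mem_filter, mem_univ, true_and] at hj ⊢
    constructor
    · rintro rfl
      exact ⟨(hlab v).symm.trans hj, rfl⟩
    · exact fun h => h.2
  · intro v hv
    simp only [coe_filter, mem_univ, true_and, Set.mem_ofPred_eq] at hv ⊢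
    rw [hlab, hv]

/-- A nonzero coefficient means that the two classes are completely joined. The class of a large
block has more than `k` vertices, so `card_le_of_complete` bounds the other class, hence the other
block. -/
theorem few_neighbours {k M : ℕ} {C : Finset (Fin n)} (hC : G.IsVertexCover (C : Set (Fin n)))
    (hk : #C ≤ k) (hkM : k ≤ M) {lab : List ℕ} (hmem : ∀ j, labelOf lab j ∈ reps (rows G) n)
    {x : Fin lab.length → ℕ}
    (hx : ∀ i, ∑ j with labelOf lab j = labelOf lab i, x j =
      classSize (rows G) n (labelOf lab i)) :
    FewNeighbours (blockCoeff (rows G) lab) k M (fun j => (x j : ℤ)) := by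
  have hle : ∀ i, x i ≤ #{v | classOf G v = labelOf lab i} := fun i => by
    rw [← classSize_eq G (hmem i), ← hx i]
    exact single_le_sum (f := x) (fun _ _ => Nat.zero_le _) (by simp)
  have key : ∀ a b, M < x a → (entry (rows G) (labelOf lab a) (labelOf lab b) ≠ 0 ∨
      entry (rows G) (labelOf lab b) (labelOf lab a) ≠ 0) → x b ≤ k := by
    intro a b ha hab
    refine (hle b).trans (card_le_of_complete hC hk (S := univ.filter fun v =>
      classOf G v = labelOf lab a) (fun u hu v hv => ?_) (hkM.trans_lt (ha.trans_le (hle a))))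
    simp only [mem_filter, mem_univ, true_and] at hu hv
    by_contra h
    have h1 : adj G u v = 0 := by simp [adj, h]
    have h2 : adj G v u = 0 := by rw [adj_comm, h1]
    rw [adj_eq_entry_classOf, hu, hv] at h1
    rw [adj_eq_entry_classOf, hu, hv] at h2
    rcases hab with h' | h'
    · exact h' (by exact_mod_cast h1)
    · exact h' (by exact_mod_cast h2)
  intro a b l ha hab
  have ha' : M < x a := by exact_mod_cast (show (M : ℤ) < x a from ha)
  have h1 : entry (rows G) (labelOf lab a) (labelOf lab b) = 0 →
      blockCoeff (rows G) lab a b l = 0 := fun h0 => by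
    unfold blockCoeff
    rw [show entry (rows G) (lab.getD a 0) (lab.getD b 0) = 0 from h0]
    simp
  have h2 : entry (rows G) (labelOf lab b) (labelOf lab a) = 0 →
      blockCoeff (rows G) lab b a l = 0 := fun h0 => by
    unfold blockCoeff
    rw [show entry (rows G) (lab.getD b 0) (lab.getD a 0) = 0 from h0]
    simp
  have h := key a b ha' (hab.imp (fun h h0 => h (h1 h0)) fun h h0 => h (h2 h0))
  change (x b : ℤ) ≤ k
  exact_mod_cast h

/-- The algorithm finds an optimal layout. -/
theorem solve_spec {k : ℕ} {C : Finset (Fin n)} (hC : G.IsVertexCover (C : Set (Fin n)))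
    (hk : #C ≤ k) : ∃ σ : Equiv.Perm (Fin n), IsOptimal G σ ∧
      solve (rows G) n k = List.ofFn fun v => pos σ v := by
  classical
  set A := rows G with hAdef
  set lab := labels A n k with hlab
  have hreps := length_reps_le G hC hk
  have hmem : ∀ j, labelOf lab j ∈ reps A n := labelOf_mem G
  have himage : #(univ.image (classOf G)) ≤ (reps A n).length := by
    refine (card_le_card fun s hs => ?_).trans (List.toFinset_card_le (reps A n))
    obtain ⟨v, -, rfl⟩ := mem_image.1 hs
    exact List.mem_toFinset.2 (classOf_mem G v)
  obtain ⟨σ₀, run, hopt, hrun, hmono, hclass⟩ := exists_optimal_few_runs hC hk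
    (fun u v => (classOf_eq_iff G u v).1) himage
  set τ := (reps A n).length with hτ
  have hidx : ∀ v, (reps A n).idxOf (classOf G v) < τ := fun v =>
    List.idxOf_lt_length_of_mem (classOf_mem G v)
  have hlen : lab.length = (2 * (k + 1) * τ + 1) * τ := by
    simp [hlab, labels, hτ]
  have hβlt : ∀ v, run v * τ + (reps A n).idxOf (classOf G v) < lab.length := by
    intro v
    rw [hlen]
    calc _ < run v * τ + τ := Nat.add_lt_add_left (hidx v) _
      _ = (run v + 1) * τ := by ring
      _ ≤ _ := Nat.mul_le_mul_right _ (hrun v)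
  -- Run number `r` is placed into the `r`-th copy of the list of classes, at the position of its
  -- own class.
  let β : Fin n → Fin lab.length := fun v => ⟨_, hβlt v⟩
  have hβlab : ∀ v, labelOf lab (β v) = classOf G v := by
    intro v
    change (List.replicate (2 * (k + 1) * (reps A n).length + 1) (reps A n)).flatten.getD
      (run v * (reps A n).length + (reps A n).idxOf (classOf G v)) 0 = classOf G v
    rw [getD_flatten_replicate _ (hrun v) (hidx v),
      List.getD_eq_getElem _ _ (hidx v), List.getElem_idxOf]
  have hβmono : ∀ u v, β u < β v → σ₀ u < σ₀ v := by
    intro u v huv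
    by_contra hle
    have h1 := hmono v u (not_lt.1 hle)
    rcases h1.eq_or_lt with h2 | h2
    · have h3 := hclass v u h2
      refine huv.ne (Fin.ext ?_)
      simp only [β, h2, h3]
    · have h3 := hidx v
      have h4 : run v * τ + τ ≤ run u * τ := by
        calc run v * τ + τ = (run v + 1) * τ := by ring
          _ ≤ _ := Nat.mul_le_mul_right _ h2
      rw [Fin.lt_def] at huv
      simp only [β] at huv
      omega
  -- The block sizes of the optimal layout need not be a spread minimum; `x` has the same class sums
  -- and no larger energy.
  obtain ⟨x, hx, hxsum⟩ := exists_isSpreadMin (blockCoeff A lab) (labelOf lab)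
    (fun j => (#{v | β v = j} : ℕ)) (fun j => by positivity)
  lift x to Fin lab.length → ℕ using hx.nonneg
  have hcs : ∀ i, ∑ j with labelOf lab j = labelOf lab i, x j =
      classSize A n (labelOf lab i) := fun i => by
    have h1 : ∑ j with labelOf lab j = labelOf lab i, (x j : ℤ) =
      ∑ j with labelOf lab j = labelOf lab i, ((#{v | β v = j} : ℕ) : ℤ) := hxsum i
    rw [classSize_eq G (hmem i), ← fits_of_blocks G hβlab]
    exact_mod_cast h1
  have hxn : ∀ j, x j ≤ n := by
    intro j
    calc x j ≤ ∑ i with labelOf lab i = labelOf lab j, x i :=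
          single_le_sum (f := x) (fun _ _ => Nat.zero_le _) (by simp)
      _ = #{v | classOf G v = labelOf lab j} := by rw [hcs j, classSize_eq G (hmem j)]
      _ ≤ n := (card_filter_le _ _).trans_eq (by simp)
  have hcand := mem_candidates (entry_rows_le G) hx
    (few_neighbours G hC hk (by unfold smallBound; omega) hmem hcs) hcs hxn
  obtain ⟨hbest, hle⟩ := best_spec A lab (List.ne_nil_of_mem hcand)
  set b := best A lab (candidates A n k lab) with hb
  -- The selected candidate may differ from `x` and may come from any guess; it suffices that it
  -- fits, hence is realised by a layout of cost half its energy.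
  have hbfit : fits A n lab b = true := by
    obtain ⟨g, _, hg⟩ := List.mem_flatMap.1 hbest
    exact (List.mem_filter.1 hg).2
  rw [fits_iff] at hbfit
  have hFits : Fits (labelOf lab) (classOf G) (fun j => b.getD j 0) := by
    have h2 : ∀ i, ∑ j with labelOf lab j = labelOf lab i, b.getD j 0 =
        #{w | classOf G w = labelOf lab i} := fun i => by
      rw [hbfit i, classSize_eq G (hmem i)]
    exact ⟨fun v => by rw [← hβlab v]; exact h2 (β v), h2⟩
  obtain ⟨σ, β', hplace, hβ', hlab', hcard'⟩ := exists_layout_of_fits hFits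
  refine ⟨σ, fun τ' => ?_, ?_⟩
  · have e1 := energy_eq_two_mul_cost G hβ' hlab' hcard'
    have e2 := energy_eq_two_mul_cost G hβmono hβlab
      (x := List.ofFn fun j => #{v | β v = j}) fun j =>
        (getD_ofFn (fun j => #{v | β v = j}) j).symm
    have e3 : energy A lab b ≤ energy A lab (List.ofFn x) := hle _ hcand
    have e4 : energy A lab (List.ofFn x) ≤ energy A lab (List.ofFn fun j => #{v | β v = j}) := by
      have h1 := hx.le _ (fun j => by positivity) (fun i => (hxsum i).symm)
      zify
      rw [energy_eq_cubic, energy_eq_cubic]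
      have e : ∀ f : Fin lab.length → ℕ, vec lab.length (List.ofFn f) = fun j => (f j : ℤ) :=
        fun f => by
          ext j
          simp only [vec, getD_ofFn]
      rw [e, e]
      exact h1
    have e5 := hopt τ'
    have e6 : (energy A lab b : ℤ) ≤ energy A lab (List.ofFn fun j => #{v | β v = j}) := by
      exact_mod_cast e3.trans e4
    linarith
  · rw [solve, if_pos (by simpa using hreps)]
    refine list_ext_getD (m := n) (by simp [positions]) (by simp) fun v hv => ?_
    have h1 := positions_eq G (k := k) (x := b) ⟨v, hv⟩
    have h2 := getD_ofFn (fun v => pos σ v) ⟨v, hv⟩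
    dsimp only at h1 h2
    rw [h2, pos, hplace]
    exact h1

end Correctness

end OLA

namespace FPT

open Enc (enc)
open OLA

/-! ### Computability of the parameter bounds, loops over ranges and bounded vectors. -/

section Ranges

variable {ι α β : Type} [Ctx ι] [Enc α] [Enc β]

/-- Computable number-valued functions bounded in terms of the parameter. -/
structure CompP (a : ι → ℕ) : Prop where
  comp : Comp a
  pbdd : PBdd a

theorem CompP.compN {a : ι → ℕ} (ha : CompP a) : CompN a := ⟨ha.comp, ha.pbdd.bdd⟩

theorem CompP.ext {a : ι → ℕ} (ha : CompP a) {P : ι → α → Prop} :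
    CompP (fun e : Ext ι α P => a e.fst) := ⟨ha.comp.ext, ha.pbdd.ext⟩

theorem CompP.const (n : ℕ) : CompP (fun _ : ι => n) := ⟨(CompN.const n).comp, .const n⟩

theorem CompP.add {a b : ι → ℕ} (ha : CompP a) (hb : CompP b) : CompP (fun i => a i + b i) :=
  ⟨.add ha.compN hb.comp, ha.pbdd.add hb.pbdd⟩

theorem CompP.mul {a b : ι → ℕ} (ha : CompP a) (hb : CompP b) : CompP (fun i => a i * b i) :=
  ⟨(CompN.mul ha.compN hb.compN).comp, ha.pbdd.mul hb.pbdd⟩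

theorem CompP.pow {a b : ι → ℕ} (ha : CompP a) (hb : CompP b) : CompP (fun i => a i ^ b i) :=
  ⟨(CompN.pow ha.compN hb.compN ((ha.pbdd.add (.const 1)).pow hb.pbdd).bdd).comp,
    ha.pbdd.pow hb.pbdd⟩

theorem CompP.smallBound {k m : ι → ℕ} (hk : CompP k) (hm : CompP m) :
    CompP fun i => smallBound (k i) (m i) :=
  .add (.pow (.mul hm (.add (.mul (.const 2) (.mul (.mul (.const 8) hk) hm)) (.const 1))) hm)
    (.add hk (.const 1))

theorem CompP.slack {k m : ι → ℕ} (hk : CompP k) (hm : CompP m) :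
    CompP fun i => slack (k i) (m i) :=
  have hM := hk.smallBound hm
  .add (.add (.add (.mul (.mul (.const 24) (.pow hM (.const 2))) (.pow hm (.const 2)))
    (.mul (.mul (.const 24) hk) hm)) (.mul (.mul (.const 16) hk) (.pow hm (.const 2))))
    (.add hm (.mul hm hM))

theorem CompP.cap {k m : ι → ℕ} (hk : CompP k) (hm : CompP m) :
    CompP fun i => cap (k i) (m i) :=
  have hs := CompP.add (CompP.mul (.const 2) (hk.slack hm)) (.const 1)
  .mul (.pow hs hm) (.pow hs (.mul hm hm))

theorem CompN.cond {b : ι → Bool} {g h : ι → ℕ} (hb : Comp b) (hg : CompN g) (hh : CompN h) :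
    CompN (fun i => if b i then g i else h i) :=
  ⟨.cond hb hg.comp hh.comp, (hg.bdd.add hh.bdd).mono fun i => by split_ifs <;> omega⟩

theorem CompN.index {a : ι → ℕ} (ha : CompN a) :
    CompN (fun e : ElemCtx (fun i => List.range (a i)) => e.snd) :=
  ⟨.var, ha.bdd.ext.mono fun e => (List.mem_range.1 e.prop).le⟩

theorem CompN.bdd_range {a : ι → ℕ} (ha : CompN a) :
    Bdd fun i => (List.range (a i)).length := by
  simpa using ha.bdd

theorem Comp.mapRange {a : ι → ℕ} {f : ι → ℕ → β} (ha : CompN a)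
    (hf : Comp (fun e : ElemCtx (fun i => List.range (a i)) => f e.fst e.snd)) :
    Comp (fun i => (List.range (a i)).map (f i)) :=
  .map (.range ha) ha.bdd_range hf

theorem Comp.filterRange {a : ι → ℕ} {p : ι → ℕ → Bool} (ha : CompN a)
    (hp : Comp (fun e : ElemCtx (fun i => List.range (a i)) => p e.fst e.snd)) :
    Comp (fun i => (List.range (a i)).filter (p i)) :=
  .filter (.range ha) ha.bdd_range hp

theorem Comp.allRange {a : ι → ℕ} {p : ι → ℕ → Bool} (ha : CompN a)
    (hp : Comp (fun e : ElemCtx (fun i => List.range (a i)) => p e.fst e.snd)) :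
    Comp (fun i => (List.range (a i)).all (p i)) :=
  .all (.range ha) ha.bdd_range hp

theorem CompN.sumRange {a : ι → ℕ} {f : ι → ℕ → ℕ} (ha : CompN a)
    (hf : CompN (fun e : ElemCtx (fun i => List.range (a i)) => f e.fst e.snd)) :
    CompN (fun i => ((List.range (a i)).map (f i)).sum) :=
  .sum (.range ha) ha.bdd_range hf

theorem CompN.countRange {a : ι → ℕ} {p : ι → ℕ → Bool} (ha : CompN a)
    (hp : Comp (fun e : ElemCtx (fun i => List.range (a i)) => p e.fst e.snd)) :
    CompN (fun i => ((List.range (a i)).filter (p i)).length) :=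
  .length (.filterRange ha hp) (.filter ha.bdd_range)

theorem CompN.halves {t c : ι → ℕ} (ht : CompN t) (hc : CompN c) :
    CompN fun i => (· / 2)^[t i] (c i) := by
  refine ⟨Comp.iterate (f := fun _ s => s / 2) (fun i s => s ≤ c i) ht hc.comp (fun _ => le_rfl)
    (fun i s h => (Nat.div_le_self _ _).trans h)
    (CompN.half ⟨Comp.var, hc.bdd.ext.mono fun e => e.prop⟩).comp, hc.bdd.mono fun i => ?_⟩
  rw [iterate_half]
  exact Nat.div_le_self _ _

/-- Computable lists of numbers with bounded entries. -/
structure CompV (x : ι → List ℕ) : Prop where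
  comp : Comp x
  bdd : ∃ b : ι → ℕ, Bdd b ∧ ∀ i j, (x i).getD j 0 ≤ b i

theorem CompV.ext {x : ι → List ℕ} (hx : CompV x) {P : ι → α → Prop} :
    CompV (fun e : Ext ι α P => x e.fst) :=
  let ⟨b, hb, h⟩ := hx.bdd
  ⟨hx.comp.ext, fun e => b e.fst, hb.ext, fun e => h e.fst⟩

theorem CompV.getD {x : ι → List ℕ} (hx : CompV x) {a : ι → ℕ} (ha : CompN a) :
    CompN fun i => (x i).getD (a i) 0 :=
  let ⟨_, hb, h⟩ := hx.bdd
  ⟨.getD hx.comp ha 0 rfl, hb.mono fun i => h i (a i)⟩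

theorem getD_map_range_le {f : ℕ → ℕ} {m b : ℕ} (h : ∀ j < m, f j ≤ b) (j : ℕ) :
    ((List.range m).map f).getD j 0 ≤ b := by
  rcases lt_or_ge j m with hj | hj
  · rw [getD_map_range f hj]
    exact h j hj
  · rw [List.getD_eq_default _ _ (by simpa using hj)]
    exact Nat.zero_le _

theorem CompV.mapRange {a : ι → ℕ} {f : ι → ℕ → ℕ} (ha : CompN a)
    (hf : CompN (fun e : ElemCtx (fun i => List.range (a i)) => f e.fst e.snd)) :
    CompV (fun i => (List.range (a i)).map (f i)) := by
  obtain ⟨g, c, hb⟩ := hf.bdd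
  exact ⟨.mapRange ha hf.comp, fun i => g (Ctx.param i) * (Ctx.size i + 1) ^ c,
    ⟨g, c, fun i => le_rfl⟩, fun i => getD_map_range_le fun j hj => hb ⟨i, j, List.mem_range.2 hj⟩⟩

/-- The lists with entries less than `B`, in a context with such a list. -/
theorem CompV.elem_vecs {B m : ι → ℕ} (hB : Bdd B) :
    CompV fun e : ElemCtx (fun i => vecs (B i) (m i)) => e.snd := by
  refine ⟨.var, fun e => B e.fst, hB.ext, fun e j => ?_⟩
  obtain ⟨h1, h2⟩ := mem_vecs.1 e.prop
  rcases lt_or_ge j (m e.fst) with hj | hj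
  · exact (h2 j hj).le
  · rw [List.getD_eq_default _ _ (by omega)]
    exact Nat.zero_le _

theorem Bdd.vecs {B m : ι → ℕ} (hB : CompP B) (hm : CompP m) :
    Bdd fun i => (vecs (B i) (m i)).length := by
  simp only [length_vecs]
  exact (hB.pow hm).compN.bdd

/-- As for powers, a counter in the accumulator makes the invariant strong enough: it pins the list
to the stage reached, which bounds its length. -/
theorem Comp.vecs {B m : ι → ℕ} (hB : CompP B) (hm : CompP m) :
    Comp fun i => vecs (B i) (m i) := by
  let step : ι → List (List ℕ) → List (List ℕ) := fun i L =>
    L.flatMap fun l => (List.range (B i)).map fun a => a :: l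
  let f : ι → ℕ × List (List ℕ) → ℕ × List (List ℕ) := fun i p =>
    if decide (p.1 < m i) then (p.1 + 1, step i p.2) else p
  let Inv : ι → ℕ × List (List ℕ) → Prop := fun i p => p.1 ≤ m i ∧ p.2 = OLA.vecs (B i) p.1
  have hstep : ∀ i t, step i (OLA.vecs (B i) t) = OLA.vecs (B i) (t + 1) := fun i t => by
    simp only [step, OLA.vecs, Function.iterate_succ_apply']
  have hlen : Bdd fun e : Ext ι (ℕ × List (List ℕ)) Inv => e.snd.2.length := by
    refine ((hB.add (.const 1)).pow hm).compN.bdd.ext.mono fun e => ?_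
    rw [e.prop.2, length_vecs]
    exact (Nat.pow_le_pow_left (Nat.le_succ _) _).trans
      (Nat.pow_le_pow_right (Nat.succ_pos _) e.prop.1)
  have hc : Comp fun i => (f i)^[m i] (0, [[]]) := by
    refine Comp.iterate Inv hm.compN (Comp.zero.pair (.cons .empty .empty))
      (fun i => ⟨Nat.zero_le _, rfl⟩) (fun i p hp => ?_) ?_
    · by_cases hlt : p.1 < m i
      · simp only [f, hlt, decide_true, if_true, Inv]
        exact ⟨hlt, by rw [hp.2, hstep]⟩
      · simpa [f, hlt] using hp
    · have h₁ : CompN fun e : Ext ι (ℕ × List (List ℕ)) Inv => e.snd.1 :=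
        ⟨Comp.var.proj₁, hm.compN.bdd.ext.mono fun e => e.prop.1⟩
      refine .cond (h₁.lt hm.compN.ext) (h₁.comp.succ.pair ?_) .var
      refine Comp.flatMap (L := fun e : Ext ι (ℕ × List (List ℕ)) Inv => e.snd.2)
        (f := fun e l => (List.range (B e.fst)).map fun a => a :: l) Comp.var.proj₂ hlen ?_ ?_
      · exact Comp.mapRange hB.compN.ext.ext (.cons .var (Comp.ext .var))
      · simpa using hB.compN.bdd.ext.ext
  refine hc.proj₂.congr fun i => ?_
  have key : ∀ t ≤ m i, (f i)^[t] (0, [[]]) = (t, OLA.vecs (B i) t) := by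
    intro t ht
    induction t with
    | zero => rfl
    | succ t ih =>
      rw [Function.iterate_succ_apply', ih (by omega)]
      simp only [f, show t < m i by omega, decide_true, if_true, hstep]
  rw [key _ le_rfl]

end Ranges

/-! ### Computability of twin classes, energies and tests. -/

section Graphs

variable {ι α : Type} [Ctx ι] [Enc α]

theorem Comp.entry {A : ι → List (List ℕ)} {u v : ι → ℕ} (hA : Comp A) (hu : CompN u)
    (hv : CompN v) : Comp fun i => entry (A i) (u i) (v i) :=
  .getD (.getD hA hu [] rfl) hv 0 rfl

/-- Computable matrices of zeros and ones, with their sizes. -/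
structure CompM (A : ι → List (List ℕ)) (n : ι → ℕ) : Prop where
  comp : Comp A
  le_one : ∀ i u v, OLA.entry (A i) u v ≤ 1
  size : CompN n

variable {A : ι → List (List ℕ)} {n k : ι → ℕ}

theorem CompM.ext (h : CompM A n) {P : ι → α → Prop} :
    CompM (fun e : Ext ι α P => A e.fst) (fun e : Ext ι α P => n e.fst) :=
  ⟨h.comp.ext, fun e => h.le_one e.fst, h.size.ext⟩

theorem CompM.entry (h : CompM A n) {u v : ι → ℕ} (hu : CompN u) (hv : CompN v) :
    CompN fun i => OLA.entry (A i) (u i) (v i) :=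
  ⟨.entry h.comp hu hv, (Bdd.const 1).mono fun i => h.le_one i _ _⟩

theorem CompM.twin (h : CompM A n) {u v : ι → ℕ} (hu : CompN u) (hv : CompN v) :
    Comp fun i => twin (A i) (n i) (u i) (v i) :=
  .allRange h.size (CompN.eq (h.ext.entry hu.ext h.size.index) (h.ext.entry hv.ext h.size.index))

theorem CompM.reps (h : CompM A n) : Comp fun i => reps (A i) (n i) :=
  .filterRange h.size (.allRange h.size.index
    (.not (h.ext.ext.twin h.size.index.index h.size.index.ext)))

theorem CompM.bdd_reps (h : CompM A n) : Bdd fun i => (OLA.reps (A i) (n i)).length :=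
  .filter h.size.bdd_range

theorem CompM.classSize (h : CompM A n) {s : ι → ℕ} (hs : CompN s) :
    CompN fun i => classSize (A i) (n i) (s i) :=
  .countRange h.size (h.ext.twin hs.ext h.size.index)

theorem CompN.coeff {a b c : ι → ℕ} (ha : CompN a) (hb : CompN b) (hc : CompN c) :
    CompN fun i => coeff (a i) (b i) (c i) :=
  (CompN.cond (ha.lt hb) (.cond ((ha.lt hc).and (hc.lt hb)) (.const 2)
    (.cond ((hc.eq ha).or (hc.eq hb)) (.const 1) (.const 0))) (.const 0)).congr fun i => by
      simp [OLA.coeff]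

variable {lab x g z : ι → List ℕ}

/-- Computable matrices together with the labels of blocks and the parameter. -/
structure CompB (A : ι → List (List ℕ)) (n k : ι → ℕ) (lab : ι → List ℕ) : Prop extends
    CompM A n where
  param : CompP k
  labels : CompV lab
  length : CompP fun i => (lab i).length

theorem CompB.ext (h : CompB A n k lab) {P : ι → α → Prop} :
    CompB (fun e : Ext ι α P => A e.fst) (fun e : Ext ι α P => n e.fst)
      (fun e : Ext ι α P => k e.fst) (fun e : Ext ι α P => lab e.fst) :=
  ⟨h.toCompM.ext, h.param.ext, h.labels.ext, h.length.ext⟩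

theorem CompB.energy (h : CompB A n k lab) (hx : CompV x) :
    CompN fun i => energy (A i) (lab i) (x i) := by
  have hm := h.length.compN
  refine .sumRange hm (.sumRange hm.ext (.sumRange hm.ext.ext ?_))
  have hi := (hm.index.ext (P := fun i a => a ∈ List.range (lab i.fst).length)).ext
    (P := fun i a => a ∈ List.range (lab i.fst.fst).length)
  have hj := (hm.ext (P := fun i a => a ∈ List.range (lab i).length)).index.ext
    (P := fun i a => a ∈ List.range (lab i.fst.fst).length)
  have hl := ((hm.ext (P := fun i a => a ∈ List.range (lab i).length)).ext
    (P := fun i a => a ∈ List.range (lab i.fst).length)).index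
  exact .mul (.mul (.mul (.mul (h.toCompM.ext.ext.ext.entry (h.labels.ext.ext.ext.getD hi)
    (h.labels.ext.ext.ext.getD hj)) (.coeff hi hj hl)) (hx.ext.ext.ext.getD hi))
    (hx.ext.ext.ext.getD hj)) (hx.ext.ext.ext.getD hl)

theorem CompB.isFree (h : CompB A n k lab) (hg : CompV g) {j : ι → ℕ} (hj : CompN j) :
    Comp fun i => isFree (k i) (lab i).length (g i) (j i) :=
  CompN.eq (hg.getD hj) (.add (h.param.smallBound h.length).compN (.const 1))

theorem CompB.merge (h : CompB A n k lab) (hg : CompV g) (hz : CompV z) :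
    CompV fun i => merge (k i) (lab i).length (g i) (z i) :=
  have hj := h.length.compN.index
  .mapRange h.length.compN (.cond (h.ext.isFree hg.ext hj) (hz.ext.getD hj) (hg.ext.getD hj))

theorem CompB.bump (h : CompB A n k lab) (hz : CompV z) {a : ι → ℕ} (ha : CompN a) :
    CompV fun i => bump (lab i).length (z i) (a i) :=
  have hj := h.length.compN.index
  .mapRange h.length.compN (.add (hz.ext.getD hj) (.cond (hj.eq ha.ext) (.const 1) (.const 0)))

theorem CompB.double (h : CompB A n k lab) (hz : CompV z) (hx : CompV x) :
    CompV fun i => double (lab i).length (z i) (x i) :=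
  have hj := h.length.compN.index
  .mapRange h.length.compN (.add (.mul (.const 2) (hz.ext.getD hj)) (hx.ext.getD hj))

theorem CompB.freeSum (h : CompB A n k lab) (hg : CompV g) (hz : CompV z) {a : ι → ℕ}
    (ha : CompN a) : CompN fun i => freeSum (k i) (lab i) (g i) (z i) (a i) :=
  have hj := h.length.compN.index
  .sumRange h.length.compN (.cond (.and (h.ext.isFree hg.ext hj)
    (CompN.eq (h.labels.ext.getD hj) (h.labels.ext.getD ha.ext))) (hz.ext.getD hj) (.const 0))

theorem CompB.testSums (h : CompB A n k lab) (hg : CompV g) (hz : CompV z) {t : ι → ℕ}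
    (ht : CompN t) :
    Comp fun i => testSums (A i) (n i) (k i) (lab i) (g i) (t i) (z i) :=
  have hj := h.length.compN.index
  have hs := h.ext.freeSum hg.ext hz.ext hj
  have hc := ht.ext.halves (h.toCompM.ext.classSize (h.labels.ext.getD hj))
  have hD := (h.param.slack h.length).compN.ext
  .allRange h.length.compN (.cond (h.ext.isFree hg.ext hj)
    (.and (CompN.le hs (.add hc hD)) (CompN.le hc (.add hs hD))) (CompN.eq (hz.ext.getD hj) (.const 0)))

theorem CompB.testEnergy (h : CompB A n k lab) (hg : CompV g) (hz : CompV z) :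
    Comp fun i => testEnergy (A i) (k i) (lab i) (g i) (z i) :=
  have hm := h.length.compN
  have ha := hm.index.ext (P := fun i a => a ∈ List.range (lab i.fst).length)
  have hb := (hm.ext (P := fun i a => a ∈ List.range (lab i).length)).index
  have h' := h.ext.ext
  .allRange hm (.allRange hm.ext (.or (.not (.and (h'.isFree hg.ext.ext ha)
    (.and (h'.isFree hg.ext.ext hb) (CompN.eq (h'.labels.getD ha) (h'.labels.getD hb)))))
    (CompN.le (h'.energy (h'.merge hg.ext.ext (h'.bump hz.ext.ext ha)))
      (.add (h'.energy (h'.merge hg.ext.ext (h'.bump hz.ext.ext hb)))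
        (h'.param.slack h'.length).compN))))

end Graphs

end FPT

namespace OLA

/-! ### Size bounds for the search, valid for every input and guess. -/

section Bounds

variable {A : List (List ℕ)} {n k : ℕ} {lab g : List ℕ}

theorem classSize_le (A : List (List ℕ)) (n s : ℕ) : classSize A n s ≤ n :=
  (List.length_filter_le _ _).trans_eq (by simp)

theorem cap_pos (k m : ℕ) : 0 < cap k m := by
  unfold cap
  positivity

/-- A free entry is at most its class sum, which the test bounds by the scaled class size plus the
slack; other entries are tested to be zero. -/
theorem getD_le_of_testSums {t : ℕ} {z : List ℕ} (hz : z.length = lab.length)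
    (h : testSums A n k lab g t z = true) (j : ℕ) : z.getD j 0 ≤ n + slack k lab.length := by
  rcases lt_or_ge j lab.length with hj | hj
  · have h1 := List.all_eq_true.1 h j (List.mem_range.2 hj)
    by_cases hf : isFree k lab.length g j = true
    · simp only [hf, if_true, Bool.and_eq_true, decide_eq_true_eq] at h1
      have h2 : z.getD j 0 ≤ freeSum k lab g z j := by
        refine List.single_le_sum (fun _ _ => Nat.zero_le _) _ (List.mem_map.2
          ⟨j, List.mem_range.2 hj, ?_⟩)
        simp [hf]
      have h3 : (· / 2)^[t] (classSize A n (lab.getD j 0)) ≤ n := by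
        rw [iterate_half]
        exact (Nat.div_le_self _ _).trans (classSize_le _ _ _)
      omega
    · simp only [hf] at h1
      simp at h1
      simp [h1]
  · rw [List.getD_eq_default _ _ (by omega)]
    exact Nat.zero_le _

/-- The invariant of the search. -/
def SearchInv (n k m : ℕ) (L : List (List ℕ)) : Prop :=
  L.length ≤ cap k m ∧ ∀ z ∈ L, ∀ j, z.getD j 0 ≤ n + slack k m

theorem searchInv_init (n k m : ℕ) : SearchInv n k m [List.replicate m 0] := by
  refine ⟨cap_pos _ _, fun z hz j => ?_⟩
  rw [List.mem_singleton.1 hz]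
  simp

/-- Nothing is needed about the incoming list: truncation bounds the length and the class-sum test
bounds the entries. -/
theorem searchInv_refineStep (A : List (List ℕ)) (n k : ℕ) (lab g : List ℕ) (t : ℕ)
    (L : List (List ℕ)) : SearchInv n k lab.length (refineStep A n k lab g t L) := by
  unfold refineStep
  dsimp only
  split_ifs with h
  · refine ⟨of_decide_eq_true h, fun z hz => ?_⟩
    obtain ⟨h1, h2⟩ := List.mem_filter.1 hz
    rw [Bool.and_eq_true] at h2
    refine getD_le_of_testSums ?_ h2.1
    obtain ⟨y, -, hy⟩ := List.mem_flatMap.1 h1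
    obtain ⟨b, -, rfl⟩ := List.mem_map.1 hy
    simp [double]
  · exact ⟨Nat.zero_le _, by simp⟩

theorem searchInv_search (A : List (List ℕ)) (n k : ℕ) (lab g : List ℕ) :
    SearchInv n k lab.length (search A n k lab g) := by
  unfold search
  cases List.range n with
  | nil => exact searchInv_init _ _ _
  | cons t l => exact searchInv_refineStep _ _ _ _ _ _ _

theorem length_candidates_le (A : List (List ℕ)) (n k : ℕ) (lab : List ℕ) :
    (candidates A n k lab).length ≤
      (smallBound k lab.length + 2) ^ lab.length * cap k lab.length := by
  unfold candidates
  rw [List.length_flatMap, ← length_vecs]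
  refine (List.sum_le_card_nsmul _ (cap k lab.length) fun a ha => ?_).trans_eq (by simp)
  obtain ⟨g, -, rfl⟩ := List.mem_map.1 ha
  refine (List.length_filter_le _ _).trans ?_
  rw [List.length_map]
  exact (searchInv_search A n k lab g).1

theorem getD_le_of_mem_candidates {x : List ℕ} (hx : x ∈ candidates A n k lab) (j : ℕ) :
    x.getD j 0 ≤ n := by
  obtain ⟨g, -, hg⟩ := List.mem_flatMap.1 hx
  obtain ⟨h1, h2⟩ := List.mem_filter.1 hg
  obtain ⟨z, -, rfl⟩ := List.mem_map.1 h1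
  rcases lt_or_ge j lab.length with hj | hj
  · have h3 := of_decide_eq_true (List.all_eq_true.1 h2 j (List.mem_range.2 hj))
    refine le_trans ?_ (h3.le.trans (classSize_le _ _ _))
    refine List.single_le_sum (fun _ _ => Nat.zero_le _) _ (List.mem_map.2
      ⟨j, List.mem_range.2 hj, ?_⟩)
    simp
  · rw [List.getD_eq_default _ _ (by simpa [merge] using hj)]
    exact Nat.zero_le _

end Bounds

end OLA

namespace FPT

open Enc (enc)
open OLA

/-! ### Assembly of the program. -/

section Solve

variable {ι α : Type} [Ctx ι] [Enc α] {A : ι → List (List ℕ)} {n k : ι → ℕ} {lab x g : ι → List ℕ}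

theorem CompB.refineStep (h : CompB A n k lab) (hg : CompV g) {t : ι → ℕ} (ht : CompN t)
    {L : ι → List (List ℕ)} (hL : Comp L)
    (hLi : ∀ i, OLA.SearchInv (n i) (k i) (lab i).length (L i)) :
    Comp fun i => refineStep (A i) (n i) (k i) (lab i) (g i) (t i) (L i) := by
  have hcap := (h.param.cap h.length).compN
  have hD := (h.param.slack h.length).compN
  have hlen : Bdd fun i => (L i).length := hcap.bdd.mono fun i => (hLi i).1
  have hz : CompV fun e : ElemCtx L => e.snd :=
    ⟨.var, fun e => n e.fst + slack (k e.fst) (lab e.fst).length, (h.size.add hD).bdd.ext,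
      fun e => (hLi e.fst).2 _ e.prop⟩
  have h2 : CompP fun _ : ι => 2 := .const 2
  have hbits : Bdd fun i => (vecs 2 (lab i).length).length := Bdd.vecs h2 h.length
  have hexp : Comp fun i => expand (lab i).length (L i) := by
    refine .flatMap hL hlen (.map (Comp.vecs h2 h.length).ext hbits.ext ?_) ?_
    · exact (h.ext.ext.double hz.ext
        (CompV.elem_vecs (B := fun e : ElemCtx L => 2) (.const 2))).comp
    · simpa using hbits.ext
  have hexpl : Bdd fun i => (expand (lab i).length (L i)).length :=
    Bdd.flatMap hlen hbits fun i z _ => by simp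
  -- Entries are doubled and a digit is added before the filter reduces them again.
  have hv : CompV fun e : ElemCtx (fun i => expand (lab i).length (L i)) => e.snd := by
    refine ⟨.var, fun e => 2 * (n e.fst + slack (k e.fst) (lab e.fst).length) + 2,
      (((CompN.const 2).mul (h.size.add hD)).add (.const 2)).bdd.ext, fun e => ?_⟩
    obtain ⟨y, hy, hy'⟩ := List.mem_flatMap.1 e.prop
    obtain ⟨b, hb, hb'⟩ := List.mem_map.1 hy'
    rw [← hb']
    refine getD_map_range_le fun j hj => ?_
    have h3 := (hLi e.fst).2 y hy j
    have h4 := (mem_vecs.1 hb).2 j hj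
    dsimp only
    omega
  have hfil : Comp fun i => (expand (lab i).length (L i)).filter fun z =>
      OLA.testSums (A i) (n i) (k i) (lab i) (g i) (t i) z &&
        OLA.testEnergy (A i) (k i) (lab i) (g i) z :=
    .filter hexp hexpl (.and (h.ext.testSums hg.ext hv ht.ext) (h.ext.testEnergy hg.ext hv))
  exact .cond (CompN.le (.length hfil (.filter hexpl)) hcap) hfil .empty

theorem CompB.search (h : CompB A n k lab) (hg : CompV g) :
    Comp fun i => search (A i) (n i) (k i) (lab i) (g i) := by
  refine Comp.foldr (L := fun i => List.range (n i))
    (f := fun i t L => OLA.refineStep (A i) (n i) (k i) (lab i) (g i) t L)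
    (fun i L => OLA.SearchInv (n i) (k i) (lab i).length L) (.range h.size) h.size.bdd_range
    (.cons (.replicate h.length.compN .zero) .empty) (fun i => OLA.searchInv_init _ _ _)
    (fun i t _ L _ => OLA.searchInv_refineStep _ _ _ _ _ _ _) ?_
  exact h.ext.refineStep hg.ext ⟨Comp.var.proj₁, h.size.bdd.ext.mono fun e =>
    (List.mem_range.1 e.prop.1).le⟩ Comp.var.proj₂ fun e => e.prop.2

theorem CompB.fits (h : CompB A n k lab) (hx : CompV x) :
    Comp fun i => fits (A i) (n i) (lab i) (x i) := by
  have hm := h.length.compN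
  have ha := hm.index.ext (P := fun i a => a ∈ List.range (lab i.fst).length)
  have hb := (hm.ext (P := fun i a => a ∈ List.range (lab i).length)).index
  exact .allRange hm (CompN.eq (.sumRange hm.ext (.cond (CompN.eq (h.labels.ext.ext.getD hb)
    (h.labels.ext.ext.getD ha)) (hx.ext.ext.getD hb) (.const 0)))
    (h.toCompM.ext.classSize (h.labels.ext.getD hm.index)))

theorem CompB.candidates (h : CompB A n k lab) :
    Comp fun i => candidates (A i) (n i) (k i) (lab i) := by
  have hB := CompP.add (h.param.smallBound h.length) (.const 2)
  have hD := (h.param.slack h.length).compN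
  have hcap := (h.param.cap h.length).compN
  have hg := CompV.elem_vecs (m := fun i => (lab i).length) hB.compN.bdd
  have hs := h.ext.search hg
  have hl : Bdd fun e : ElemCtx (fun i =>
      vecs (smallBound (k i) (lab i).length + 2) (lab i).length) =>
      (OLA.search (A e.fst) (n e.fst) (k e.fst) (lab e.fst) e.snd).length :=
    hcap.bdd.ext.mono fun e => (OLA.searchInv_search _ _ _ _ _).1
  refine .flatMap (.vecs hB h.length) (.vecs hB h.length) (.filter (.map hs hl ?_) (by simpa using hl)
    ?_) (.filter (by simpa using hl))
  · refine (h.ext.ext.merge hg.ext ⟨.var, fun e =>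
      n e.fst.fst + slack (k e.fst.fst) (lab e.fst.fst).length, (h.size.add hD).bdd.ext.ext,
      fun e => (OLA.searchInv_search _ _ _ _ _).2 _ e.prop⟩).comp
  · refine h.ext.ext.fits ⟨.var, fun e => n e.fst.fst + slack (k e.fst.fst) (lab e.fst.fst).length +
      (smallBound (k e.fst.fst) (lab e.fst.fst).length + 2),
      ((h.size.add hD).add hB.compN).bdd.ext.ext, fun e => ?_⟩
    obtain ⟨z, hz, hz'⟩ := List.mem_map.1 e.prop
    rw [← hz']
    refine getD_map_range_le fun j hj => ?_
    have h3 := (OLA.searchInv_search _ _ _ _ _).2 z hz j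
    have h4 := (mem_vecs.1 e.fst.prop).2 j hj
    dsimp only
    split_ifs <;> omega

theorem CompB.best (h : CompB A n k lab) :
    CompV fun i => best (A i) (lab i) (OLA.candidates (A i) (n i) (k i) (lab i)) := by
  have hc := h.candidates
  have hlen : Bdd fun i => (OLA.candidates (A i) (n i) (k i) (lab i)).length :=
    ((((h.param.smallBound h.length).add (.const 2)).pow h.length).mul
      (h.param.cap h.length)).compN.bdd.mono fun i => OLA.length_candidates_le _ _ _ _
  have h0 : ∀ i j, ((OLA.candidates (A i) (n i) (k i) (lab i)).headD []).getD j 0 ≤ n i := by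
    intro i j
    cases e : OLA.candidates (A i) (n i) (k i) (lab i) with
    | nil => simp
    | cons x L =>
      exact OLA.getD_le_of_mem_candidates (by rw [e]; exact List.mem_cons_self) j
  have hInv : ∀ i, ∀ x ∈ OLA.candidates (A i) (n i) (k i) (lab i), ∀ b : List ℕ,
      (∀ j, b.getD j 0 ≤ n i) → ∀ j,
      (if decide (OLA.energy (A i) (lab i) x ≤ OLA.energy (A i) (lab i) b) then x else b).getD j 0 ≤
        n i := by
    intro i x hx b hb
    split_ifs
    · exact OLA.getD_le_of_mem_candidates hx
    · exact hb
  refine ⟨Comp.foldl (s := fun i => (OLA.candidates (A i) (n i) (k i) (lab i)).headD [])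
    (f := fun i b x => if decide (OLA.energy (A i) (lab i) x ≤ OLA.energy (A i) (lab i) b) then x else b)
    (fun i b => ∀ j, b.getD j 0 ≤ n i) hc hlen (.headD hc [] rfl) h0 hInv ?_, n, h.size.bdd,
    fun i => ?_⟩
  · exact .cond (CompN.le
      (h.ext.energy ⟨Comp.var.proj₁, fun e => n e.fst, h.size.bdd.ext, fun e =>
        OLA.getD_le_of_mem_candidates e.prop.1⟩)
      (h.ext.energy ⟨Comp.var.proj₂, fun e => n e.fst, h.size.bdd.ext, fun e => e.prop.2⟩))
      Comp.var.proj₁ Comp.var.proj₂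
  · exact List.foldlRecOn (motive := fun b : List ℕ => ∀ j, b.getD j 0 ≤ n i) _ _ (h0 i)
      fun b hb x hx => hInv i x hx b hb

theorem CompB.blockIndex (h : CompB A n k lab) (hx : CompV x) {v : ι → ℕ} (hv : CompN v) :
    CompN fun i => blockIndex (A i) (n i) (lab i) (x i) (v i) := by
  have hm := h.length.compN
  have hj := CompN.add hm.index (.const 1)
  exact .countRange hm (CompN.le (.sumRange hj (.cond (h.toCompM.ext.ext.twin
    (h.labels.ext.ext.getD hj.index) hv.ext.ext) (hx.ext.ext.getD hj.index) (.const 0)))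
    (.countRange hv.ext (h.toCompM.ext.ext.twin hv.ext.index hv.ext.ext)))

theorem CompB.positions (h : CompB A n k lab) (hx : CompV x) :
    Comp fun i => positions (A i) (n i) (lab i) (x i) := by
  have hv := h.size.index.ext (P := fun i a => a ∈ List.range (n i.fst))
  have hw := (h.size.ext (P := fun i a => a ∈ List.range (n i))).index
  have hbv := h.ext.ext.blockIndex hx.ext.ext hv
  have hbw := h.ext.ext.blockIndex hx.ext.ext hw
  exact .mapRange h.size (CompN.countRange h.size.ext
    (.or (hbw.lt hbv) (.and (hbw.eq hbv) (hw.lt hv)))).comp.succ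

/-- The bound on the number of classes is what makes the number of blocks a function of the
parameter, as all later bounds require. -/
theorem CompM.blocks (h : CompM A n) (hk : CompP k)
    (hr : ∀ i, (OLA.reps (A i) (n i)).length ≤ k i + 2 ^ k i) :
    CompB A n k fun i => labels (A i) (n i) (k i) := by
  have hrl : CompP fun i => (OLA.reps (A i) (n i)).length :=
    ⟨(CompN.length h.reps h.bdd_reps).comp, (hk.add (.pow (.const 2) hk)).pbdd.mono hr⟩
  have hN : CompP fun i => 2 * (k i + 1) * (OLA.reps (A i) (n i)).length + 1 :=
    .add (.mul (.mul (.const 2) (.add hk (.const 1))) hrl) (.const 1)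
  have hl : ∀ i, (labels (A i) (n i) (k i)).length =
      (2 * (k i + 1) * (OLA.reps (A i) (n i)).length + 1) * (OLA.reps (A i) (n i)).length :=
    fun i => by simp [labels]
  have hc : Comp fun i => labels (A i) (n i) (k i) := by
    refine (Comp.flatMap (L := fun i => List.replicate
      (2 * (k i + 1) * (OLA.reps (A i) (n i)).length + 1) (OLA.reps (A i) (n i)))
      (f := fun _ a => a) (.replicate hN.compN h.reps) (by simpa using hN.compN.bdd) .var
      (hrl.compN.bdd.ext.mono fun e => ?_)).congr fun i => ?_
    · rw [List.eq_of_mem_replicate e.prop]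
    · simp [labels, List.flatMap_id']
  refine ⟨h, hk, ⟨hc, n, h.size.bdd, fun i j => ?_⟩,
    (CompN.length hc ((hN.mul hrl).compN.bdd.mono fun i => (hl i).le)).comp,
    (hN.mul hrl).pbdd.mono fun i => (hl i).le⟩
  rcases lt_or_ge j (labels (A i) (n i) (k i)).length with hj | hj
  · rw [List.getD_eq_getElem _ _ hj]
    obtain ⟨l, hl, hl'⟩ := List.mem_flatten.1 (List.getElem_mem hj)
    rw [List.eq_of_mem_replicate hl] at hl'
    exact (List.mem_range.1 (List.mem_filter.1 hl').1).le
  · rw [List.getD_eq_default _ _ hj]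
    exact Nat.zero_le _

/-- Lazy branching is essential: the main branch has a fixed-parameter time bound only on instances
that pass the test on the number of classes. -/
theorem CompM.solve (h : CompM A n) (hk : CompP k) :
    Comp fun i => solve (A i) (n i) (k i) := by
  refine .dcond (CompN.le (.length h.reps h.bdd_reps) (hk.add (.pow (.const 2) hk)).compN) ?_ ?_
  · have hB := h.ext.blocks (k := fun e => k e.fst) hk.ext
      (fun e : Ext ι Bool (fun i _ => decide ((OLA.reps (A i) (n i)).length ≤ k i + 2 ^ k i) = true)
        => of_decide_eq_true e.prop)
    exact (hB.positions hB.best).congr fun e => if_pos e.prop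
  · exact Comp.empty.congr fun e => if_neg (by rw [e.prop]; exact Bool.false_ne_true)

end Solve

/-- A graph on `{0, …, n - 1}` together with a parameter. -/
structure GraphInput where
  n : ℕ
  k : ℕ
  G : SimpleGraph (Fin n)

noncomputable instance : Ctx GraphInput where
  size i := i.n
  param i := i.k
  inp i := encodeInput i.G i.k

theorem enc_ofFn {α : Type} [Enc α] {n : ℕ} (f : Fin n → α) :
    enc (List.ofFn f) = Data.ofList (List.ofFn fun i => enc (f i)) :=
  congrArg Data.ofList List.map_ofFn

theorem enc_rows {n : ℕ} (G : SimpleGraph (Fin n)) : enc (rows G) = encodeGraph G := by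
  rw [rows, enc_ofFn]
  simp only [enc_ofFn]
  rfl

/-- A three-element list is a nested pair ending in a singleton list, so the input components are
reached by projections. -/
theorem encodeInput_eq {n : ℕ} (G : SimpleGraph (Fin n)) (k : ℕ) :
    encodeInput G k = enc (n, k, [rows G]) := by
  change _ = Data.cons _ (Data.cons _ (Data.cons (enc (rows G)) _))
  rw [enc_rows]
  rfl

theorem comp_solve : Comp fun i : GraphInput => solve (rows i.G) i.n i.k := by
  have h : Comp fun i : GraphInput => (i.n, i.k, [rows i.G]) :=
    Comp.instance_datum.recode fun i => (encodeInput_eq i.G i.k).symm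
  exact CompM.solve (A := fun i : GraphInput => rows i.G)
    ⟨h.proj₂.proj₂.headD [] rfl, fun i => entry_rows_le i.G, h.proj₁, .size⟩ ⟨h.proj₂.proj₁, .param⟩

end FPT

theorem mainTheorem3 :
    ∃ (P : Prog) (f : ℕ → ℕ) (c : ℕ), ∀ (n k : ℕ) (G : SimpleGraph (Fin n)),
      ∃ (out : Data) (t : ℕ),
        Prog.Eval P (OLA.encodeInput G k) out t ∧
        t ≤ f k * (n + 1) ^ c ∧
        ((∃ C : Finset (Fin n), C.card ≤ k ∧ G.IsVertexCover (C : Set (Fin n))) →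
          ∃ σ : Equiv.Perm (Fin n), OLA.IsOptimal G σ ∧ out = OLA.encodeLayout σ) := by
  obtain ⟨P, T, ⟨f, c, hT⟩, hP⟩ := FPT.comp_solve
  refine ⟨P, f, c, fun n k G => ?_⟩
  obtain ⟨t, ht, h⟩ := hP ⟨n, k, G⟩
  refine ⟨_, t, h, ht.trans (hT ⟨n, k, G⟩), ?_⟩
  rintro ⟨C, hk, hC⟩
  obtain ⟨σ, hσ, hs⟩ := OLA.solve_spec G hC hk
  refine ⟨σ, hσ, ?_⟩
  dsimp only
  rw [hs, FPT.enc_ofFn]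
  rfl
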